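/- Let $L_2(0,\pi)$ be the space of complex-valued square-integrable functions on $(0,\pi)$ with norm $\|\cdot\|$, and let $L_{2,\pi}$ be the space of complex-valued functions $f$ on $(0,\pi)$ with $(\pi-x)f(x)\in L_2(0,\pi)$, with norm $\|f\|_{2,\pi}=\|(\pi-\cdot)f\|$. For $q\in L_2(0,\pi)$ and $M\in L_{2,\pi}$ let $P(x,t)=P(x,t;q,M)$ be the continuous solution, on the triangle $0\le t\le x\le\pi$, of the linear integral equation $$ \begin{aligned} P(x,t)=\frac12\Big(&\int_{t/2}^{x-t/2}q(s)\,ds+\int_0^t(x-t)M(s)\,ds+\int_t^xq(s)\int_0^tP(s,\xi)\,d\xi\,ds\\ &+\int_{t/2}^tq(s)\int_0^{2s-t}P(s,\xi)\,d\xi\,ds-\int_{x-t/2}^xq(s)\int_0^{2(s-x)+t}P(s,\xi)\,d\xi\,ds\\ &+\int_0^tM(s)\int_t^x\int_0^{t-s}P(\xi-s,\eta)\,d\eta\,d\xi\,ds+\int_0^tM(s)\int_{(t+s)/2}^t\int_0^{2\xi-t-s}P(\xi-s,\eta)\,d\eta\,d\xi\,ds\\ &-\int_0^tM(s)\int_{(s-t)/2+x}^x\int_0^{2(\xi-x)+t-s}P(\xi-s,\eta)\,d\eta\,d\xi\,ds\Big),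 \end{aligned} $$ and let $R(x,t;q,M)=\frac{\partial}{\partial t}P(x,t;q,M)$. Given $q,v\in L_2(0,\pi)$, consider the main nonlinear equation $$-v(\pi-x)=R(\pi,x;q,M)\quad\text{for almost every }x\in(0,\pi)\qquad(*)$$ with respect to the unknown function $M$. **Theorem 4.** (i) For any complex-valued functions $q,v\in L_2(0,\pi)$ satisfying $$\int_0^\pi v(x)\,dx=\frac12\int_0^\pi q(x)\,dx,\qquad(**)$$ equation $(*)$ has a solution $M\in L_{2,\pi}$, and it is unique up to values on a set of measure zero. (ii) For every $r>0$ there is a constant $C_r>0$, depending only on $r$, such that for all $q,v\in L_2(0,\pi)$ satisfying $(**)$, $\|v\|\le r$ and $\|q\|\le r$, the solution $M\in L_{2,\pi}$ of $(*)$ satisfies $\|M\|_{2,\pi}\le C_r$. -/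

import Mathlib

open MeasureTheory Set

/-- Lebesgue measure on the interval `(0, π)`. -/
noncomputable def volPi : Measure ℝ := volume.restrict (Ioo 0 Real.pi)

/-- `f ∈ L₂(0, π)` for a complex-valued function `f`; only the values on `(0, π)` matter. -/
def MemL2 (f : ℝ → ℂ) : Prop := MemLp f 2 volPi

/-- The norm of `L₂(0, π)`, with values in `[0, ∞]`. -/
noncomputable def normL2 (f : ℝ → ℂ) : ENNReal := eLpNorm f 2 volPi

/-- `f ∈ L_{2,π}`, that is, `(π - x) f(x) ∈ L₂(0, π)`. -/
def MemL2Pi (f : ℝ → ℂ) : Prop := MemL2 fun x => ((Real.pi - x : ℝ) : ℂ) * f x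

/-- The norm `‖f‖_{2,π} = ‖(π - ·) f‖` of `L_{2,π}`, with values in `[0, ∞]`. -/
noncomputable def normL2Pi (f : ℝ → ℂ) : ENNReal :=
  normL2 fun x => ((Real.pi - x : ℝ) : ℂ) * f x

/-- The closed triangle `0 ≤ t ≤ x ≤ π` of points `(x, t)`. -/
def triangle : Set (ℝ × ℝ) := {p | 0 ≤ p.2 ∧ p.2 ≤ p.1 ∧ p.1 ≤ Real.pi}

/-- The free term of the integral equation for the transformation kernel. -/
noncomputable def kernelFreeTerm (q M : ℝ → ℂ) (x t : ℝ) : ℂ :=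
  (1 / 2 : ℂ) * ((∫ s in (t / 2)..(x - t / 2), q s)
    + ∫ s in (0 : ℝ)..t, ((x - t : ℝ) : ℂ) * M s)

/-- The linear integral operator (acting on `P`) of the equation for the transformation kernel. -/
noncomputable def kernelOperator (q M : ℝ → ℂ) (P : ℝ → ℝ → ℂ) (x t : ℝ) : ℂ :=
  (1 / 2 : ℂ) *
    ((∫ s in t..x, q s * ∫ ξ in (0 : ℝ)..t, P s ξ)
    + (∫ s in (t / 2)..t, q s * ∫ ξ in (0 : ℝ)..(2 * s - t), P s ξ)
    - (∫ s in (x - t / 2)..x, q s * ∫ ξ in (0 : ℝ)..(2 * (s - x) + t), P s ξ)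
    + (∫ s in (0 : ℝ)..t, M s * ∫ ξ in t..x, ∫ η in (0 : ℝ)..(t - s), P (ξ - s) η)
    + (∫ s in (0 : ℝ)..t, M s *
        ∫ ξ in ((t + s) / 2)..t, ∫ η in (0 : ℝ)..(2 * ξ - t - s), P (ξ - s) η)
    - (∫ s in (0 : ℝ)..t, M s *
        ∫ ξ in ((s - t) / 2 + x)..x, ∫ η in (0 : ℝ)..(2 * (ξ - x) + t - s), P (ξ - s) η))

/-- `P` is the transformation kernel `P(x, t; q, M)`: the continuous solution on the triangle
`0 ≤ t ≤ x ≤ π` of its integral equation. Values of `P` off the triangle are irrelevant. -/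
def IsTransformationKernel (q M : ℝ → ℂ) (P : ℝ → ℝ → ℂ) : Prop :=
  ContinuousOn (fun p : ℝ × ℝ => P p.1 p.2) triangle ∧
  ∀ x t : ℝ, 0 ≤ t → t ≤ x → x ≤ Real.pi →
    P x t = kernelFreeTerm q M x t + kernelOperator q M P x t

/-- `M ∈ L_{2,π}` solves the main nonlinear equation `-v(π - x) = R(π, x; q, M)`, `0 < x < π`,
where `R(x, t; q, M) = ∂/∂t P(x, t; q, M)`. As an equality of square-integrable functions of `x`,
it is required for almost every `x ∈ (0, π)`. -/
def IsMainSolution (q v M : ℝ → ℂ) : Prop :=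
  MemL2Pi M ∧ ∃ P : ℝ → ℝ → ℂ, IsTransformationKernel q M P ∧
    ∀ᵐ x ∂volPi, HasDerivAt (fun t : ℝ => P Real.pi t) (-v (Real.pi - x)) x

/-!
The kernel operator consists of integrals of `q(y) P(y, η)` and of `M ∗ P` over parallelograms that
move with `t`. On the side `x = π` the kernel equation can therefore be differentiated in `t` almost
everywhere (`ae_hasDerivAt_kernel_side`, from Fubini's theorem in `integral_charDeriv` and
`integral_convDeriv`), and the main equation becomes `(π - t) M(t) - ∫₀ᵗ M = g(t) - N(t)`, where `g`
(`mainData`) depends on `q` and `v` only and the continuous function `N` (`kernelPart`) collects the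
integrals of the kernel along the sides of the parallelograms (`hasDerivAt_side_iff`).

The operator on the left is a singular Volterra operator in the unknown `(π - t) M(t)`, with the
explicit inverse `hardyInv h = h + (∫₀ᵗ h) / (π - t)` (`weight_sub_primitive_iff`). It is bounded in
`L₂` on functions of mean zero by Hardy's inequality (`memL2_hardyInv`). The compatibility condition
on `q` and `v` means that `g` has mean zero (`integral_mainData`), while `N` always has
(`integral_kernelPart_pi`). So `M` is determined by `N`, and the problem is a system for the pair
`(N, P)` of continuous functions.

The system is quadratic, but it is of Volterra type. In the supremum norm with the weight `e^{-L t}`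
the inverse operator is bounded on functions of mean zero with a constant independent of `L`
(`norm_hardyInv_le`), whereas the integral operators become small for large `L`. The exception is
the dependence of `N` on `P`, which is bounded but not small; this is compensated by measuring `P`
on the scale `ε = L^(-1/4)`. Hence the system is a contraction (`contraction_estimate`) of a ball
whose radius does not depend on `L` (`self_map_estimate`). All constants depend only on the norms of
`q` and `v`. The fixed point (`exists_solution_system`) gives existence with a uniform bound. For
uniqueness the same estimate is applied to two given solutions, with `L` large enough for both
(`IsMainSolution.ae_unique`).
-/

/-! ### Integrals with moving endpoints and over planar regions -/

open Filter Topology in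
/-- Dominated convergence for integrals whose endpoints depend on the parameter. -/
lemma continuousWithinAt_integral_moving {E : Type*} [TopologicalSpace E]
    [FirstCountableTopology E] {Z : Set E} {z₀ : E} (hz₀ : z₀ ∈ Z) {α β : E → ℝ}
    {Φ : E → ℝ → ℂ} {g : ℝ → ℝ}
    (hα : ContinuousWithinAt α Z z₀) (hβ : ContinuousWithinAt β Z z₀)
    (hαβ : ∀ z ∈ Z, α z ≤ β z)
    (hm : ∀ z ∈ Z, AEStronglyMeasurable (Φ z) (volume.restrict (Ioc (α z) (β z))))
    (hb : ∀ z ∈ Z, ∀ y ∈ Ioo (α z) (β z), ‖Φ z y‖ ≤ g y) (hg0 : ∀ y, 0 ≤ g y) (hg : Integrable g)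
    (hc : ∀ y ∈ Ioo (α z₀) (β z₀), ContinuousWithinAt (fun z => Φ z y) Z z₀) :
    ContinuousWithinAt (fun z => ∫ y in (α z)..(β z), Φ z y) Z z₀ := by
  have key : ContinuousWithinAt (fun z => ∫ y, (Ioc (α z) (β z)).indicator (Φ z) y) Z z₀ := by
    refine continuousWithinAt_of_dominated (bound := g) ?_ ?_ hg ?_
    · filter_upwards [self_mem_nhdsWithin] with z hz
      exact (aestronglyMeasurable_indicator_iff measurableSet_Ioc).2 (hm z hz)
    · filter_upwards [self_mem_nhdsWithin] with z hz
      have : ∀ᵐ y : ℝ, y ≠ β z := by simp [ae_iff, measure_singleton]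
      filter_upwards [this] with y hy
      by_cases h : y ∈ Ioc (α z) (β z)
      · rw [indicator_of_mem h]
        exact hb z hz y ⟨h.1, lt_of_le_of_ne h.2 hy⟩
      · rw [indicator_of_notMem h, norm_zero]
        exact hg0 y
    · have h1 : ∀ᵐ y : ℝ, y ≠ β z₀ := by simp [ae_iff, measure_singleton]
      have h2 : ∀ᵐ y : ℝ, y ≠ α z₀ := by simp [ae_iff, measure_singleton]
      filter_upwards [h1, h2] with y hy1 hy2
      rcases lt_or_gt_of_ne hy2 with h | h
      · have : ∀ᶠ z in 𝓝[Z] z₀, y < α z := hα.eventually_const_lt h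
        refine (continuousWithinAt_const (b := (0 : ℂ))).congr_of_eventuallyEq ?_ ?_
        · filter_upwards [this] with z hz
          exact indicator_of_notMem (fun h' => absurd h'.1 (not_lt.2 hz.le)) _
        · exact indicator_of_notMem (fun h' => absurd h'.1 (not_lt.2 h.le)) _
      · rcases lt_or_gt_of_ne hy1 with h' | h'
        · have e1 : ∀ᶠ z in 𝓝[Z] z₀, α z < y := hα.eventually_lt_const h
          have e2 : ∀ᶠ z in 𝓝[Z] z₀, y < β z := hβ.eventually_const_lt h'
          refine (hc y ⟨h, h'⟩).congr_of_eventuallyEq ?_ ?_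
          · filter_upwards [e1, e2] with z hz1 hz2
            exact indicator_of_mem (s := Ioc (α z) (β z)) ⟨hz1, hz2.le⟩ _
          · exact indicator_of_mem (s := Ioc (α z₀) (β z₀)) ⟨h, h'.le⟩ _
        · have : ∀ᶠ z in 𝓝[Z] z₀, β z < y := hβ.eventually_lt_const h'
          refine (continuousWithinAt_const (b := (0 : ℂ))).congr_of_eventuallyEq ?_ ?_
          · filter_upwards [this] with z hz
            exact indicator_of_notMem (fun h' => absurd h'.2 (not_le.2 hz)) _
          · exact indicator_of_notMem (fun h'' => absurd h''.2 (not_le.2 h')) _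
  refine key.congr ?_ ?_
  · intro z hz
    rw [intervalIntegral.integral_of_le (hαβ z hz), integral_indicator measurableSet_Ioc]
  · rw [intervalIntegral.integral_of_le (hαβ _ hz₀), integral_indicator measurableSet_Ioc]

/-- Fubini's theorem for a planar region that is described by its sections in either variable. -/
lemma integral_integral_swap_region {a b c d C : ℝ} {α β γ δ : ℝ → ℝ} {g : ℝ → ℂ}
    {k : ℝ → ℝ → ℂ} (hab : a ≤ b) (hcd : c ≤ d)
    (hα : Measurable α) (hβ : Measurable β)
    (hαβ : ∀ t ∈ Ioo c d, a ≤ α t ∧ α t ≤ β t ∧ β t ≤ b)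
    (hγδ : ∀ y ∈ Ioo a b, c ≤ γ y ∧ γ y ≤ δ y ∧ δ y ≤ d)
    (hiff : ∀ t ∈ Ioo c d, ∀ y ∈ Ioo a b, y ∈ Ioo (α t) (β t) ↔ t ∈ Ioo (γ y) (δ y))
    (hg : IntervalIntegrable g volume a b) (hk : Measurable (Function.uncurry k))
    (hC : ∀ t ∈ Ioo c d, ∀ y ∈ Ioo (α t) (β t), ‖k t y‖ ≤ C) :
    ∫ t in c..d, ∫ y in (α t)..(β t), g y * k t y
      = ∫ y in a..b, g y * ∫ t in (γ y)..(δ y), k t y := by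
  set S : Set (ℝ × ℝ) := {p | α p.1 < p.2 ∧ p.2 < β p.1} with hS
  have hSm : MeasurableSet S :=
    (measurableSet_lt (hα.comp measurable_fst) measurable_snd).inter
      (measurableSet_lt measurable_snd (hβ.comp measurable_fst))
  have hgi : IntegrableOn g (Ioo a b) :=
    ((intervalIntegrable_iff_integrableOn_Ioo_of_le hab).1 hg)
  set F : ℝ → ℝ → ℂ := fun t y => S.indicator (fun p => g p.2 * k p.1 p.2) (t, y) with hF
  have hFi : Integrable (Function.uncurry F)
      ((volume.restrict (Ioo c d)).prod (volume.restrict (Ioo a b))) := by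
    have hg2 : Integrable (fun p : ℝ × ℝ => g p.2)
        ((volume.restrict (Ioo c d)).prod (volume.restrict (Ioo a b))) := by
      have : IsFiniteMeasure (volume.restrict (Ioo c d)) :=
        ⟨by simp [Real.volume_Ioo]⟩
      exact hgi.comp_snd _
    have hmeas : Measurable (S.indicator (Function.uncurry k)) := hk.indicator hSm
    have : Integrable (fun p : ℝ × ℝ => S.indicator (Function.uncurry k) p * g p.2)
        ((volume.restrict (Ioo c d)).prod (volume.restrict (Ioo a b))) := by
      refine hg2.bdd_mul (c := max C 0) hmeas.aestronglyMeasurable ?_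
      rw [Measure.prod_restrict]
      refine (ae_restrict_iff' (measurableSet_Ioo.prod measurableSet_Ioo)).2
        (Filter.Eventually.of_forall ?_)
      rintro ⟨t, y⟩ ⟨ht, hy⟩
      by_cases h : (t, y) ∈ S
      · rw [indicator_of_mem h]
        exact (hC t ht y h).trans (le_max_left _ _)
      · rw [indicator_of_notMem h, norm_zero]
        exact le_max_right _ _
    refine this.congr (Filter.Eventually.of_forall ?_)
    rintro ⟨t, y⟩
    by_cases h : (t, y) ∈ S
    · simp only [hF, Function.uncurry_apply_pair, indicator_of_mem h]
      exact mul_comm _ _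
    · simp only [hF, Function.uncurry_apply_pair, indicator_of_notMem h, zero_mul]
  have hswap := integral_integral_swap hFi
  rw [intervalIntegral.integral_of_le hcd, intervalIntegral.integral_of_le hab,
    integral_Ioc_eq_integral_Ioo, integral_Ioc_eq_integral_Ioo]
  refine Eq.trans ?_ (hswap.trans ?_)
  · refine setIntegral_congr_fun measurableSet_Ioo fun t ht => ?_
    obtain ⟨h1, h2, h3⟩ := hαβ t ht
    rw [intervalIntegral.integral_of_le h2, integral_Ioc_eq_integral_Ioo]
    have : (fun y => F t y) = (Ioo (α t) (β t)).indicator (fun y => g y * k t y) := by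
      ext y
      by_cases h : y ∈ Ioo (α t) (β t)
      · rw [indicator_of_mem h]
        exact indicator_of_mem (show (t, y) ∈ S from h) _
      · rw [indicator_of_notMem h]
        exact indicator_of_notMem (show (t, y) ∉ S from h) _
    rw [this, setIntegral_indicator measurableSet_Ioo,
      inter_eq_right.2 (Ioo_subset_Ioo h1 h3)]
  · refine setIntegral_congr_fun measurableSet_Ioo fun y hy => ?_
    obtain ⟨h1, h2, h3⟩ := hγδ y hy
    change ∫ t in Ioo c d, F t y = _
    rw [intervalIntegral.integral_of_le h2, integral_Ioc_eq_integral_Ioo, ← integral_const_mul]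
    have : ∀ t ∈ Ioo c d, F t y = (Ioo (γ y) (δ y)).indicator (fun t => g y * k t y) t := by
      intro t ht
      by_cases h : t ∈ Ioo (γ y) (δ y)
      · rw [indicator_of_mem h]
        exact indicator_of_mem (show (t, y) ∈ S from (hiff t ht y hy).2 h) _
      · rw [indicator_of_notMem h]
        exact indicator_of_notMem (show (t, y) ∉ S from fun h' => h ((hiff t ht y hy).1 h')) _
    rw [setIntegral_congr_fun measurableSet_Ioo this, setIntegral_indicator measurableSet_Ioo,
      inter_eq_right.2 (Ioo_subset_Ioo h1 h3)]

/-- Fubini's theorem on the triangle `0 < s < t < T`. -/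
lemma integral_triangle_swap {T C : ℝ} (hT : 0 ≤ T) {g : ℝ → ℂ} {k : ℝ → ℝ → ℂ}
    (hg : IntervalIntegrable g volume 0 T) (hk : Measurable (Function.uncurry k))
    (hC : ∀ t s, 0 < s → s < t → t < T → ‖k t s‖ ≤ C) :
    ∫ t in (0 : ℝ)..T, ∫ s in (0 : ℝ)..t, g s * k t s
      = ∫ s in (0 : ℝ)..T, g s * ∫ t in s..T, k t s :=
  integral_integral_swap_region (α := fun _ => 0) (β := fun t => t) (γ := fun s => s)
    (δ := fun _ => T) hT hT measurable_const measurable_id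
    (fun _ ht => ⟨le_rfl, ht.1.le, ht.2.le⟩) (fun _ hs => ⟨hs.1.le, hs.2.le, le_rfl⟩)
    (fun _ ht _ hs => ⟨fun h => ⟨h.2, ht.2⟩, fun h => ⟨hs.1, h.1⟩⟩) hg hk
    (fun t ht s hs => hC t s hs.1 hs.2 ht.2)

/-! ### Integrals over parallelograms and their derivatives -/

/-- The integral of `w(y) P(y, η)` over the parallelogram bounded by the lines `η = 0`, `η = τ`,
`2 y - η = τ` and `2 y - η = 2 X - τ`, written as in the equation for the transformation kernel. -/
noncomputable def charInt (w : ℝ → ℂ) (P : ℝ → ℝ → ℂ) (X τ : ℝ) : ℂ :=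
  (∫ s in τ..X, w s * ∫ ξ in (0 : ℝ)..τ, P s ξ)
    + (∫ s in (τ / 2)..τ, w s * ∫ ξ in (0 : ℝ)..(2 * s - τ), P s ξ)
    - ∫ s in (X - τ / 2)..X, w s * ∫ ξ in (0 : ℝ)..(2 * (s - X) + τ), P s ξ

/-- The derivative of `charInt w P X τ` with respect to `τ`: integrals of `w P` along three sides
of the parallelogram. -/
noncomputable def charDeriv (w : ℝ → ℂ) (P : ℝ → ℝ → ℂ) (X τ : ℝ) : ℂ :=
  (∫ s in τ..X, w s * P s τ) - (∫ s in (τ / 2)..τ, w s * P s (2 * s - τ))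
    - ∫ s in (X - τ / 2)..X, w s * P s (2 * (s - X) + τ)

/-- On the diagonal the parallelogram degenerates to a segment. -/
lemma charInt_diag (w : ℝ → ℂ) (P : ℝ → ℝ → ℂ) (X : ℝ) : charInt w P X X = 0 := by
  have h1 : X - X / 2 = X / 2 := by ring
  have h2 : ∀ s, 2 * (s - X) + X = 2 * s - X := fun s => by ring
  simp only [charInt, h1, h2, intervalIntegral.integral_same]
  ring

lemma continuous_integral_endpoints {E : Type*} [TopologicalSpace E] [FirstCountableTopology E]
    [LocallyCompactSpace E] {F : E → ℝ → ℂ} (hF : Continuous (Function.uncurry F)) {α β : E → ℝ}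
    (hα : Continuous α) (hβ : Continuous β) :
    Continuous fun p => ∫ y in (α p)..(β p), F p y := by
  have h1 : ∀ p, ∫ y in (α p)..(β p), F p y
      = (∫ y in (0 : ℝ)..(β p), F p y) - ∫ y in (0 : ℝ)..(α p), F p y := by
    intro p
    have hp : Continuous (F p) := hF.comp (by fun_prop : Continuous fun y => (p, y))
    rw [intervalIntegral.integral_interval_sub_left] <;> exact hp.intervalIntegrable _ _
  simp only [h1]
  exact (intervalIntegral.continuous_parametric_intervalIntegral_of_continuous hF hβ).sub
    (intervalIntegral.continuous_parametric_intervalIntegral_of_continuous hF hα)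

/-- Integrals of an integrable function against a continuous one, over an interval inside `(0, X)`,
depend continuously on the parameters. -/
lemma continuousOn_integral_weight {E : Type*} [TopologicalSpace E] [FirstCountableTopology E]
    {Z : Set E} (hZ : IsCompact Z) {X : ℝ} (hX : 0 ≤ X) {w : ℝ → ℂ}
    (hw : IntervalIntegrable w volume 0 X) {α β : E → ℝ} (hα : ContinuousOn α Z)
    (hβ : ContinuousOn β Z) (hαβ : ∀ z ∈ Z, 0 ≤ α z ∧ α z ≤ β z ∧ β z ≤ X) {Φ : E → ℝ → ℂ}
    (hΦ : Continuous (Function.uncurry Φ)) :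
    ContinuousOn (fun z => ∫ y in (α z)..(β z), w y * Φ z y) Z := by
  intro z₀ hz₀
  obtain ⟨C, hC⟩ := (hZ.prod (isCompact_Icc (a := (0 : ℝ)) (b := X))).exists_bound_of_continuousOn
    hΦ.continuousOn
  have hwi : IntegrableOn w (Ioc 0 X) := (intervalIntegrable_iff_integrableOn_Ioc_of_le hX).1 hw
  refine continuousWithinAt_integral_moving (g := (Ioc 0 X).indicator fun y => ‖w y‖ * max C 0)
    hz₀ (hα z₀ hz₀) (hβ z₀ hz₀) (fun z hz => (hαβ z hz).2.1) ?_ ?_ ?_ ?_ ?_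
  · intro z hz
    refine AEStronglyMeasurable.mul ?_ ?_
    · exact hwi.aestronglyMeasurable.mono_set (Ioc_subset_Ioc (hαβ z hz).1 (hαβ z hz).2.2)
    · exact (hΦ.comp (by fun_prop : Continuous fun y => (z, y))).aestronglyMeasurable
  · intro z hz y hy
    have hy' : y ∈ Ioc 0 X := ⟨(hαβ z hz).1.trans_lt hy.1, hy.2.le.trans (hαβ z hz).2.2⟩
    rw [indicator_of_mem hy', norm_mul]
    exact mul_le_mul_of_nonneg_left
      ((hC (z, y) ⟨hz, hy'.1.le, hy'.2⟩).trans (le_max_left _ _)) (norm_nonneg _)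
  · intro y
    exact indicator_nonneg (fun y _ => by positivity) y
  · exact (integrable_indicator_iff measurableSet_Ioc).2 (hwi.norm.mul_const _)
  · intro y _
    exact (continuous_const.mul
      (hΦ.comp (by fun_prop : Continuous fun z => (z, y)))).continuousWithinAt

lemma norm_integral_mul_le {w g : ℝ → ℂ} {X a b R : ℝ}
    (hw : IntervalIntegrable w volume 0 X) (ha : 0 ≤ a) (hab : a ≤ b) (hb : b ≤ X)
    (hR : 0 ≤ R) (hg : ∀ y ∈ Ioo a b, ‖g y‖ ≤ R) :
    ‖∫ y in a..b, w y * g y‖ ≤ (∫ y in (0 : ℝ)..X, ‖w y‖) * R := by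
  have hX : 0 ≤ X := ha.trans (hab.trans hb)
  have hsub : IntervalIntegrable w volume a b := hw.mono_set (by
    rw [uIcc_of_le hX, uIcc_of_le hab]; exact Icc_subset_Icc ha hb)
  calc ‖∫ y in a..b, w y * g y‖ ≤ ∫ y in a..b, ‖w y‖ * R := by
        refine intervalIntegral.norm_integral_le_of_norm_le hab ?_ (hsub.norm.mul_const R)
        have : ∀ᵐ y : ℝ, y ≠ b := by simp [ae_iff, measure_singleton]
        filter_upwards [this] with y hy hy'
        rw [norm_mul]
        exact mul_le_mul_of_nonneg_left (hg y ⟨hy'.1, lt_of_le_of_ne hy'.2 hy⟩) (norm_nonneg _)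
    _ = (∫ y in a..b, ‖w y‖) * R := intervalIntegral.integral_mul_const _ _
    _ ≤ (∫ y in (0 : ℝ)..X, ‖w y‖) * R := by
        refine mul_le_mul_of_nonneg_right ?_ hR
        exact intervalIntegral.integral_mono_interval ha hab hb
          (Filter.Eventually.of_forall fun y => norm_nonneg _) hw.norm

lemma norm_charInt_le {w : ℝ → ℂ} {P : ℝ → ℝ → ℂ} {X τ R : ℝ}
    (hw : IntervalIntegrable w volume 0 X) (hτ : 0 ≤ τ) (hX : τ ≤ X) (hR : 0 ≤ R)
    (h : ∀ y t, 0 ≤ t → t ≤ y → y ≤ X → t ≤ τ → ‖∫ ξ in (0 : ℝ)..t, P y ξ‖ ≤ R) :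
    ‖charInt w P X τ‖ ≤ 3 * ((∫ y in (0 : ℝ)..X, ‖w y‖) * R) := by
  have h1 := norm_integral_mul_le (a := τ) (b := X) (g := fun s => ∫ ξ in (0 : ℝ)..τ, P s ξ)
    hw hτ hX le_rfl hR (fun y hy => h y τ hτ hy.1.le hy.2.le le_rfl)
  have h2 := norm_integral_mul_le (a := τ / 2) (b := τ)
    (g := fun s => ∫ ξ in (0 : ℝ)..(2 * s - τ), P s ξ)
    hw (by linarith) (by linarith) hX hR
    (fun y hy => h y _ (by linarith [hy.1]) (by linarith [hy.2]) (by linarith [hy.2])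
      (by linarith [hy.2]))
  have h3 := norm_integral_mul_le (a := X - τ / 2) (b := X)
    (g := fun s => ∫ ξ in (0 : ℝ)..(2 * (s - X) + τ), P s ξ)
    hw (by linarith) (by linarith) le_rfl hR
    (fun y hy => h y _ (by linarith [hy.1]) (by linarith [hy.2]) (by linarith [hy.2])
      (by linarith [hy.2]))
  refine (norm_sub_le _ _).trans ?_
  linarith [norm_add_le (∫ s in τ..X, w s * ∫ ξ in (0 : ℝ)..τ, P s ξ)
    (∫ s in (τ / 2)..τ, w s * ∫ ξ in (0 : ℝ)..(2 * s - τ), P s ξ)]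

lemma norm_charDeriv_le {w : ℝ → ℂ} {P : ℝ → ℝ → ℂ} {X τ R : ℝ}
    (hw : IntervalIntegrable w volume 0 X) (hτ : 0 ≤ τ) (hX : τ ≤ X) (hR : 0 ≤ R)
    (h : ∀ y t, 0 ≤ t → t ≤ y → y ≤ X → t ≤ τ → ‖P y t‖ ≤ R) :
    ‖charDeriv w P X τ‖ ≤ 3 * ((∫ y in (0 : ℝ)..X, ‖w y‖) * R) := by
  have h1 := norm_integral_mul_le (a := τ) (b := X) (g := fun s => P s τ)
    hw hτ hX le_rfl hR (fun y hy => h y τ hτ hy.1.le hy.2.le le_rfl)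
  have h2 := norm_integral_mul_le (a := τ / 2) (b := τ) (g := fun s => P s (2 * s - τ))
    hw (by linarith) (by linarith) hX hR
    (fun y hy => h y _ (by linarith [hy.1]) (by linarith [hy.2]) (by linarith [hy.2])
      (by linarith [hy.2]))
  have h3 := norm_integral_mul_le (a := X - τ / 2) (b := X)
    (g := fun s => P s (2 * (s - X) + τ))
    hw (by linarith) (by linarith) le_rfl hR
    (fun y hy => h y _ (by linarith [hy.1]) (by linarith [hy.2]) (by linarith [hy.2])
      (by linarith [hy.2]))
  refine (norm_sub_le _ _).trans ?_
  linarith [norm_sub_le (∫ s in τ..X, w s * P s τ) (∫ s in (τ / 2)..τ, w s * P s (2 * s - τ))]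

lemma Continuous.uncurry_apply {P : ℝ → ℝ → ℂ} (hP : Continuous (Function.uncurry P)) {E : Type*}
    [TopologicalSpace E] {a b : E → ℝ} (ha : Continuous a) (hb : Continuous b) :
    Continuous fun p => P (a p) (b p) :=
  hP.comp (ha.prodMk hb)

lemma continuous_primitive_snd {P : ℝ → ℝ → ℂ} (hP : Continuous (Function.uncurry P)) {E : Type*}
    [TopologicalSpace E] [FirstCountableTopology E] [LocallyCompactSpace E] {a b : E → ℝ}
    (ha : Continuous a) (hb : Continuous b) :
    Continuous fun p => ∫ ξ in (0 : ℝ)..(b p), P (a p) ξ :=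
  continuous_integral_endpoints (F := fun p ξ => P (a p) ξ)
    (hP.uncurry_apply (ha.comp continuous_fst) continuous_snd) continuous_const hb

lemma isCompact_triangle : IsCompact triangle := by
  have : triangle ⊆ Icc (0 : ℝ) Real.pi ×ˢ Icc (0 : ℝ) Real.pi := by
    rintro ⟨x, t⟩ ⟨h1, h2, h3⟩
    exact ⟨⟨le_trans h1 h2, h3⟩, h1, le_trans h2 h3⟩
  refine (isCompact_Icc.prod isCompact_Icc).of_isClosed_subset ?_ this
  exact (isClosed_le continuous_const continuous_snd).inter
    ((isClosed_le continuous_snd continuous_fst).inter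
      (isClosed_le continuous_fst continuous_const))

lemma continuousOn_charInt {q : ℝ → ℂ} (hq : IntervalIntegrable q volume 0 Real.pi)
    {P : ℝ → ℝ → ℂ} (hP : Continuous (Function.uncurry P)) :
    ContinuousOn (fun p : ℝ × ℝ => charInt q P p.1 p.2) triangle := by
  refine ((continuousOn_integral_weight isCompact_triangle Real.pi_pos.le hq
    (α := fun p : ℝ × ℝ => p.2) (β := fun p => p.1)
    (Φ := fun p s => ∫ ξ in (0 : ℝ)..p.2, P s ξ) (by fun_prop) (by fun_prop) ?_ ?_).add
    (continuousOn_integral_weight isCompact_triangle Real.pi_pos.le hq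
    (α := fun p : ℝ × ℝ => p.2 / 2) (β := fun p => p.2)
    (Φ := fun p s => ∫ ξ in (0 : ℝ)..(2 * s - p.2), P s ξ) (by fun_prop) (by fun_prop)
    ?_ ?_)).sub
    (continuousOn_integral_weight isCompact_triangle Real.pi_pos.le hq
    (α := fun p : ℝ × ℝ => p.1 - p.2 / 2) (β := fun p => p.1)
    (Φ := fun p s => ∫ ξ in (0 : ℝ)..(2 * (s - p.1) + p.2), P s ξ) (by fun_prop) (by fun_prop)
    ?_ ?_)
  · rintro p ⟨h1, h2, h3⟩; exact ⟨h1, h2, h3⟩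
  · exact continuous_primitive_snd hP (by fun_prop) (by fun_prop)
  · rintro p ⟨h1, h2, h3⟩; exact ⟨by linarith, by linarith, by linarith⟩
  · exact continuous_primitive_snd hP (by fun_prop) (by fun_prop)
  · rintro p ⟨h1, h2, h3⟩; exact ⟨by linarith, by linarith, by linarith⟩
  · exact continuous_primitive_snd hP (by fun_prop) (by fun_prop)

lemma continuous_charInt_one {P : ℝ → ℝ → ℂ} (hP : Continuous (Function.uncurry P)) :
    Continuous (Function.uncurry (charInt (fun _ => 1) P)) := by
  simp only [Function.uncurry_def, charInt, one_mul]
  refine ((continuous_integral_endpoints ?_ (by fun_prop) (by fun_prop)).add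
    (continuous_integral_endpoints ?_ (by fun_prop) (by fun_prop))).sub
    (continuous_integral_endpoints ?_ (by fun_prop) (by fun_prop)) <;>
  exact continuous_primitive_snd hP (by fun_prop) (by fun_prop)

lemma continuous_charDeriv_one {P : ℝ → ℝ → ℂ} (hP : Continuous (Function.uncurry P)) :
    Continuous (Function.uncurry (charDeriv (fun _ => 1) P)) := by
  simp only [Function.uncurry_def, charDeriv, one_mul]
  refine ((continuous_integral_endpoints ?_ (by fun_prop) (by fun_prop)).sub
    (continuous_integral_endpoints ?_ (by fun_prop) (by fun_prop))).sub
    (continuous_integral_endpoints ?_ (by fun_prop) (by fun_prop)) <;>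
  exact hP.uncurry_apply (by fun_prop) (by fun_prop)

section Derivative

variable {w : ℝ → ℂ} {P : ℝ → ℝ → ℂ} {X : ℝ}

lemma continuousOn_top_side (hX : 0 ≤ X) (hw : IntervalIntegrable w volume 0 X)
    (hP : Continuous (Function.uncurry P)) :
    ContinuousOn (fun τ => ∫ s in τ..X, w s * P s τ) (Icc 0 X) :=
  continuousOn_integral_weight isCompact_Icc hX hw (Φ := fun τ s => P s τ) continuousOn_id
    continuousOn_const (fun _ hτ => ⟨hτ.1, hτ.2, le_rfl⟩)
    (hP.uncurry_apply (by fun_prop) (by fun_prop))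

lemma continuousOn_left_side (hX : 0 ≤ X) (hw : IntervalIntegrable w volume 0 X)
    (hP : Continuous (Function.uncurry P)) :
    ContinuousOn (fun τ => ∫ s in (τ / 2)..τ, w s * P s (2 * s - τ)) (Icc 0 X) :=
  continuousOn_integral_weight isCompact_Icc hX hw (Φ := fun τ s => P s (2 * s - τ))
    (by fun_prop) (by fun_prop)
    (fun _ hτ => ⟨by linarith [hτ.1], by linarith [hτ.1], by linarith [hτ.2]⟩)
    (hP.uncurry_apply (by fun_prop) (by fun_prop))

lemma continuousOn_right_side (hX : 0 ≤ X) (hw : IntervalIntegrable w volume 0 X)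
    (hP : Continuous (Function.uncurry P)) :
    ContinuousOn (fun τ => ∫ s in (X - τ / 2)..X, w s * P s (2 * (s - X) + τ)) (Icc 0 X) :=
  continuousOn_integral_weight isCompact_Icc hX hw (Φ := fun τ s => P s (2 * (s - X) + τ))
    (by fun_prop) (by fun_prop)
    (fun _ hτ => ⟨by linarith [hτ.1, hτ.2], by linarith [hτ.1], le_rfl⟩)
    (hP.uncurry_apply (by fun_prop) (by fun_prop))

lemma continuousOn_charDeriv (hX : 0 ≤ X) (hw : IntervalIntegrable w volume 0 X)
    (hP : Continuous (Function.uncurry P)) :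
    ContinuousOn (fun τ => charDeriv w P X τ) (Icc 0 X) :=
  ((continuousOn_top_side hX hw hP).sub (continuousOn_left_side hX hw hP)).sub
    (continuousOn_right_side hX hw hP)

/-- `charDeriv` is indeed the derivative of `charInt`, in integrated form. -/
lemma integral_charDeriv {τ : ℝ} (hτ : 0 ≤ τ) (hτX : τ ≤ X)
    (hw : IntervalIntegrable w volume 0 X) (hP : Continuous (Function.uncurry P)) :
    ∫ t in (0 : ℝ)..τ, charDeriv w P X t = charInt w P X τ := by
  have hX : 0 ≤ X := hτ.trans hτX
  have hsub : Icc 0 τ ⊆ Icc 0 X := Icc_subset_Icc le_rfl hτX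
  have hw' : ∀ a b, 0 ≤ a → a ≤ b → b ≤ X → IntervalIntegrable w volume a b := by
    intro a b h1 h2 h3
    refine hw.mono_set ?_
    rw [uIcc_of_le h2, uIcc_of_le hX]
    exact Icc_subset_Icc h1 h3
  have hPb : ∃ C, ∀ y ∈ Icc 0 X, ∀ t ∈ Icc (-X) X, ‖P y t‖ ≤ C := by
    obtain ⟨C, hC⟩ := ((isCompact_Icc (a := (0 : ℝ)) (b := X)).prod
      (isCompact_Icc (a := -X) (b := X))).exists_bound_of_continuousOn hP.continuousOn
    exact ⟨C, fun y hy t ht => hC (y, t) ⟨hy, ht⟩⟩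
  obtain ⟨C, hC⟩ := hPb
  have i1 : IntervalIntegrable (fun τ => ∫ s in τ..X, w s * P s τ) volume 0 τ :=
    ((continuousOn_top_side hX hw hP).mono hsub).intervalIntegrable_of_Icc hτ
  have i2 : IntervalIntegrable (fun τ => ∫ s in (τ / 2)..τ, w s * P s (2 * s - τ)) volume 0 τ :=
    ((continuousOn_left_side hX hw hP).mono hsub).intervalIntegrable_of_Icc hτ
  have i3 : IntervalIntegrable (fun τ => ∫ s in (X - τ / 2)..X, w s * P s (2 * (s - X) + τ))
      volume 0 τ :=
    ((continuousOn_right_side hX hw hP).mono hsub).intervalIntegrable_of_Icc hτ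
  have hPi : ∀ y a b, IntervalIntegrable (P y) volume a b := fun y a b =>
    (hP.comp (by fun_prop : Continuous fun t => (y, t))).intervalIntegrable _ _
  have hQc : Continuous fun p : ℝ × ℝ => ∫ ξ in (0 : ℝ)..p.2, P p.1 ξ :=
    continuous_primitive_snd hP continuous_fst continuous_snd
  have hwQ : ∀ (b : ℝ → ℝ), Continuous b → ∀ l r, 0 ≤ l → l ≤ r → r ≤ X →
      IntervalIntegrable (fun y => w y * ∫ ξ in (0 : ℝ)..(b y), P y ξ) volume l r :=
    fun b hb l r h1 h2 h3 => (hw' l r h1 h2 h3).mul_continuousOn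
      (hQc.comp (continuous_id.prodMk hb)).continuousOn
  -- each side sweeps a planar region; the two corner regions of the first two sides cancel
  have e1 : ∫ t in (0 : ℝ)..τ, ∫ s in t..X, w s * P s t
      = (∫ y in (0 : ℝ)..τ, w y * ∫ ξ in (0 : ℝ)..y, P y ξ)
        + ∫ y in τ..X, w y * ∫ ξ in (0 : ℝ)..τ, P y ξ := by
    rw [integral_integral_swap_region (a := 0) (b := X) (C := C) (α := fun t => t) (β := fun _ => X)
      (γ := fun _ => 0) (δ := fun y => min y τ) (k := fun t s => P s t) hX hτ measurable_id
      measurable_const (fun t ht => ⟨ht.1.le, ht.2.le.trans hτX, le_rfl⟩)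
      (fun y hy => ⟨le_rfl, le_min hy.1.le hτ, min_le_right _ _⟩) ?_ hw
      (hP.uncurry_apply (by fun_prop) (by fun_prop)).measurable ?_]
    · have hc : Continuous fun y => min y τ := by fun_prop
      rw [← intervalIntegral.integral_add_adjacent_intervals (b := τ)
        (hwQ _ hc 0 τ le_rfl hτ hτX) (hwQ _ hc τ X hτ hτX le_rfl)]
      congr 1
      · refine intervalIntegral.integral_congr fun y hy => ?_
        rw [uIcc_of_le hτ] at hy
        simp only [min_eq_left hy.2]
      · refine intervalIntegral.integral_congr fun y hy => ?_
        rw [uIcc_of_le hτX] at hy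
        simp only [min_eq_right hy.1]
    · intro t ht y hy
      simp only [mem_Ioo, lt_min_iff]
      exact ⟨fun h => ⟨ht.1, h.1, ht.2⟩, fun h => ⟨h.2.1, hy.2⟩⟩
    · intro t ht y hy
      exact hC y ⟨ht.1.le.trans hy.1.le, hy.2.le⟩ t
        ⟨by linarith [ht.1], by linarith [hy.1, hy.2]⟩
  have e2 : ∫ t in (0 : ℝ)..τ, ∫ s in (t / 2)..t, w s * P s (2 * s - t)
      = (∫ y in (0 : ℝ)..τ, w y * ∫ ξ in (0 : ℝ)..y, P y ξ)
        - ∫ y in (τ / 2)..τ, w y * ∫ ξ in (0 : ℝ)..(2 * y - τ), P y ξ := by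
    rw [integral_integral_swap_region (a := 0) (b := τ) (C := C) (α := fun t => t / 2)
      (β := fun t => t)
      (γ := fun y => y) (δ := fun y => min (2 * y) τ) (k := fun t s => P s (2 * s - t)) hτ hτ
      (by fun_prop) measurable_id
      (fun t ht => ⟨by linarith [ht.1], by linarith [ht.1], ht.2.le⟩)
      (fun y hy => ⟨hy.1.le, le_min (by linarith [hy.1]) hy.2.le, min_le_right _ _⟩) ?_
      (hw' 0 τ le_rfl hτ hτX)
      (hP.uncurry_apply (by fun_prop) (by fun_prop)).measurable ?_]
    · have h1 : ∀ y, ∫ t in y..(min (2 * y) τ), P y (2 * y - t)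
          = (∫ ξ in (0 : ℝ)..y, P y ξ) - ∫ ξ in (0 : ℝ)..(2 * y - min (2 * y) τ), P y ξ := by
        intro y
        rw [intervalIntegral.integral_comp_sub_left (fun x => P y x),
          intervalIntegral.integral_interval_sub_left (hPi _ _ _) (hPi _ _ _)]
        congr 1
        ring
      have hc : Continuous fun y => 2 * y - min (2 * y) τ := by fun_prop
      simp only [h1, mul_sub]
      rw [intervalIntegral.integral_sub (hwQ _ continuous_id' 0 τ le_rfl hτ hτX)
        (hwQ _ hc 0 τ le_rfl hτ hτX)]
      congr 1
      rw [← intervalIntegral.integral_add_adjacent_intervals (b := τ / 2)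
        (hwQ _ hc 0 (τ / 2) le_rfl (by linarith) (by linarith))
        (hwQ _ hc (τ / 2) τ (by linarith) (by linarith) hτX)]
      have z : ∫ y in (0 : ℝ)..(τ / 2), w y * ∫ ξ in (0 : ℝ)..(2 * y - min (2 * y) τ), P y ξ
          = 0 := by
        rw [intervalIntegral.integral_congr (g := fun _ => (0 : ℂ))]
        · simp
        · intro y hy
          rw [uIcc_of_le (by linarith)] at hy
          have : min (2 * y) τ = 2 * y := min_eq_left (by linarith [hy.2])
          simp [this]
      rw [z, zero_add]
      refine intervalIntegral.integral_congr fun y hy => ?_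
      rw [uIcc_of_le (by linarith)] at hy
      have : min (2 * y) τ = τ := min_eq_right (by linarith [hy.1])
      simp only [this]
    · intro t ht y hy
      simp only [mem_Ioo, lt_min_iff]
      exact ⟨fun h => ⟨h.2, by linarith [h.1], ht.2⟩, fun h => ⟨by linarith [h.2.1], h.1⟩⟩
    · intro t ht y hy
      exact hC y ⟨by linarith [ht.1, hy.1], by linarith [hy.2, ht.2]⟩ _
        ⟨by linarith [hy.1], by linarith [hy.1, hy.2, ht.2]⟩
  have e3 : ∫ t in (0 : ℝ)..τ, ∫ s in (X - t / 2)..X, w s * P s (2 * (s - X) + t)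
      = ∫ y in (X - τ / 2)..X, w y * ∫ ξ in (0 : ℝ)..(2 * (y - X) + τ), P y ξ := by
    rw [integral_integral_swap_region (a := X - τ / 2) (b := X) (C := C) (α := fun t => X - t / 2)
      (β := fun _ => X)
      (γ := fun y => 2 * (X - y)) (δ := fun _ => τ) (k := fun t s => P s (2 * (s - X) + t))
      (by linarith) hτ (by fun_prop) (by fun_prop)
      (fun t ht => ⟨by linarith [ht.2], by linarith [ht.1], le_rfl⟩)
      (fun y hy => ⟨by linarith [hy.2], by linarith [hy.1], le_rfl⟩) ?_
      (hw' _ _ (by linarith) (by linarith) le_rfl)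
      (hP.uncurry_apply (by fun_prop) (by fun_prop)).measurable ?_]
    · refine intervalIntegral.integral_congr fun y _ => ?_
      rw [intervalIntegral.integral_comp_add_left (fun x => P y x)]
      congr 2
      ring
    · intro t ht y hy
      exact ⟨fun h => ⟨by linarith [h.1], ht.2⟩, fun h => ⟨by linarith [h.1], hy.2⟩⟩
    · intro t ht y hy
      exact hC y ⟨by linarith [ht.2, hy.1], hy.2.le⟩ _
        ⟨by linarith [hy.1, ht.1], by linarith [hy.2, ht.2]⟩
  unfold charDeriv charInt
  rw [intervalIntegral.integral_sub (i1.sub i2) i3, intervalIntegral.integral_sub i1 i2,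
    e1, e2, e3]
  ring

end Derivative

section Linear

variable {w : ℝ → ℂ} {P P' : ℝ → ℝ → ℂ} {X τ : ℝ}

lemma intervalIntegrable_mul_of_subset (hw : IntervalIntegrable w volume 0 X) {a b : ℝ}
    (ha : 0 ≤ a) (hab : a ≤ b) (hb : b ≤ X) {g : ℝ → ℂ} (hg : Continuous g) :
    IntervalIntegrable (fun y => w y * g y) volume a b := by
  refine (hw.mono_set ?_).mul_continuousOn hg.continuousOn
  rw [uIcc_of_le hab, uIcc_of_le (ha.trans (hab.trans hb))]
  exact Icc_subset_Icc ha hb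

lemma charInt_sub (hw : IntervalIntegrable w volume 0 X) (hτ : 0 ≤ τ) (hτX : τ ≤ X)
    (hP : Continuous (Function.uncurry P)) (hP' : Continuous (Function.uncurry P')) :
    charInt w (fun x t => P x t - P' x t) X τ = charInt w P X τ - charInt w P' X τ := by
  have key : ∀ (b : ℝ → ℝ), Continuous b → ∀ l r, 0 ≤ l → l ≤ r → r ≤ X →
      ∫ y in l..r, w y * ∫ ξ in (0 : ℝ)..(b y), (P y ξ - P' y ξ)
        = (∫ y in l..r, w y * ∫ ξ in (0 : ℝ)..(b y), P y ξ)
          - ∫ y in l..r, w y * ∫ ξ in (0 : ℝ)..(b y), P' y ξ := by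
    intro b hb l r h1 h2 h3
    rw [← intervalIntegral.integral_sub
      (intervalIntegrable_mul_of_subset hw h1 h2 h3 (continuous_primitive_snd hP continuous_id' hb))
      (intervalIntegrable_mul_of_subset hw h1 h2 h3
        (continuous_primitive_snd hP' continuous_id' hb))]
    refine intervalIntegral.integral_congr fun y _ => ?_
    rw [intervalIntegral.integral_sub, mul_sub]
    · exact (hP.uncurry_apply continuous_const continuous_id).intervalIntegrable _ _
    · exact (hP'.uncurry_apply continuous_const continuous_id).intervalIntegrable _ _
  unfold charInt
  rw [key _ continuous_const _ _ hτ hτX le_rfl,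
    key _ (by fun_prop) _ _ (by linarith) (by linarith) hτX,
    key _ (by fun_prop) _ _ (by linarith) (by linarith) le_rfl]
  ring

lemma charDeriv_sub (hw : IntervalIntegrable w volume 0 X) (hτ : 0 ≤ τ) (hτX : τ ≤ X)
    (hP : Continuous (Function.uncurry P)) (hP' : Continuous (Function.uncurry P')) :
    charDeriv w (fun x t => P x t - P' x t) X τ = charDeriv w P X τ - charDeriv w P' X τ := by
  have key : ∀ (b : ℝ → ℝ), Continuous b → ∀ l r, 0 ≤ l → l ≤ r → r ≤ X →
      ∫ y in l..r, w y * (P y (b y) - P' y (b y))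
        = (∫ y in l..r, w y * P y (b y)) - ∫ y in l..r, w y * P' y (b y) := by
    intro b hb l r h1 h2 h3
    rw [← intervalIntegral.integral_sub
      (intervalIntegrable_mul_of_subset hw h1 h2 h3 (hP.uncurry_apply continuous_id' hb))
      (intervalIntegrable_mul_of_subset hw h1 h2 h3 (hP'.uncurry_apply continuous_id' hb))]
    refine intervalIntegral.integral_congr fun y _ => ?_
    simp only [mul_sub]
  unfold charDeriv
  rw [key _ continuous_const _ _ hτ hτX le_rfl,
    key _ (by fun_prop) _ _ (by linarith) (by linarith) hτX,
    key _ (by fun_prop) _ _ (by linarith) (by linarith) le_rfl]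
  ring

end Linear

/-! ### The kernel operator as a sum of parallelogram integrals -/

/-- Twice the part of the kernel operator that involves `M`: a convolution of `M` with integrals
of `P` over parallelograms. -/
noncomputable def convInt (M : ℝ → ℂ) (P : ℝ → ℝ → ℂ) (x t : ℝ) : ℂ :=
  ∫ s in (0 : ℝ)..t, M s * charInt (fun _ => 1) P (x - s) (t - s)

/-- The formal derivative of `convInt M P x t` with respect to `t`; there is no boundary term
because the parallelogram is degenerate at `s = t`. -/
noncomputable def convDeriv (M : ℝ → ℂ) (P : ℝ → ℝ → ℂ) (x t : ℝ) : ℂ :=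
  ∫ s in (0 : ℝ)..t, M s * charDeriv (fun _ => 1) P (x - s) (t - s)

lemma exists_bound_of_continuous {P : ℝ → ℝ → ℂ} (hP : Continuous (Function.uncurry P)) :
    ∃ C, 0 ≤ C ∧ ∀ y ∈ Icc 0 Real.pi, ∀ t ∈ Icc 0 Real.pi, ‖P y t‖ ≤ C := by
  obtain ⟨C, hC⟩ := ((isCompact_Icc (a := (0 : ℝ)) (b := Real.pi)).prod
    (isCompact_Icc (a := (0 : ℝ)) (b := Real.pi))).exists_bound_of_continuousOn hP.continuousOn
  exact ⟨max C 0, le_max_right _ _, fun y hy t ht => (hC (y, t) ⟨hy, ht⟩).trans (le_max_left _ _)⟩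

lemma norm_primitive_le {P : ℝ → ℝ → ℂ} {C y t : ℝ} (ht : 0 ≤ t)
    (h : ∀ η, 0 ≤ η → η ≤ t → ‖P y η‖ ≤ C) : ‖∫ ξ in (0 : ℝ)..t, P y ξ‖ ≤ C * t := by
  have := intervalIntegral.norm_integral_le_of_norm_le_const (a := 0) (b := t) (C := C)
    (f := P y) (fun η hη => by
      rw [uIoc_of_le ht] at hη
      exact h η hη.1.le hη.2)
  rwa [sub_zero, abs_of_nonneg ht] at this

lemma norm_charInt_one_le {P : ℝ → ℝ → ℂ} {X τ R : ℝ} (hτ : 0 ≤ τ) (hX : τ ≤ X) (hR : 0 ≤ R)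
    (h : ∀ y t, 0 ≤ t → t ≤ y → y ≤ X → t ≤ τ → ‖∫ ξ in (0 : ℝ)..t, P y ξ‖ ≤ R) :
    ‖charInt (fun _ => 1) P X τ‖ ≤ X * (3 * R) := by
  have := norm_charInt_le (w := fun _ => 1) (P := P) (by simp) hτ hX hR h
  simp only [norm_one, intervalIntegral.integral_const, sub_zero, smul_eq_mul, mul_one] at this
  linarith

lemma norm_charDeriv_one_le {P : ℝ → ℝ → ℂ} {X τ R : ℝ} (hτ : 0 ≤ τ) (hX : τ ≤ X) (hR : 0 ≤ R)
    (h : ∀ y t, 0 ≤ t → t ≤ y → y ≤ X → t ≤ τ → ‖P y t‖ ≤ R) :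
    ‖charDeriv (fun _ => 1) P X τ‖ ≤ X * (3 * R) := by
  have := norm_charDeriv_le (w := fun _ => 1) (P := P) (by simp) hτ hX hR h
  simp only [norm_one, intervalIntegral.integral_const, sub_zero, smul_eq_mul, mul_one] at this
  linarith

section Weighted

variable {M : ℝ → ℂ}

/-- A factor vanishing like `π - s` compensates the singularity of `M` at `π`. -/
lemma intervalIntegrable_mul_weight
    (hM : IntervalIntegrable (fun s => ((Real.pi - s : ℝ) : ℂ) * M s) volume 0 Real.pi)
    {t : ℝ} (ht0 : 0 ≤ t) (ht : t ≤ Real.pi) {c : ℝ → ℂ} (hc : Measurable c) {C : ℝ}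
    (hC : ∀ s ∈ Ioo 0 t, ‖c s‖ ≤ (Real.pi - s) * C) :
    IntervalIntegrable (fun s => M s * c s) volume 0 t := by
  have hM' : IntegrableOn (fun s => ((Real.pi - s : ℝ) : ℂ) * M s) (Ioo 0 t) :=
    ((intervalIntegrable_iff_integrableOn_Ioo_of_le Real.pi_pos.le).1 hM).mono_set
      (Ioo_subset_Ioo le_rfl ht)
  rw [intervalIntegrable_iff_integrableOn_Ioo_of_le ht0]
  have : Integrable (fun s => (c s / ((Real.pi - s : ℝ) : ℂ)) * (((Real.pi - s : ℝ) : ℂ) * M s))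
      (volume.restrict (Ioo 0 t)) := by
    refine hM'.bdd_mul (c := C) (hc.div (by fun_prop)).aestronglyMeasurable ?_
    refine (ae_restrict_iff' measurableSet_Ioo).2 (Filter.Eventually.of_forall fun s hs => ?_)
    have hpos : 0 < Real.pi - s := by linarith [hs.2]
    rw [norm_div, Complex.norm_real, Real.norm_of_nonneg hpos.le, div_le_iff₀ hpos, mul_comm]
    exact hC s hs
  refine this.congr ((ae_restrict_iff' measurableSet_Ioo).2
    (Filter.Eventually.of_forall fun s hs => ?_))
  have hpos : ((Real.pi - s : ℝ) : ℂ) ≠ 0 := by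
    exact_mod_cast (by linarith [hs.2] : (0 : ℝ) < Real.pi - s).ne'
  field_simp

lemma norm_integral_mul_weight_le
    (hM : IntervalIntegrable (fun s => ((Real.pi - s : ℝ) : ℂ) * M s) volume 0 Real.pi)
    {t : ℝ} (ht0 : 0 ≤ t) (ht : t ≤ Real.pi) {c : ℝ → ℂ} {r : ℝ → ℝ}
    (hr : Continuous r) (hc : ∀ s ∈ Ioo 0 t, ‖c s‖ ≤ (Real.pi - s) * r s) :
    ‖∫ s in (0 : ℝ)..t, M s * c s‖
      ≤ ∫ s in (0 : ℝ)..t, ‖((Real.pi - s : ℝ) : ℂ) * M s‖ * r s := by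
  have hM' : IntervalIntegrable (fun s => ((Real.pi - s : ℝ) : ℂ) * M s) volume 0 t :=
    hM.mono_set (by
      rw [uIcc_of_le ht0, uIcc_of_le Real.pi_pos.le]
      exact Icc_subset_Icc le_rfl ht)
  refine intervalIntegral.norm_integral_le_of_norm_le ht0 ?_
    (hM'.norm.mul_continuousOn hr.continuousOn)
  have : ∀ᵐ y : ℝ, y ≠ t := by simp [ae_iff, measure_singleton]
  filter_upwards [this] with s hs hs'
  have hpos : 0 ≤ Real.pi - s := by linarith [hs'.2]
  have := hc s ⟨hs'.1, lt_of_le_of_ne hs'.2 hs⟩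
  rw [norm_mul, norm_mul, Complex.norm_real, Real.norm_of_nonneg hpos]
  calc ‖M s‖ * ‖c s‖ ≤ ‖M s‖ * ((Real.pi - s) * r s) :=
        mul_le_mul_of_nonneg_left this (norm_nonneg _)
    _ = _ := by ring

end Weighted

section Operator

variable {q M : ℝ → ℂ} {P P' : ℝ → ℝ → ℂ} {x t : ℝ}

/-- The kernel operator only involves the values of `P` on the triangle. -/
lemma kernelOperator_congr (h : ∀ x t, 0 ≤ t → t ≤ x → x ≤ Real.pi → P x t = P' x t)
    (ht : 0 ≤ t) (htx : t ≤ x) (hx : x ≤ Real.pi) :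
    kernelOperator q M P x t = kernelOperator q M P' x t := by
  have hQ : ∀ y b, 0 ≤ b → b ≤ y → y ≤ Real.pi →
      ∫ ξ in (0 : ℝ)..b, P y ξ = ∫ ξ in (0 : ℝ)..b, P' y ξ := by
    intro y b h1 h2 h3
    refine intervalIntegral.integral_congr fun ξ hξ => ?_
    rw [uIcc_of_le h1] at hξ
    exact h y ξ hξ.1 (hξ.2.trans h2) h3
  have e1 : ∫ s in t..x, q s * ∫ ξ in (0 : ℝ)..t, P s ξ
      = ∫ s in t..x, q s * ∫ ξ in (0 : ℝ)..t, P' s ξ := by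
    refine intervalIntegral.integral_congr fun s hs => ?_
    rw [uIcc_of_le htx] at hs
    simp only [hQ s t ht hs.1 (hs.2.trans hx)]
  have e2 : ∫ s in (t / 2)..t, q s * ∫ ξ in (0 : ℝ)..(2 * s - t), P s ξ
      = ∫ s in (t / 2)..t, q s * ∫ ξ in (0 : ℝ)..(2 * s - t), P' s ξ := by
    refine intervalIntegral.integral_congr fun s hs => ?_
    rw [uIcc_of_le (by linarith)] at hs
    simp only [hQ s (2 * s - t) (by linarith [hs.1]) (by linarith [hs.2]) (by linarith [hs.2])]
  have e3 : ∫ s in (x - t / 2)..x, q s * ∫ ξ in (0 : ℝ)..(2 * (s - x) + t), P s ξ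
      = ∫ s in (x - t / 2)..x, q s * ∫ ξ in (0 : ℝ)..(2 * (s - x) + t), P' s ξ := by
    refine intervalIntegral.integral_congr fun s hs => ?_
    rw [uIcc_of_le (by linarith)] at hs
    simp only [hQ s (2 * (s - x) + t) (by linarith [hs.1]) (by linarith [hs.2])
      (by linarith [hs.2])]
  have e4 : ∫ s in (0 : ℝ)..t, M s * ∫ ξ in t..x, ∫ η in (0 : ℝ)..(t - s), P (ξ - s) η
      = ∫ s in (0 : ℝ)..t, M s * ∫ ξ in t..x, ∫ η in (0 : ℝ)..(t - s), P' (ξ - s) η := by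
    refine intervalIntegral.integral_congr fun s hs => ?_
    rw [uIcc_of_le ht] at hs
    refine congrArg (M s * ·) (intervalIntegral.integral_congr fun ξ hξ => ?_)
    rw [uIcc_of_le htx] at hξ
    exact hQ _ _ (by linarith [hs.2]) (by linarith [hξ.1]) (by linarith [hξ.2, hs.1])
  have e5 : ∫ s in (0 : ℝ)..t, M s *
        ∫ ξ in ((t + s) / 2)..t, ∫ η in (0 : ℝ)..(2 * ξ - t - s), P (ξ - s) η
      = ∫ s in (0 : ℝ)..t, M s *
        ∫ ξ in ((t + s) / 2)..t, ∫ η in (0 : ℝ)..(2 * ξ - t - s), P' (ξ - s) η := by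
    refine intervalIntegral.integral_congr fun s hs => ?_
    rw [uIcc_of_le ht] at hs
    refine congrArg (M s * ·) (intervalIntegral.integral_congr fun ξ hξ => ?_)
    rw [uIcc_of_le (by linarith [hs.2])] at hξ
    exact hQ _ _ (by linarith [hξ.1]) (by linarith [hξ.2]) (by linarith [hξ.2, hs.1])
  have e6 : ∫ s in (0 : ℝ)..t, M s *
        ∫ ξ in ((s - t) / 2 + x)..x, ∫ η in (0 : ℝ)..(2 * (ξ - x) + t - s), P (ξ - s) η
      = ∫ s in (0 : ℝ)..t, M s *
        ∫ ξ in ((s - t) / 2 + x)..x, ∫ η in (0 : ℝ)..(2 * (ξ - x) + t - s), P' (ξ - s) η := by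
    refine intervalIntegral.integral_congr fun s hs => ?_
    rw [uIcc_of_le ht] at hs
    refine congrArg (M s * ·) (intervalIntegral.integral_congr fun ξ hξ => ?_)
    rw [uIcc_of_le (by linarith [hs.2])] at hξ
    exact hQ _ _ (by linarith [hξ.1]) (by linarith [hξ.2]) (by linarith [hξ.2, hs.1])
  unfold kernelOperator
  rw [e1, e2, e3, e4, e5, e6]

/-- The kernel operator is the sum of a term with `q` and a convolution with `M`; both are governed
by integrals over parallelograms. -/
lemma kernelOperator_eq (hP : Continuous (Function.uncurry P))
    (hM : IntervalIntegrable (fun s => ((Real.pi - s : ℝ) : ℂ) * M s) volume 0 Real.pi)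
    (ht : 0 ≤ t) (htx : t ≤ x) (hx : x ≤ Real.pi) :
    kernelOperator q M P x t = (1 / 2 : ℂ) * (charInt q P x t + convInt M P x t) := by
  obtain ⟨C, hC0, hC⟩ := exists_bound_of_continuous hP
  have hQ : ∀ y b, 0 ≤ b → b ≤ y → y ≤ Real.pi →
      ‖∫ ξ in (0 : ℝ)..b, P y ξ‖ ≤ C * Real.pi := by
    intro y b h1 h2 h3
    refine (norm_primitive_le h1 fun η h4 h5 => hC y ⟨by linarith, h3⟩ η
      ⟨h4, by linarith⟩).trans ?_
    exact mul_le_mul_of_nonneg_left (h2.trans h3) hC0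
  have hR : 0 ≤ C * Real.pi := mul_nonneg hC0 Real.pi_pos.le
  -- each of the three summands of the factor of `M(s)` is of size `O(π - s)`
  have bound : ∀ s, s ≤ Real.pi → ∀ a b, 0 ≤ a → a ≤ b → b ≤ Real.pi - s → ∀ g : ℝ → ℂ,
      (∀ y ∈ Ioo a b, ‖g y‖ ≤ C * Real.pi) →
      ‖∫ y in a..b, g y‖ ≤ (Real.pi - s) * (C * Real.pi) := by
    intro s hs a b h1 h2 h3 g hg
    have := norm_integral_mul_le (w := fun _ => 1) (X := Real.pi - s) (by simp) h1 h2 h3 hR hg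
    simpa using this
  have f1 : ∀ s, ∫ ξ in t..x, ∫ η in (0 : ℝ)..(t - s), P (ξ - s) η
      = ∫ y in (t - s)..(x - s), ∫ η in (0 : ℝ)..(t - s), P y η := fun s =>
    intervalIntegral.integral_comp_sub_right (fun y => ∫ η in (0 : ℝ)..(t - s), P y η) s
  have f2 : ∀ s, ∫ ξ in ((t + s) / 2)..t, ∫ η in (0 : ℝ)..(2 * ξ - t - s), P (ξ - s) η
      = ∫ y in ((t - s) / 2)..(t - s), ∫ η in (0 : ℝ)..(2 * y - (t - s)), P y η := by
    intro s
    have := intervalIntegral.integral_comp_sub_right (a := (t + s) / 2) (b := t)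
      (fun y => ∫ η in (0 : ℝ)..(2 * y - (t - s)), P y η) s
    rw [show (t + s) / 2 - s = (t - s) / 2 by ring] at this
    rw [← this]
    refine intervalIntegral.integral_congr fun ξ _ => ?_
    congr 1
    ring
  have f3 : ∀ s, ∫ ξ in ((s - t) / 2 + x)..x, ∫ η in (0 : ℝ)..(2 * (ξ - x) + t - s), P (ξ - s) η
      = ∫ y in (x - s - (t - s) / 2)..(x - s),
          ∫ η in (0 : ℝ)..(2 * (y - (x - s)) + (t - s)), P y η := by
    intro s
    have := intervalIntegral.integral_comp_sub_right (a := (s - t) / 2 + x) (b := x)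
      (fun y => ∫ η in (0 : ℝ)..(2 * (y - (x - s)) + (t - s)), P y η) s
    rw [show (s - t) / 2 + x - s = x - s - (t - s) / 2 by ring] at this
    rw [← this]
    refine intervalIntegral.integral_congr fun ξ _ => ?_
    congr 1
    ring
  have m1 : Measurable fun s => ∫ y in (t - s)..(x - s), ∫ η in (0 : ℝ)..(t - s), P y η :=
    (continuous_integral_endpoints (continuous_primitive_snd hP (by fun_prop) (by fun_prop))
      (by fun_prop) (by fun_prop)).measurable
  have m2 : Measurable fun s => ∫ y in ((t - s) / 2)..(t - s),
      ∫ η in (0 : ℝ)..(2 * y - (t - s)), P y η :=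
    (continuous_integral_endpoints (continuous_primitive_snd hP (by fun_prop) (by fun_prop))
      (by fun_prop) (by fun_prop)).measurable
  have m3 : Measurable fun s => ∫ y in (x - s - (t - s) / 2)..(x - s),
          ∫ η in (0 : ℝ)..(2 * (y - (x - s)) + (t - s)), P y η :=
    (continuous_integral_endpoints (continuous_primitive_snd hP (by fun_prop) (by fun_prop))
      (by fun_prop) (by fun_prop)).measurable
  have i1 := intervalIntegrable_mul_weight hM ht (htx.trans hx) m1 (C := C * Real.pi)
    (fun s hs => bound s (by linarith [hs.2]) _ _ (by linarith [hs.2]) (by linarith)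
      (by linarith) _ fun y hy => hQ _ _ (by linarith [hs.2]) hy.1.le
        (by linarith [hy.2, hs.1]))
  have i2 := intervalIntegrable_mul_weight hM ht (htx.trans hx) m2 (C := C * Real.pi)
    (fun s hs => bound s (by linarith [hs.2]) _ _ (by linarith [hs.2]) (by linarith [hs.2])
      (by linarith) _ fun y hy => hQ _ _ (by linarith [hy.1]) (by linarith [hy.2])
        (by linarith [hy.2, hs.1]))
  have i3 := intervalIntegrable_mul_weight hM ht (htx.trans hx) m3 (C := C * Real.pi)
    (fun s hs => bound s (by linarith [hs.2]) _ _ (by linarith [hs.2]) (by linarith [hs.2])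
      (by linarith) _ fun y hy => hQ _ _ (by linarith [hy.1]) (by linarith [hy.2])
        (by linarith [hy.2, hs.1]))
  have hsplit : convInt M P x t
      = (∫ s in (0 : ℝ)..t, M s * ∫ y in (t - s)..(x - s), ∫ η in (0 : ℝ)..(t - s), P y η)
        + (∫ s in (0 : ℝ)..t, M s * ∫ y in ((t - s) / 2)..(t - s),
            ∫ η in (0 : ℝ)..(2 * y - (t - s)), P y η)
        - ∫ s in (0 : ℝ)..t, M s * ∫ y in (x - s - (t - s) / 2)..(x - s),
            ∫ η in (0 : ℝ)..(2 * (y - (x - s)) + (t - s)), P y η := by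
    rw [← intervalIntegral.integral_add i1 i2, ← intervalIntegral.integral_sub (i1.add i2) i3]
    refine intervalIntegral.integral_congr fun s _ => ?_
    simp only [charInt, one_mul]
    ring
  unfold kernelOperator charInt
  rw [hsplit]
  simp only [f1, f2, f3]
  ring

end Operator

/-- The extension of a function on the triangle to the plane that is constant along the
fibres of a retraction onto the triangle. -/
noncomputable def triExt (P : ℝ → ℝ → ℂ) (x t : ℝ) : ℂ :=
  P (max 0 (min x Real.pi)) (max 0 (min t (max 0 (min x Real.pi))))

lemma retraction_mem_triangle (x t : ℝ) :
    ((max 0 (min x Real.pi), max 0 (min t (max 0 (min x Real.pi)))) : ℝ × ℝ) ∈ triangle :=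
  ⟨le_max_left _ _, max_le (le_max_left _ _) (min_le_right _ _),
    max_le Real.pi_pos.le (min_le_right _ _)⟩

lemma triExt_eq (P : ℝ → ℝ → ℂ) {x t : ℝ} (ht : 0 ≤ t) (htx : t ≤ x) (hx : x ≤ Real.pi) :
    triExt P x t = P x t := by
  simp only [triExt, min_eq_left hx, max_eq_right (ht.trans htx), min_eq_left htx,
    max_eq_right ht]

lemma continuous_triExt {P : ℝ → ℝ → ℂ}
    (hP : ContinuousOn (fun p : ℝ × ℝ => P p.1 p.2) triangle) :
    Continuous (Function.uncurry (triExt P)) :=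
  hP.comp_continuous (f := fun p : ℝ × ℝ =>
    (max 0 (min p.1 Real.pi), max 0 (min p.2 (max 0 (min p.1 Real.pi))))) (by fun_prop)
    fun p => retraction_mem_triangle p.1 p.2

/-! ### Continuity and derivatives of the terms with `M` -/

section Weighted

variable {M : ℝ → ℂ}
  (hM : IntervalIntegrable (fun s => ((Real.pi - s : ℝ) : ℂ) * M s) volume 0 Real.pi)

lemma pi_sub_ne_zero {s : ℝ} (hs : s < Real.pi) : ((Real.pi - s : ℝ) : ℂ) ≠ 0 := by
  exact_mod_cast (sub_pos.2 hs).ne'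

include hM in
/-- Integrals of `M` against a factor that compensates its singularity at `π` depend continuously
on the parameters. -/
lemma continuousOn_integral_mul_weight {E : Type*} [TopologicalSpace E]
    [FirstCountableTopology E] {Z : Set E} {b : E → ℝ} (hb : ContinuousOn b Z)
    (hb0 : ∀ z ∈ Z, 0 ≤ b z ∧ b z ≤ Real.pi) {c : E → ℝ → ℂ}
    (hc : Continuous (Function.uncurry c)) {C : ℝ} (hC0 : 0 ≤ C)
    (hC : ∀ z ∈ Z, ∀ s ∈ Ioo 0 (b z), ‖c z s‖ ≤ (Real.pi - s) * C) :
    ContinuousOn (fun z => ∫ s in (0 : ℝ)..(b z), M s * c z s) Z := by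
  intro z₀ hz₀
  have hMi := (intervalIntegrable_iff_integrableOn_Ioo_of_le Real.pi_pos.le).1 hM
  refine continuousWithinAt_integral_moving
    (g := (Ioo 0 Real.pi).indicator fun s => ‖((Real.pi - s : ℝ) : ℂ) * M s‖ * C)
    hz₀ continuousWithinAt_const (hb z₀ hz₀) (fun z hz => (hb0 z hz).1) ?_ ?_ ?_ ?_ ?_
  · intro z hz
    have hcz : Measurable (c z) :=
      (hc.comp (by fun_prop : Continuous fun y => (z, y))).measurable
    exact ((intervalIntegrable_iff_integrableOn_Ioc_of_le (hb0 z hz).1).1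
      (intervalIntegrable_mul_weight hM (hb0 z hz).1 (hb0 z hz).2 hcz
        (hC z hz))).aestronglyMeasurable
  · intro z hz s hs
    have hs' : s ∈ Ioo 0 Real.pi := ⟨hs.1, hs.2.trans_le (hb0 z hz).2⟩
    have hpos : 0 ≤ Real.pi - s := by linarith [hs'.2]
    rw [indicator_of_mem hs', norm_mul, norm_mul, Complex.norm_real, Real.norm_of_nonneg hpos]
    calc ‖M s‖ * ‖c z s‖ ≤ ‖M s‖ * ((Real.pi - s) * C) :=
          mul_le_mul_of_nonneg_left (hC z hz s hs) (norm_nonneg _)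
      _ = _ := by ring
  · exact fun s => indicator_nonneg (fun s _ => by positivity) s
  · exact (integrable_indicator_iff measurableSet_Ioo).2 (hMi.norm.mul_const _)
  · intro s _
    exact (continuous_const.mul
      (hc.comp (by fun_prop : Continuous fun z => (z, s)))).continuousWithinAt

include hM in
lemma intervalIntegrable_of_weight {t : ℝ} (ht0 : 0 ≤ t) (ht : t < Real.pi) :
    IntervalIntegrable M volume 0 t := by
  have h : 0 < Real.pi - t := sub_pos.2 ht
  have := intervalIntegrable_mul_weight hM ht0 ht.le (c := fun _ => 1) measurable_const
    (C := 1 / (Real.pi - t)) (fun s hs => by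
      rw [norm_one, mul_one_div, le_div_iff₀ h]
      linarith [hs.2])
  simpa using this

variable {P : ℝ → ℝ → ℂ} (hP : Continuous (Function.uncurry P))

include hP in
lemma exists_norm_charDeriv_one_le : ∃ C, 0 ≤ C ∧ ∀ x t s, 0 ≤ s → s ≤ t → t ≤ x → x ≤ Real.pi →
    ‖charDeriv (fun _ => 1) P (x - s) (t - s)‖ ≤ (Real.pi - s) * C := by
  obtain ⟨C, hC0, hC⟩ := exists_bound_of_continuous hP
  refine ⟨3 * C, by positivity, fun x t s h0 h1 h2 h3 => ?_⟩
  refine (norm_charDeriv_one_le (by linarith) (by linarith) hC0 fun y η h4 h5 h6 _ =>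
    hC y ⟨by linarith, by linarith⟩ η ⟨h4, by linarith⟩).trans ?_
  exact mul_le_mul_of_nonneg_right (by linarith) (by positivity)

include hP in
lemma exists_norm_charInt_one_le : ∃ C, 0 ≤ C ∧ ∀ x t s, 0 ≤ s → s ≤ t → t ≤ x → x ≤ Real.pi →
    ‖charInt (fun _ => 1) P (x - s) (t - s)‖ ≤ (Real.pi - s) * C := by
  obtain ⟨C, hC0, hC⟩ := exists_bound_of_continuous hP
  have := Real.pi_pos
  refine ⟨3 * (C * Real.pi), by positivity, fun x t s h0 h1 h2 h3 => ?_⟩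
  refine (norm_charInt_one_le (R := C * Real.pi) (by linarith) (by linarith) (by positivity)
    fun y b h4 h5 h6 _ => ?_).trans ?_
  · refine (norm_primitive_le h4 fun η h8 h9 => hC y ⟨by linarith, by linarith⟩ η
      ⟨h8, by linarith⟩).trans ?_
    exact mul_le_mul_of_nonneg_left (by linarith) hC0
  · exact mul_le_mul_of_nonneg_right (by linarith) (by positivity)

include hM hP in
lemma continuousOn_convInt : ContinuousOn (fun p : ℝ × ℝ => convInt M P p.1 p.2) triangle := by
  obtain ⟨C, hC0, hC⟩ := exists_norm_charInt_one_le hP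
  exact continuousOn_integral_mul_weight hM continuousOn_snd
    (fun p hp => ⟨hp.1, hp.2.1.trans hp.2.2⟩)
    (c := fun p s => charInt (fun _ => 1) P (p.1 - s) (p.2 - s))
    ((continuous_charInt_one hP).uncurry_apply (by fun_prop) (by fun_prop)) hC0
    (fun p hp s hs => hC p.1 p.2 s hs.1.le hs.2.le hp.2.1 hp.2.2)

include hM hP in
lemma continuousOn_convDeriv :
    ContinuousOn (fun t => convDeriv M P Real.pi t) (Icc 0 Real.pi) := by
  obtain ⟨C, hC0, hC⟩ := exists_norm_charDeriv_one_le hP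
  exact continuousOn_integral_mul_weight hM continuousOn_id
    (fun t ht => ht)
    (c := fun t s => charDeriv (fun _ => 1) P (Real.pi - s) (t - s))
    ((continuous_charDeriv_one hP).uncurry_apply (by fun_prop) (by fun_prop)) hC0
    (fun t ht s hs => hC Real.pi t s hs.1.le hs.2.le ht.2 le_rfl)

include hM in
lemma continuousOn_freeConv :
    ContinuousOn (fun p : ℝ × ℝ => ∫ s in (0 : ℝ)..p.2, ((p.1 - p.2 : ℝ) : ℂ) * M s)
      triangle := by
  simp only [mul_comm _ (M _)]
  refine continuousOn_integral_mul_weight hM continuousOn_snd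
    (fun p hp => ⟨hp.1, hp.2.1.trans hp.2.2⟩)
    (c := fun p _ => ((p.1 - p.2 : ℝ) : ℂ)) (by fun_prop) zero_le_one
    (fun p hp s hs => ?_)
  rw [Complex.norm_real, Real.norm_of_nonneg (sub_nonneg.2 hp.2.1)]
  linarith [hp.2.2, hs.2]

include hM hP in
/-- `convDeriv` is indeed the derivative of `convInt` on the side `x = π` of the triangle. -/
lemma integral_convDeriv {t : ℝ} (ht0 : 0 ≤ t) (ht : t ≤ Real.pi) :
    ∫ r in (0 : ℝ)..t, convDeriv M P Real.pi r = convInt M P Real.pi t := by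
  obtain ⟨C, hC0, hC⟩ := exists_norm_charDeriv_one_le hP
  have hM' : IntervalIntegrable (fun s => ((Real.pi - s : ℝ) : ℂ) * M s) volume 0 t :=
    hM.mono_set (by
      rw [uIcc_of_le ht0, uIcc_of_le Real.pi_pos.le]
      exact Icc_subset_Icc le_rfl ht)
  have hk : Measurable (Function.uncurry fun r s : ℝ =>
      charDeriv (fun _ => 1) P (Real.pi - s) (r - s) / ((Real.pi - s : ℝ) : ℂ)) :=
    ((continuous_charDeriv_one hP).uncurry_apply (by fun_prop) (by fun_prop)).measurable.div
      (by fun_prop)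
  have hswap := integral_triangle_swap (C := C) ht0 hM' hk (fun r s h0 h1 h2 => by
    have hpos : 0 < Real.pi - s := by linarith
    rw [norm_div, Complex.norm_real, Real.norm_of_nonneg hpos.le, div_le_iff₀ hpos, mul_comm]
    exact hC Real.pi r s h0.le h1.le (by linarith) le_rfl)
  refine Eq.trans ?_ (hswap.trans ?_)
  · refine intervalIntegral.integral_congr_Ioo_of_le ht0 fun r hr => ?_
    refine intervalIntegral.integral_congr_Ioo_of_le hr.1.le fun s hs => ?_
    have := pi_sub_ne_zero (s := s) (by linarith [hs.2, hr.2])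
    field_simp
  · refine intervalIntegral.integral_congr_Ioo_of_le ht0 fun s hs => ?_
    have hne := pi_sub_ne_zero (s := s) (by linarith [hs.2])
    simp only [intervalIntegral.integral_div]
    rw [intervalIntegral.integral_comp_sub_right
        (fun τ => charDeriv (fun _ => 1) P (Real.pi - s) τ),
      sub_self, integral_charDeriv (by linarith [hs.2]) (by linarith) (by simp) hP]
    field_simp

include hM in
/-- The free term with `M` on the side `x = π`, as the integral of its formal derivative. -/
lemma integral_weight_sub_primitive {t : ℝ} (ht0 : 0 ≤ t) (ht : t < Real.pi) :
    ∫ r in (0 : ℝ)..t, (((Real.pi - r : ℝ) : ℂ) * M r - ∫ s in (0 : ℝ)..r, M s)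
      = ((Real.pi - t : ℝ) : ℂ) * ∫ s in (0 : ℝ)..t, M s := by
  have hMt := intervalIntegrable_of_weight hM ht0 ht
  have hM' : IntervalIntegrable (fun s => ((Real.pi - s : ℝ) : ℂ) * M s) volume 0 t :=
    hMt.continuousOn_mul (by fun_prop)
  have hswap := integral_triangle_swap (C := 1) (k := fun _ _ => 1) ht0 hMt measurable_const
    (by simp)
  simp only [mul_one, intervalIntegral.integral_const, Complex.real_smul] at hswap
  have hprim : IntervalIntegrable (fun r => ∫ s in (0 : ℝ)..r, M s) volume 0 t :=
    (intervalIntegral.continuousOn_primitive_interval' hMt left_mem_uIcc).intervalIntegrable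
  rw [intervalIntegral.integral_sub hM' hprim, hswap,
    ← intervalIntegral.integral_sub hM' (hMt.mul_continuousOn (by fun_prop)),
    ← intervalIntegral.integral_const_mul]
  refine intervalIntegral.integral_congr fun s _ => ?_
  push_cast
  ring

end Weighted

/-- The part of `2 R(π, t; q, M)` that involves the kernel `P`; it is continuous in `t`. -/
noncomputable def kernelPart (q M : ℝ → ℂ) (P : ℝ → ℝ → ℂ) (t : ℝ) : ℂ :=
  charDeriv q P Real.pi t + convDeriv M P Real.pi t

/-- The data of the main equation, solved for the terms with the kernel or with `M`. -/
noncomputable def mainData (q v : ℝ → ℂ) (t : ℝ) : ℂ :=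
  -2 * v (Real.pi - t) + (1 / 2 : ℂ) * (q (t / 2) + q (Real.pi - t / 2))

section MainEquation

variable {q v M : ℝ → ℂ} {P : ℝ → ℝ → ℂ}

lemma continuousOn_kernelPart (hq : IntervalIntegrable q volume 0 Real.pi)
    (hM : IntervalIntegrable (fun s => ((Real.pi - s : ℝ) : ℂ) * M s) volume 0 Real.pi)
    (hP : Continuous (Function.uncurry P)) :
    ContinuousOn (kernelPart q M P) (Icc 0 Real.pi) :=
  (continuousOn_charDeriv Real.pi_pos.le hq hP).add (continuousOn_convDeriv hM hP)

lemma integral_kernelPart (hq : IntervalIntegrable q volume 0 Real.pi)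
    (hM : IntervalIntegrable (fun s => ((Real.pi - s : ℝ) : ℂ) * M s) volume 0 Real.pi)
    (hP : Continuous (Function.uncurry P)) {t : ℝ} (ht0 : 0 ≤ t) (ht : t ≤ Real.pi) :
    ∫ r in (0 : ℝ)..t, kernelPart q M P r = charInt q P Real.pi t + convInt M P Real.pi t := by
  have hsub : Icc 0 t ⊆ Icc 0 Real.pi := Icc_subset_Icc le_rfl ht
  unfold kernelPart
  rw [intervalIntegral.integral_add
    (((continuousOn_charDeriv Real.pi_pos.le hq hP).mono hsub).intervalIntegrable_of_Icc ht0)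
    (((continuousOn_convDeriv hM hP).mono hsub).intervalIntegrable_of_Icc ht0),
    integral_charDeriv ht0 ht hq hP, integral_convDeriv hM hP ht0 ht]

/-- The terms with the kernel have mean zero, since the parallelograms degenerate at `t = π`. -/
lemma integral_kernelPart_pi (hq : IntervalIntegrable q volume 0 Real.pi)
    (hM : IntervalIntegrable (fun s => ((Real.pi - s : ℝ) : ℂ) * M s) volume 0 Real.pi)
    (hP : Continuous (Function.uncurry P)) :
    ∫ r in (0 : ℝ)..Real.pi, kernelPart q M P r = 0 := by
  rw [integral_kernelPart hq hM hP Real.pi_pos.le le_rfl, charInt_diag, zero_add, convInt]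
  simp [charInt_diag]

lemma intervalIntegrable_comp_half (hq : IntervalIntegrable q volume 0 Real.pi) :
    IntervalIntegrable (fun t => q (t / 2)) volume 0 Real.pi := by
  have h : IntervalIntegrable q volume 0 (Real.pi / 2) := hq.mono_set (by
    rw [uIcc_of_le Real.pi_pos.le, uIcc_of_le (by linarith [Real.pi_pos])]
    exact Icc_subset_Icc le_rfl (by linarith [Real.pi_pos]))
  have := h.comp_mul_left (c := 2⁻¹)
  simp only [zero_mul, div_inv_eq_mul, div_mul_cancel₀ Real.pi two_ne_zero] at this
  simpa only [div_eq_inv_mul] using this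

lemma intervalIntegrable_comp_sub_half (hq : IntervalIntegrable q volume 0 Real.pi) :
    IntervalIntegrable (fun t => q (Real.pi - t / 2)) volume 0 Real.pi := by
  have h : IntervalIntegrable (fun t => q (Real.pi - t)) volume 0 Real.pi := by
    have := hq.comp_sub_left Real.pi
    simp only [sub_zero, sub_self] at this
    exact this.symm
  exact intervalIntegrable_comp_half h

lemma intervalIntegrable_mainData (hq : IntervalIntegrable q volume 0 Real.pi)
    (hv : IntervalIntegrable v volume 0 Real.pi) :
    IntervalIntegrable (mainData q v) volume 0 Real.pi := by
  have h : IntervalIntegrable (fun t => v (Real.pi - t)) volume 0 Real.pi := by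
    have := hv.comp_sub_left Real.pi
    simp only [sub_zero, sub_self] at this
    exact this.symm
  exact (h.const_mul _).add
    (((intervalIntegrable_comp_half hq).add (intervalIntegrable_comp_sub_half hq)).const_mul _)

/-- The compatibility condition on `q` and `v` says exactly that the data has mean zero. -/
lemma integral_mainData (hq : IntervalIntegrable q volume 0 Real.pi)
    (hv : IntervalIntegrable v volume 0 Real.pi)
    (hqv : (∫ x in (0 : ℝ)..Real.pi, v x) = (1 / 2 : ℂ) * ∫ x in (0 : ℝ)..Real.pi, q x) :
    ∫ t in (0 : ℝ)..Real.pi, mainData q v t = 0 := by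
  have h : IntervalIntegrable (fun t => v (Real.pi - t)) volume 0 Real.pi := by
    have := hv.comp_sub_left Real.pi
    simp only [sub_zero, sub_self] at this
    exact this.symm
  have hq1 : IntervalIntegrable q volume 0 (Real.pi / 2) := hq.mono_set (by
    rw [uIcc_of_le Real.pi_pos.le, uIcc_of_le (by linarith [Real.pi_pos])]
    exact Icc_subset_Icc le_rfl (by linarith [Real.pi_pos]))
  have hq2 : IntervalIntegrable q volume (Real.pi / 2) Real.pi := hq.mono_set (by
    rw [uIcc_of_le Real.pi_pos.le, uIcc_of_le (by linarith [Real.pi_pos])]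
    exact Icc_subset_Icc (by linarith [Real.pi_pos]) le_rfl)
  unfold mainData
  rw [intervalIntegral.integral_add (h.const_mul _)
    (((intervalIntegrable_comp_half hq).add (intervalIntegrable_comp_sub_half hq)).const_mul _),
    intervalIntegral.integral_const_mul, intervalIntegral.integral_const_mul,
    intervalIntegral.integral_add (intervalIntegrable_comp_half hq)
      (intervalIntegrable_comp_sub_half hq),
    intervalIntegral.integral_comp_sub_left (fun x => v x),
    intervalIntegral.integral_comp_div (fun x => q x) two_ne_zero,
    intervalIntegral.integral_comp_sub_div (fun x => q x) two_ne_zero, sub_self, zero_div,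
    sub_zero, hqv, ← intervalIntegral.integral_add_adjacent_intervals hq1 hq2,
    show Real.pi - Real.pi / 2 = Real.pi / 2 by ring]
  simp only [Complex.real_smul]
  push_cast
  ring

end MainEquation

/-! ### The main equation as a singular Volterra equation -/

lemma ae_volPi_iff {p : ℝ → Prop} :
    (∀ᵐ t ∂volPi, p t) ↔ ∀ᵐ t : ℝ, t ∈ Ioo 0 Real.pi → p t :=
  ae_restrict_iff' measurableSet_Ioo

section MainEquation

variable {q v M : ℝ → ℂ} {P : ℝ → ℝ → ℂ}

/-- The sum of all terms of `2 R(π, t; q, M)`. -/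
noncomputable def sideDerivative (q M : ℝ → ℂ) (P : ℝ → ℝ → ℂ) (t : ℝ) : ℂ :=
  -(1 / 2 : ℂ) * (q (t / 2) + q (Real.pi - t / 2))
    + (((Real.pi - t : ℝ) : ℂ) * M t - ∫ s in (0 : ℝ)..t, M s) + kernelPart q M P t

lemma intervalIntegrable_sideDerivative (hq : IntervalIntegrable q volume 0 Real.pi)
    (hM : IntervalIntegrable (fun s => ((Real.pi - s : ℝ) : ℂ) * M s) volume 0 Real.pi)
    (hP : Continuous (Function.uncurry P)) {t : ℝ} (ht0 : 0 ≤ t) (ht : t < Real.pi) :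
    IntervalIntegrable (sideDerivative q M P) volume 0 t := by
  have hsub : uIcc 0 t ⊆ uIcc 0 Real.pi := by
    rw [uIcc_of_le ht0, uIcc_of_le Real.pi_pos.le]
    exact Icc_subset_Icc le_rfl ht.le
  have hMt := intervalIntegrable_of_weight hM ht0 ht
  have hprim : IntervalIntegrable (fun r => ∫ s in (0 : ℝ)..r, M s) volume 0 t :=
    (intervalIntegral.continuousOn_primitive_interval' hMt left_mem_uIcc).intervalIntegrable
  exact (((((intervalIntegrable_comp_half hq).add
    (intervalIntegrable_comp_sub_half hq)).mono_set hsub).const_mul _).add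
    ((hM.mono_set hsub).sub hprim)).add
    (((continuousOn_kernelPart hq hM hP).mono
      (Icc_subset_Icc le_rfl ht.le)).intervalIntegrable_of_Icc ht0)

/-- The right-hand side of the kernel equation on the side `x = π`, in integrated form. -/
lemma kernel_side_eq (hq : IntervalIntegrable q volume 0 Real.pi)
    (hM : IntervalIntegrable (fun s => ((Real.pi - s : ℝ) : ℂ) * M s) volume 0 Real.pi)
    (hP : Continuous (Function.uncurry P)) {t : ℝ} (ht0 : 0 ≤ t) (ht : t < Real.pi) :
    kernelFreeTerm q M Real.pi t + kernelOperator q M P Real.pi t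
      = (1 / 2 : ℂ) * ((∫ s in (0 : ℝ)..Real.pi, q s)
        + ∫ r in (0 : ℝ)..t, sideDerivative q M P r) := by
  have hsub : uIcc 0 t ⊆ uIcc 0 Real.pi := by
    rw [uIcc_of_le ht0, uIcc_of_le Real.pi_pos.le]
    exact Icc_subset_Icc le_rfl ht.le
  have hMt := intervalIntegrable_of_weight hM ht0 ht
  have hprim : IntervalIntegrable (fun r => ∫ s in (0 : ℝ)..r, M s) volume 0 t :=
    (intervalIntegral.continuousOn_primitive_interval' hMt left_mem_uIcc).intervalIntegrable
  have i1 := (intervalIntegrable_comp_half hq).mono_set hsub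
  have i2 := (intervalIntegrable_comp_sub_half hq).mono_set hsub
  have i3 := (hM.mono_set hsub).sub hprim
  have i4 := ((continuousOn_kernelPart hq hM hP).mono
      (Icc_subset_Icc le_rfl ht.le)).intervalIntegrable_of_Icc (μ := volume) ht0
  have hqs : ∀ a b, 0 ≤ a → a ≤ b → b ≤ Real.pi → IntervalIntegrable q volume a b := by
    intro a b h1 h2 h3
    refine hq.mono_set ?_
    rw [uIcc_of_le h2, uIcc_of_le Real.pi_pos.le]
    exact Icc_subset_Icc h1 h3
  have e1 : ∫ r in (0 : ℝ)..t, sideDerivative q M P r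
      = -(∫ s in (0 : ℝ)..(t / 2), q s) - (∫ s in (Real.pi - t / 2)..Real.pi, q s)
        + ((Real.pi - t : ℝ) : ℂ) * (∫ s in (0 : ℝ)..t, M s)
        + (charInt q P Real.pi t + convInt M P Real.pi t) := by
    unfold sideDerivative
    rw [intervalIntegral.integral_add (((i1.add i2).const_mul _).add i3) i4,
      intervalIntegral.integral_add ((i1.add i2).const_mul _) i3,
      intervalIntegral.integral_const_mul, intervalIntegral.integral_add i1 i2,
      integral_kernelPart hq hM hP ht0 ht.le, integral_weight_sub_primitive hM ht0 ht,
      intervalIntegral.integral_comp_div (fun x => q x) two_ne_zero,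
      intervalIntegral.integral_comp_sub_div (fun x => q x) two_ne_zero, zero_div, sub_zero]
    simp only [Complex.real_smul]
    push_cast
    ring
  have e2 : ∫ s in (0 : ℝ)..Real.pi, q s
      = (∫ s in (0 : ℝ)..(t / 2), q s) + (∫ s in (t / 2)..(Real.pi - t / 2), q s)
        + ∫ s in (Real.pi - t / 2)..Real.pi, q s := by
    rw [intervalIntegral.integral_add_adjacent_intervals
        (hqs _ _ le_rfl (by linarith) (by linarith)) (hqs _ _ (by linarith) (by linarith)
          (by linarith)),
      intervalIntegral.integral_add_adjacent_intervals
        (hqs _ _ le_rfl (by linarith) (by linarith)) (hqs _ _ (by linarith) (by linarith) le_rfl)]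
  rw [kernelOperator_eq hP hM ht0 ht.le le_rfl, e1, e2, kernelFreeTerm,
    intervalIntegral.integral_const_mul]
  ring

/-- On the side `x = π` the kernel is differentiable almost everywhere, by Lebesgue's theorem. -/
lemma ae_hasDerivAt_kernel_side (hq : IntervalIntegrable q volume 0 Real.pi)
    (hM : IntervalIntegrable (fun s => ((Real.pi - s : ℝ) : ℂ) * M s) volume 0 Real.pi)
    (hP : Continuous (Function.uncurry P))
    (hK : ∀ t, 0 ≤ t → t ≤ Real.pi →
      P Real.pi t = kernelFreeTerm q M Real.pi t + kernelOperator q M P Real.pi t) :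
    ∀ᵐ t ∂volPi, HasDerivAt (fun t => P Real.pi t)
      ((1 / 2 : ℂ) * sideDerivative q M P t) t := by
  have hpi := Real.pi_pos
  -- the derivative is only locally integrable on `[0, π)`, so the interval is exhausted
  have key : ∀ n : ℕ, ∀ᵐ t : ℝ, t ∈ Ioo 0 (Real.pi - Real.pi / (n + 2)) →
      HasDerivAt (fun t => P Real.pi t) ((1 / 2 : ℂ) * sideDerivative q M P t) t := by
    intro n
    set T : ℝ := Real.pi - Real.pi / (n + 2) with hT
    have hn : (0 : ℝ) < n + 2 := by positivity
    have hT1 : T < Real.pi := by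
      have : 0 < Real.pi / (n + 2) := by positivity
      linarith
    have hT0 : 0 ≤ T := by
      have : Real.pi / (n + 2) ≤ Real.pi := div_le_self hpi.le (by linarith)
      linarith
    have h := (intervalIntegrable_sideDerivative hq hM hP hT0 hT1).ae_hasDerivAt_integral
    filter_upwards [h] with t ht htT
    have h1 := ht (by rw [uIcc_of_le hT0]; exact ⟨htT.1.le, htT.2.le⟩) 0 left_mem_uIcc
    have h2 := ((h1.const_add (∫ s in (0 : ℝ)..Real.pi, q s)).const_mul (1 / 2 : ℂ))
    refine h2.congr_of_eventuallyEq ?_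
    filter_upwards [Ioo_mem_nhds htT.1 htT.2] with r hr
    rw [hK r hr.1.le (by linarith [hr.2]), kernel_side_eq hq hM hP hr.1.le (by linarith [hr.2])]
  rw [ae_volPi_iff]
  filter_upwards [ae_all_iff.2 key] with t ht htpi
  obtain ⟨n, hn⟩ := exists_nat_gt (Real.pi / (Real.pi - t))
  refine ht n ⟨htpi.1, ?_⟩
  have h1 : 0 < Real.pi - t := sub_pos.2 htpi.2
  have h2 : (0 : ℝ) < n + 2 := by positivity
  rw [div_lt_iff₀ h1] at hn
  have h3 : Real.pi / (n + 2) < Real.pi - t := by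
    rw [div_lt_iff₀ h2]
    nlinarith
  linarith

/-- For a solution of the kernel equation, the main equation is an equation of Volterra type
for `M` in terms of the kernel. -/
lemma hasDerivAt_side_iff (hq : IntervalIntegrable q volume 0 Real.pi)
    (hM : IntervalIntegrable (fun s => ((Real.pi - s : ℝ) : ℂ) * M s) volume 0 Real.pi)
    (hP : Continuous (Function.uncurry P))
    (hK : ∀ t, 0 ≤ t → t ≤ Real.pi →
      P Real.pi t = kernelFreeTerm q M Real.pi t + kernelOperator q M P Real.pi t) :
    (∀ᵐ t ∂volPi, HasDerivAt (fun t => P Real.pi t) (-v (Real.pi - t)) t) ↔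
      ∀ᵐ t ∂volPi, ((Real.pi - t : ℝ) : ℂ) * M t - ∫ s in (0 : ℝ)..t, M s
        = mainData q v t - kernelPart q M P t := by
  have h := ae_hasDerivAt_kernel_side hq hM hP hK
  constructor
  · intro h'
    filter_upwards [h, h'] with t h1 h2
    have := h1.unique h2
    unfold sideDerivative at this
    unfold mainData
    linear_combination 2 * this
  · intro h'
    filter_upwards [h, h'] with t h1 h2
    convert h1 using 1
    unfold sideDerivative
    unfold mainData at h2
    linear_combination (-1 / 2 : ℂ) * h2

end MainEquation

/-- The inverse of the operator `f ↦ f - ∫₀ᵗ f(s) / (π - s) ds`. -/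
noncomputable def hardyInv (g : ℝ → ℂ) (t : ℝ) : ℂ :=
  g t + (∫ s in (0 : ℝ)..t, g s) / ((Real.pi - t : ℝ) : ℂ)

lemma integral_inv_sq_pi_sub {s t : ℝ} (hst : s ≤ t) (ht : t < Real.pi) :
    ∫ r in s..t, ((((Real.pi - r)⁻¹) ^ 2 : ℝ) : ℂ)
      = (((Real.pi - t)⁻¹ : ℝ) : ℂ) - (((Real.pi - s)⁻¹ : ℝ) : ℂ) := by
  have hne : ∀ r ∈ uIcc s t, Real.pi - r ≠ 0 := by
    intro r hr
    rw [uIcc_of_le hst] at hr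
    linarith [hr.2]
  refine intervalIntegral.integral_eq_sub_of_hasDerivAt
    (f := fun r => (((Real.pi - r)⁻¹ : ℝ) : ℂ)) (fun r hr => ?_) ?_
  · have h1 : HasDerivAt (fun r : ℝ => (Real.pi - r)⁻¹) (((Real.pi - r)⁻¹) ^ 2) r := by
      convert! ((hasDerivAt_id r).const_sub Real.pi).inv (hne r hr) using 1
      simp
    exact h1.ofReal_comp
  · refine ContinuousOn.intervalIntegrable ?_
    have : ContinuousOn (fun r : ℝ => ((Real.pi - r)⁻¹) ^ 2) (uIcc s t) :=
      ((continuousOn_const.sub continuousOn_id).inv₀ hne).pow 2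
    exact Complex.continuous_ofReal.comp_continuousOn this

/-- Inversion of the singular Volterra operator `f ↦ f - ∫₀ᵗ f(s) / (π - s) ds` at
`f(t) = (π - t) M(t)`. -/
lemma weight_sub_primitive_iff {M g : ℝ → ℂ}
    (hM : IntervalIntegrable (fun s => ((Real.pi - s : ℝ) : ℂ) * M s) volume 0 Real.pi)
    (hg : IntervalIntegrable g volume 0 Real.pi) :
    (∀ᵐ t ∂volPi, ((Real.pi - t : ℝ) : ℂ) * M t - ∫ s in (0 : ℝ)..t, M s = g t) ↔
      ∀ᵐ t ∂volPi, ((Real.pi - t : ℝ) : ℂ) * M t = hardyInv g t := by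
  have hcongr : ∀ {f h : ℝ → ℂ} {t : ℝ}, t ∈ Ioo 0 Real.pi → (∀ᵐ t ∂volPi, f t = h t) →
      ∫ s in (0 : ℝ)..t, f s = ∫ s in (0 : ℝ)..t, h s := by
    intro f h t ht hae
    rw [ae_volPi_iff] at hae
    refine intervalIntegral.integral_congr_ae ?_
    filter_upwards [hae] with s hs hs'
    rw [uIoc_of_le ht.1.le] at hs'
    exact hs ⟨hs'.1, hs'.2.trans_lt ht.2⟩
  constructor
  · intro h
    have h2 := ae_volPi_iff.1 h
    rw [ae_volPi_iff]
    filter_upwards [h2] with t ht htpi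
    have e := integral_weight_sub_primitive hM htpi.1.le htpi.2
    rw [hcongr htpi h] at e
    have hne := pi_sub_ne_zero htpi.2
    rw [hardyInv, e, mul_div_cancel_left₀ _ hne, ← ht htpi]
    ring
  · intro h
    have h2 := ae_volPi_iff.1 h
    rw [ae_volPi_iff]
    filter_upwards [h2] with t ht htpi
    have hne := pi_sub_ne_zero htpi.2
    rw [ht htpi, hardyInv]
    have hgt : IntervalIntegrable g volume 0 t := hg.mono_set (by
      rw [uIcc_of_le htpi.1.le, uIcc_of_le Real.pi_pos.le]
      exact Icc_subset_Icc le_rfl htpi.2.le)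
    have hinv : ContinuousOn (fun s : ℝ => (((Real.pi - s)⁻¹ : ℝ) : ℂ)) (uIcc 0 t) := by
      refine Complex.continuous_ofReal.comp_continuousOn
        ((continuousOn_const.sub continuousOn_id).inv₀ fun s hs => ?_)
      rw [uIcc_of_le htpi.1.le] at hs
      exact (by linarith [hs.2, htpi.2] : (0 : ℝ) < Real.pi - s).ne'
    have hprim : ContinuousOn (fun r => ∫ s in (0 : ℝ)..r, g s) (uIcc 0 t) :=
      intervalIntegral.continuousOn_primitive_interval' hgt left_mem_uIcc
    have i1 : IntervalIntegrable (fun s => g s * (((Real.pi - s)⁻¹ : ℝ) : ℂ)) volume 0 t :=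
      hgt.mul_continuousOn hinv
    have i2 : IntervalIntegrable
        (fun r => (∫ s in (0 : ℝ)..r, g s) * (((Real.pi - r)⁻¹ : ℝ) : ℂ) ^ 2) volume 0 t :=
      (hprim.mul (hinv.pow 2)).intervalIntegrable
    have e1 : ∫ s in (0 : ℝ)..t, M s
        = ∫ s in (0 : ℝ)..t, (g s * (((Real.pi - s)⁻¹ : ℝ) : ℂ)
          + (∫ r in (0 : ℝ)..s, g r) * (((Real.pi - s)⁻¹ : ℝ) : ℂ) ^ 2) := by
      refine hcongr htpi ?_
      rw [ae_volPi_iff]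
      filter_upwards [h2] with s hs hspi
      have hne := pi_sub_ne_zero hspi.2
      have := hs hspi
      rw [hardyInv] at this
      push_cast at this hne ⊢
      field_simp at this ⊢
      linear_combination this
    have hswap := integral_triangle_swap (C := ((Real.pi - t)⁻¹) ^ 2)
      (k := fun r _ => ((((Real.pi - r)⁻¹) ^ 2 : ℝ) : ℂ)) htpi.1.le hgt
      (by fun_prop) (fun r s h0 h1 h3 => by
        rw [Complex.norm_real, Real.norm_of_nonneg (by positivity)]
        have h4 : 0 < Real.pi - t := sub_pos.2 htpi.2
        have h5 : 0 < Real.pi - r := by linarith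
        gcongr)
    have e2 : ∫ r in (0 : ℝ)..t, (∫ s in (0 : ℝ)..r, g s) * (((Real.pi - r)⁻¹ : ℝ) : ℂ) ^ 2
        = (∫ s in (0 : ℝ)..t, g s) * (((Real.pi - t)⁻¹ : ℝ) : ℂ)
          - ∫ s in (0 : ℝ)..t, g s * (((Real.pi - s)⁻¹ : ℝ) : ℂ) := by
      rw [← intervalIntegral.integral_mul_const,
        ← intervalIntegral.integral_sub (hgt.mul_const _) i1]
      simp only [intervalIntegral.integral_mul_const] at hswap
      refine Eq.trans ?_ (hswap.trans ?_)
      · refine intervalIntegral.integral_congr fun r _ => ?_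
        push_cast
        ring
      · refine intervalIntegral.integral_congr_Ioo_of_le htpi.1.le fun s hs => ?_
        rw [integral_inv_sq_pi_sub hs.2.le htpi.2, mul_sub]
    rw [e1, intervalIntegral.integral_add i1 i2, e2]
    push_cast
    ring

/-! ### Hardy's inequality and the `L₂` bounds -/

lemma lintegral_mul_sq_le {α : Type*} [MeasurableSpace α] {μ : Measure α} {f g : α → ENNReal}
    (hf : AEMeasurable f μ) (hg : AEMeasurable g μ) :
    (∫⁻ a, f a * g a ∂μ) ^ 2 ≤ (∫⁻ a, f a ^ 2 ∂μ) * ∫⁻ a, g a ^ 2 ∂μ := by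
  have h := ENNReal.lintegral_mul_le_Lp_mul_Lq μ Real.HolderConjugate.two_two hf hg
  simp only [Pi.mul_apply, ENNReal.rpow_two] at h
  refine (pow_le_pow_left' h 2).trans_eq ?_
  rw [mul_pow, ← ENNReal.rpow_two, ← ENNReal.rpow_two, ← ENNReal.rpow_mul, ← ENNReal.rpow_mul]
  norm_num

lemma normL2_sq (f : ℝ → ℂ) : normL2 f ^ 2 = ∫⁻ x in Ioo 0 Real.pi, ‖f x‖ₑ ^ 2 := by
  have h := eLpNorm_nnreal_pow_eq_lintegral (f := f) (p := 2) (μ := volPi) two_ne_zero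
  have e : ((2 : NNReal) : ENNReal) = 2 := rfl
  have e' : ((2 : NNReal) : ℝ) = 2 := rfl
  rw [e, e'] at h
  simpa only [ENNReal.rpow_two, normL2, volPi] using h

lemma lintegral_Ioo_ofReal {f : ℝ → ℝ} {a b : ℝ} (hab : a ≤ b)
    (hf : IntervalIntegrable f volume a b) (h0 : ∀ x ∈ Ioo a b, 0 ≤ f x) :
    ∫⁻ x in Ioo a b, ENNReal.ofReal (f x) = ENNReal.ofReal (∫ x in a..b, f x) := by
  rw [intervalIntegral.integral_of_le hab, integral_Ioc_eq_integral_Ioo,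
    ofReal_integral_eq_lintegral_ofReal]
  · exact (intervalIntegrable_iff_integrableOn_Ioo_of_le hab).1 hf
  · exact (ae_restrict_iff' measurableSet_Ioo).2 (Filter.Eventually.of_forall h0)

lemma lintegral_rpow_neg_half {t : ℝ} (ht : t < Real.pi) :
    ∫⁻ s in Ioo t Real.pi, ENNReal.ofReal ((Real.pi - s) ^ (-(1 / 2) : ℝ))
      = ENNReal.ofReal (2 * (Real.pi - t) ^ (1 / 2 : ℝ)) := by
  have hi : IntervalIntegrable (fun s : ℝ => (Real.pi - s) ^ (-(1 / 2) : ℝ)) volume t Real.pi := by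
    have := (intervalIntegral.intervalIntegrable_rpow' (a := 0) (b := Real.pi - t)
      (r := -(1 / 2)) (by norm_num)).comp_sub_left Real.pi
    simp only [sub_zero, sub_sub_cancel] at this
    exact this.symm
  rw [lintegral_Ioo_ofReal ht.le hi
    (fun x hx => Real.rpow_nonneg (by linarith [hx.2]) _),
    intervalIntegral.integral_comp_sub_left (fun x => x ^ (-(1 / 2) : ℝ)), sub_self,
    integral_rpow (Or.inl (by norm_num)), Real.zero_rpow (by norm_num)]
  congr 1
  norm_num
  ring

lemma lintegral_rpow_neg_three_half_le {s : ℝ} (hs0 : 0 < s) (hs : s < Real.pi) :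
    ∫⁻ t in Ioo 0 s, ENNReal.ofReal (2 * (Real.pi - t) ^ (-(3 / 2) : ℝ))
      ≤ ENNReal.ofReal (4 * (Real.pi - s) ^ (-(1 / 2) : ℝ)) := by
  have h0 : (0 : ℝ) ∉ uIcc (Real.pi - s) Real.pi := by
    rw [uIcc_of_le (by linarith)]
    exact fun h => by linarith [h.1]
  have hi : IntervalIntegrable (fun t : ℝ => 2 * (Real.pi - t) ^ (-(3 / 2) : ℝ)) volume 0 s := by
    have := (intervalIntegral.intervalIntegrable_rpow (μ := volume) (r := -(3 / 2))
      (Or.inr h0)).comp_sub_left Real.pi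
    simp only [sub_self, sub_sub_cancel] at this
    exact (this.symm).const_mul 2
  rw [lintegral_Ioo_ofReal hs0.le hi
    (fun x hx => mul_nonneg zero_le_two (Real.rpow_nonneg (by linarith [hx.2]) _)),
    intervalIntegral.integral_const_mul,
    intervalIntegral.integral_comp_sub_left (fun x => x ^ (-(3 / 2) : ℝ)), sub_zero,
    integral_rpow (Or.inr ⟨by norm_num, h0⟩)]
  refine ENNReal.ofReal_le_ofReal ?_
  have h1 : (-(3 / 2) + 1 : ℝ) = -(1 / 2) := by norm_num
  have h2 : 0 ≤ Real.pi ^ (-(1 / 2) : ℝ) := Real.rpow_nonneg Real.pi_pos.le _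
  rw [h1]
  linarith

/-- **Hardy's inequality** for the averages of a function over `(t, π)`. -/
lemma lintegral_hardy_le {γ : ℝ → ENNReal} (hγ : AEMeasurable γ (volume.restrict (Ioo 0 Real.pi))) :
    ∫⁻ t in Ioo 0 Real.pi,
        (ENNReal.ofReal (Real.pi - t)⁻¹ * ∫⁻ s in Ioo t Real.pi, γ s) ^ 2
      ≤ 4 * ∫⁻ s in Ioo 0 Real.pi, γ s ^ 2 := by
  -- Schur's test: Cauchy–Schwarz with the weight `(π - s)^(1/4)` and its reciprocal
  set A : ℝ → ENNReal := fun s => ENNReal.ofReal ((Real.pi - s) ^ (1 / 4 : ℝ)) with hA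
  set B : ℝ → ENNReal := fun s => ENNReal.ofReal ((Real.pi - s) ^ (-(1 / 4) : ℝ)) with hB
  set D : ℝ → ENNReal := fun t => ENNReal.ofReal (2 * (Real.pi - t) ^ (-(3 / 2) : ℝ)) with hD
  have mA : Measurable A := by fun_prop
  have mB : Measurable B := by fun_prop
  have mD : Measurable D := by fun_prop
  have hAB : ∀ s < Real.pi, A s * B s = 1 := by
    intro s hs
    have hpos : 0 < Real.pi - s := sub_pos.2 hs
    rw [hA, hB]
    simp only
    rw [← ENNReal.ofReal_mul (by positivity), ← Real.rpow_add hpos]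
    norm_num
  have hB2 : ∀ s < Real.pi, B s ^ 2 = ENNReal.ofReal ((Real.pi - s) ^ (-(1 / 2) : ℝ)) := by
    intro s hs
    have hpos : 0 < Real.pi - s := sub_pos.2 hs
    rw [hB]
    simp only
    rw [← ENNReal.ofReal_pow (by positivity), ← Real.rpow_natCast, ← Real.rpow_mul hpos.le]
    norm_num
  have hA2 : ∀ s < Real.pi,
      A s ^ 2 * ENNReal.ofReal (4 * (Real.pi - s) ^ (-(1 / 2) : ℝ)) = 4 := by
    intro s hs
    rw [ENNReal.ofReal_mul (by norm_num), ← hB2 s hs, mul_left_comm, ← mul_pow, hAB s hs]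
    simp
  have hpt : ∀ t ∈ Ioo 0 Real.pi,
      (ENNReal.ofReal (Real.pi - t)⁻¹ * ∫⁻ s in Ioo t Real.pi, γ s) ^ 2
        ≤ ∫⁻ s in Ioo 0 Real.pi, (Ioi t).indicator (fun _ => D t) s * (γ s ^ 2 * A s ^ 2) := by
    intro t ht
    have hpos : 0 < Real.pi - t := sub_pos.2 ht.2
    have hsub : Ioo t Real.pi ⊆ Ioo 0 Real.pi := Ioo_subset_Ioo ht.1.le le_rfl
    have hγt : AEMeasurable γ (volume.restrict (Ioo t Real.pi)) := hγ.mono_set hsub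
    have e1 : ∫⁻ s in Ioo t Real.pi, γ s = ∫⁻ s in Ioo t Real.pi, (γ s * A s) * B s := by
      refine setLIntegral_congr_fun measurableSet_Ioo fun s hs => ?_
      rw [mul_assoc, hAB s hs.2, mul_one]
    have e2 : ∫⁻ s in Ioo t Real.pi, B s ^ 2
        = ENNReal.ofReal (2 * (Real.pi - t) ^ (1 / 2 : ℝ)) := by
      rw [← lintegral_rpow_neg_half ht.2]
      exact setLIntegral_congr_fun measurableSet_Ioo fun s hs => hB2 s hs.2
    have e3 : ENNReal.ofReal (Real.pi - t)⁻¹ ^ 2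
        * ENNReal.ofReal (2 * (Real.pi - t) ^ (1 / 2 : ℝ)) = D t := by
      rw [← ENNReal.ofReal_pow (by positivity), ← ENNReal.ofReal_mul (by positivity), hD]
      congr 1
      rw [inv_pow, ← Real.rpow_natCast, ← Real.rpow_neg hpos.le, mul_left_comm,
        ← Real.rpow_add hpos]
      norm_num
    calc (ENNReal.ofReal (Real.pi - t)⁻¹ * ∫⁻ s in Ioo t Real.pi, γ s) ^ 2
        ≤ ENNReal.ofReal (Real.pi - t)⁻¹ ^ 2 * ((∫⁻ s in Ioo t Real.pi, (γ s * A s) ^ 2)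
            * ∫⁻ s in Ioo t Real.pi, B s ^ 2) := by
          rw [mul_pow, e1]
          gcongr
          exact lintegral_mul_sq_le (hγt.mul mA.aemeasurable) mB.aemeasurable
      _ = D t * ∫⁻ s in Ioo t Real.pi, (γ s * A s) ^ 2 := by
          rw [e2, ← e3]
          ring
      _ = ∫⁻ s in Ioo t Real.pi, D t * (γ s ^ 2 * A s ^ 2) := by
          simp only [mul_pow]
          exact (lintegral_const_mul' (D t) _ ENNReal.ofReal_ne_top).symm
      _ = ∫⁻ s in Ioo t Real.pi, (Ioi t).indicator (fun _ => D t) s * (γ s ^ 2 * A s ^ 2) := by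
          refine setLIntegral_congr_fun measurableSet_Ioo fun s hs => ?_
          rw [indicator_of_mem (show s ∈ Ioi t from hs.1)]
      _ ≤ _ := lintegral_mono_set hsub
  calc ∫⁻ t in Ioo 0 Real.pi,
        (ENNReal.ofReal (Real.pi - t)⁻¹ * ∫⁻ s in Ioo t Real.pi, γ s) ^ 2
      ≤ ∫⁻ t in Ioo 0 Real.pi, ∫⁻ s in Ioo 0 Real.pi,
          (Ioi t).indicator (fun _ => D t) s * (γ s ^ 2 * A s ^ 2) :=
        setLIntegral_mono' measurableSet_Ioo hpt
    _ = ∫⁻ s in Ioo 0 Real.pi, ∫⁻ t in Ioo 0 Real.pi,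
          (Ioi t).indicator (fun _ => D t) s * (γ s ^ 2 * A s ^ 2) := by
        refine lintegral_lintegral_swap ?_
        have m1 : Measurable (fun p : ℝ × ℝ => (Ioi p.1).indicator (fun _ => D p.1) p.2) :=
          Measurable.ite (measurableSet_lt measurable_fst measurable_snd)
            (mD.comp measurable_fst) measurable_const
        exact m1.aemeasurable.mul
          (((hγ.pow_const 2).mul (mA.pow_const 2).aemeasurable).comp_snd)
    _ ≤ ∫⁻ s in Ioo 0 Real.pi, 4 * γ s ^ 2 := by
        refine setLIntegral_mono' measurableSet_Ioo fun s hs => ?_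
        have mI : Measurable fun t => (Ioi t).indicator (fun _ => D t) s :=
          Measurable.ite (measurableSet_lt measurable_id measurable_const) mD measurable_const
        rw [lintegral_mul_const _ mI]
        have : ∫⁻ t in Ioo 0 Real.pi, (Ioi t).indicator (fun _ => D t) s
            ≤ ENNReal.ofReal (4 * (Real.pi - s) ^ (-(1 / 2) : ℝ)) := by
          refine le_trans ?_ (lintegral_rpow_neg_three_half_le hs.1 hs.2)
          have : (fun t => (Ioi t).indicator (fun _ => D t) s) = (Iio s).indicator D := by
            ext t
            by_cases h : t < s
            · rw [indicator_of_mem (show s ∈ Ioi t from h),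
                indicator_of_mem (show t ∈ Iio s from h)]
            · rw [indicator_of_notMem (show s ∉ Ioi t from h),
                indicator_of_notMem (show t ∉ Iio s from h)]
          rw [this, lintegral_indicator measurableSet_Iio,
            Measure.restrict_restrict measurableSet_Iio]
          refine lintegral_mono_set fun t ht => ⟨ht.2.1, ht.1⟩
        calc _ ≤ ENNReal.ofReal (4 * (Real.pi - s) ^ (-(1 / 2) : ℝ)) * (γ s ^ 2 * A s ^ 2) := by
              gcongr
          _ = (A s ^ 2 * ENNReal.ofReal (4 * (Real.pi - s) ^ (-(1 / 2) : ℝ))) * γ s ^ 2 := by ring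
          _ = _ := by rw [hA2 s hs.2]
    _ = 4 * ∫⁻ s in Ioo 0 Real.pi, γ s ^ 2 :=
        lintegral_const_mul' _ _ (by norm_num)

lemma MemL2.intervalIntegrable {f : ℝ → ℂ} (hf : MemL2 f) :
    IntervalIntegrable f volume 0 Real.pi := by
  have : IsFiniteMeasure volPi := ⟨by simp [volPi]⟩
  rw [intervalIntegrable_iff_integrableOn_Ioo_of_le Real.pi_pos.le]
  exact MemLp.integrable (μ := volPi) one_le_two hf

lemma aestronglyMeasurable_primitive_div {g : ℝ → ℂ}
    (hg : IntervalIntegrable g volume 0 Real.pi) :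
    AEStronglyMeasurable (fun t => (∫ s in (0 : ℝ)..t, g s) / ((Real.pi - t : ℝ) : ℂ)) volPi := by
  have h1 : ContinuousOn (fun t => ∫ s in (0 : ℝ)..t, g s) (Ioo 0 Real.pi) := by
    have := intervalIntegral.continuousOn_primitive_interval' hg left_mem_uIcc
    rw [uIcc_of_le Real.pi_pos.le] at this
    exact this.mono Ioo_subset_Icc_self
  refine ContinuousOn.aestronglyMeasurable (h1.div (by fun_prop) fun t ht => ?_) measurableSet_Ioo
  exact pi_sub_ne_zero ht.2

/-- The inverse of the singular Volterra operator is bounded in `L₂` on functions of mean zero: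
for those, `∫₀ᵗ g = -∫ₜ^π g`, and Hardy's inequality applies. -/
lemma memL2_hardyInv {g : ℝ → ℂ} (hg : MemL2 g) (h0 : ∫ s in (0 : ℝ)..Real.pi, g s = 0) :
    MemL2 (hardyInv g) ∧ normL2 (hardyInv g) ≤ 3 * normL2 g := by
  have hgi := hg.intervalIntegrable
  set h : ℝ → ℂ := fun t => (∫ s in (0 : ℝ)..t, g s) / ((Real.pi - t : ℝ) : ℂ) with hh
  have hm : AEStronglyMeasurable h volPi := aestronglyMeasurable_primitive_div hgi
  have hle : normL2 h ≤ 2 * normL2 g := by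
    rw [← ENNReal.pow_le_pow_left_iff two_ne_zero, mul_pow, normL2_sq, normL2_sq]
    have hγ : AEMeasurable (fun s => ‖g s‖ₑ) (volume.restrict (Ioo 0 Real.pi)) :=
      hg.aestronglyMeasurable.enorm
    refine le_trans (setLIntegral_mono' measurableSet_Ioo fun t ht => ?_)
      ((lintegral_hardy_le hγ).trans_eq (by norm_num))
    have hpos : 0 < Real.pi - t := sub_pos.2 ht.2
    have hsub1 : IntervalIntegrable g volume 0 t := hgi.mono_set (by
      rw [uIcc_of_le ht.1.le, uIcc_of_le Real.pi_pos.le]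
      exact Icc_subset_Icc le_rfl ht.2.le)
    have hsub2 : IntervalIntegrable g volume t Real.pi := hgi.mono_set (by
      rw [uIcc_of_le ht.2.le, uIcc_of_le Real.pi_pos.le]
      exact Icc_subset_Icc ht.1.le le_rfl)
    have e : ∫ s in (0 : ℝ)..t, g s = -∫ s in t..Real.pi, g s := by
      rw [← intervalIntegral.integral_add_adjacent_intervals hsub1 hsub2] at h0
      exact eq_neg_of_add_eq_zero_left h0
    have e2 : ‖h t‖ₑ ≤ ENNReal.ofReal (Real.pi - t)⁻¹ * ∫⁻ s in Ioo t Real.pi, ‖g s‖ₑ := by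
      rw [hh]
      simp only
      rw [e, div_eq_inv_mul, enorm_mul, enorm_neg, intervalIntegral.integral_of_le ht.2.le,
        integral_Ioc_eq_integral_Ioo]
      have e3 : ‖(((Real.pi - t : ℝ) : ℂ))⁻¹‖ₑ = ENNReal.ofReal (Real.pi - t)⁻¹ := by
        rw [← ofReal_norm, norm_inv, Complex.norm_real, Real.norm_of_nonneg hpos.le]
      rw [e3]
      gcongr
      exact enorm_integral_le_lintegral_enorm _
    gcongr
  have hadd : normL2 (hardyInv g) ≤ 3 * normL2 g := by
    calc normL2 (hardyInv g) ≤ normL2 g + normL2 h :=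
          eLpNorm_add_le hg.aestronglyMeasurable hm one_le_two
      _ ≤ normL2 g + 2 * normL2 g := by gcongr
      _ = 3 * normL2 g := by ring
  refine ⟨⟨hg.aestronglyMeasurable.add hm, hadd.trans_lt ?_⟩, hadd⟩
  exact ENNReal.mul_lt_top (by norm_num) hg.2

lemma normL2_comp_half {q : ℝ → ℂ} (hq : MemL2 q) :
    MemL2 (fun t => q (t / 2)) ∧ normL2 (fun t => q (t / 2)) ≤ 2 * normL2 q := by
  set φ : ℝ → ℝ := fun t => 2⁻¹ * t with hφ
  have hφm : MeasurableEmbedding φ := measurableEmbedding_mulLeft₀ (by norm_num)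
  have hpre : φ ⁻¹' (Ioo 0 (Real.pi / 2)) = Ioo 0 Real.pi := by
    ext t
    simp only [hφ, mem_preimage, mem_Ioo]
    constructor <;> rintro ⟨h1, h2⟩ <;> constructor <;> linarith
  have hmap : Measure.map φ volPi = (2 : ENNReal) • volume.restrict (Ioo 0 (Real.pi / 2)) := by
    rw [volPi, ← hpre, ← Measure.restrict_map hφm.measurable measurableSet_Ioo,
      Real.map_volume_mul_left (by norm_num), Measure.restrict_smul]
    norm_num
  have heq : (fun t => q (t / 2)) = q ∘ φ := by
    ext t
    simp only [hφ, Function.comp_apply]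
    congr 1
    ring
  have hle : normL2 (fun t => q (t / 2)) ≤ 2 * normL2 q := by
    rw [normL2, heq, ← hφm.eLpNorm_map_measure, hmap,
      eLpNorm_smul_measure_of_ne_top (by norm_num)]
    rw [smul_eq_mul]
    gcongr
    · calc (2 : ENNReal) ^ (1 / 2 : ENNReal).toReal ≤ 2 ^ (1 : ℝ) := by
            apply ENNReal.rpow_le_rpow_of_exponent_le <;> norm_num
        _ = 2 := ENNReal.rpow_one _
    · exact eLpNorm_mono_measure _ (Measure.restrict_mono
        (Ioo_subset_Ioo le_rfl (by linarith [Real.pi_pos])) le_rfl)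
  refine ⟨⟨?_, hle.trans_lt (ENNReal.mul_lt_top (by norm_num) hq.2)⟩, hle⟩
  rw [heq]
  refine AEStronglyMeasurable.comp_measurable ?_ hφm.measurable
  rw [hmap]
  refine AEStronglyMeasurable.smul_measure ?_ _
  exact AEStronglyMeasurable.mono_set
    (Ioo_subset_Ioo le_rfl (by linarith [Real.pi_pos])) hq.aestronglyMeasurable

lemma normL2_comp_sub {q : ℝ → ℂ} (hq : MemL2 q) :
    MemL2 (fun t => q (Real.pi - t)) ∧ normL2 (fun t => q (Real.pi - t)) = normL2 q := by
  have hpre : (fun t => Real.pi - t) ⁻¹' (Ioo 0 Real.pi) = Ioo 0 Real.pi := by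
    ext t
    simp only [mem_preimage, mem_Ioo]
    constructor <;> rintro ⟨h1, h2⟩ <;> constructor <;> linarith
  have hmp : MeasurePreserving (fun t => Real.pi - t) volPi volPi := by
    have := (Measure.measurePreserving_sub_left volume Real.pi).restrict_preimage
      (measurableSet_Ioo (a := 0) (b := Real.pi))
    rwa [hpre] at this
  exact ⟨MemLp.comp_measurePreserving hq hmp,
    eLpNorm_comp_measurePreserving hq.aestronglyMeasurable hmp⟩

lemma memL2_mainData {q v : ℝ → ℂ} (hq : MemL2 q) (hv : MemL2 v) :
    MemL2 (mainData q v) ∧ normL2 (mainData q v) ≤ 2 * normL2 v + 2 * normL2 q := by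
  obtain ⟨h1, h1'⟩ := normL2_comp_sub hv
  obtain ⟨h2, h2'⟩ := normL2_comp_half hq
  obtain ⟨h3, h3'⟩ := normL2_comp_sub hq
  obtain ⟨h4, h4'⟩ := normL2_comp_half h3
  have h5 : MemL2 (fun t => (1 / 2 : ℂ) * (q (t / 2) + q (Real.pi - t / 2))) :=
    MemLp.const_mul (h2.add h4) _
  have h6 : MemL2 (fun t => -2 * v (Real.pi - t)) := MemLp.const_mul h1 _
  refine ⟨h6.add h5, (eLpNorm_add_le h6.aestronglyMeasurable h5.aestronglyMeasurable
    one_le_two).trans (add_le_add ?_ ?_)⟩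
  · have := eLpNorm_const_smul (-2 : ℂ) (fun t => v (Real.pi - t)) 2 volPi
    refine (this.trans_le ?_)
    have e : ‖(-2 : ℂ)‖ₑ = 2 := by
      rw [← ofReal_norm]; simp
    rw [e]
    exact (congrArg (2 * ·) h1').le
  · have := eLpNorm_const_smul (1 / 2 : ℂ) (fun t => q (t / 2) + q (Real.pi - t / 2)) 2 volPi
    refine (this.trans_le ?_)
    have e : ‖(1 / 2 : ℂ)‖ₑ = 2⁻¹ := by
      rw [← ofReal_norm]
      simp [ENNReal.ofReal_inv_of_pos]
    rw [e]
    have h7 : eLpNorm (fun t => q (t / 2) + q (Real.pi - t / 2)) 2 volPi ≤ 4 * normL2 q := by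
      refine (eLpNorm_add_le h2.aestronglyMeasurable h4.aestronglyMeasurable one_le_two).trans ?_
      calc _ ≤ 2 * normL2 q + 2 * normL2 q := add_le_add h2' (h4'.trans_eq (by rw [h3']))
        _ = 4 * normL2 q := by ring
    calc _ ≤ (2⁻¹ : ENNReal) * (4 * normL2 q) := by gcongr
      _ = 2⁻¹ * 2 * (2 * normL2 q) := by ring
      _ = 2 * normL2 q := by rw [ENNReal.inv_mul_cancel (by norm_num) (by norm_num), one_mul]

/-! ### Exponentially weighted estimates -/

lemma integral_norm_mul_sq_le {f : ℝ → ℂ} (hf : MemL2 f) {S : ℝ} (hS0 : 0 ≤ S)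
    (hS : normL2 f ≤ ENNReal.ofReal S) {h : ℝ → ℝ} (hh : Continuous h) (h0 : ∀ s, 0 ≤ h s) :
    (∫ s in (0 : ℝ)..Real.pi, ‖f s‖ * h s) ^ 2 ≤ S ^ 2 * ∫ s in (0 : ℝ)..Real.pi, h s ^ 2 := by
  have hpi := Real.pi_pos.le
  have hi : IntervalIntegrable (fun s => ‖f s‖ * h s) volume 0 Real.pi :=
    hf.intervalIntegrable.norm.mul_continuousOn hh.continuousOn
  have h2 : 0 ≤ ∫ s in (0 : ℝ)..Real.pi, h s ^ 2 :=
    intervalIntegral.integral_nonneg hpi fun s _ => sq_nonneg _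
  have e1 : ENNReal.ofReal (∫ s in (0 : ℝ)..Real.pi, ‖f s‖ * h s)
      = ∫⁻ s in Ioo 0 Real.pi, ‖f s‖ₑ * ENNReal.ofReal (h s) := by
    rw [← lintegral_Ioo_ofReal hpi hi fun s _ => mul_nonneg (norm_nonneg _) (h0 s)]
    refine setLIntegral_congr_fun measurableSet_Ioo fun s _ => ?_
    simp only [ENNReal.ofReal_mul (norm_nonneg (f s)), ofReal_norm]
  have e2 : ∫⁻ s in Ioo 0 Real.pi, ENNReal.ofReal (h s) ^ 2
      = ENNReal.ofReal (∫ s in (0 : ℝ)..Real.pi, h s ^ 2) := by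
    rw [← lintegral_Ioo_ofReal (f := fun s => h s ^ 2) hpi
      ((hh.pow 2).intervalIntegrable _ _) fun s _ => sq_nonneg _]
    refine setLIntegral_congr_fun measurableSet_Ioo fun s _ => ?_
    simp only [ENNReal.ofReal_pow (h0 s)]
  have h3 := lintegral_mul_sq_le (μ := volume.restrict (Ioo 0 Real.pi)) (f := fun s => ‖f s‖ₑ)
    (g := fun s => ENNReal.ofReal (h s)) hf.aestronglyMeasurable.enorm
    hh.measurable.ennreal_ofReal.aemeasurable
  rw [← e1, e2, ← normL2_sq, ← ENNReal.ofReal_pow (intervalIntegral.integral_nonneg hpi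
    fun s _ => mul_nonneg (norm_nonneg _) (h0 s))] at h3
  refine (ENNReal.ofReal_le_ofReal_iff (by positivity)).1 (h3.trans ?_)
  rw [ENNReal.ofReal_mul (by positivity), ENNReal.ofReal_pow hS0]
  gcongr

lemma integral_norm_le {f : ℝ → ℂ} (hf : MemL2 f) {S : ℝ} (hS0 : 0 ≤ S)
    (hS : normL2 f ≤ ENNReal.ofReal S) : ∫ s in (0 : ℝ)..Real.pi, ‖f s‖ ≤ 2 * S := by
  have h := integral_norm_mul_sq_le hf hS0 hS (h := fun _ => 1) continuous_const
    (fun _ => zero_le_one)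
  simp only [mul_one, one_pow, intervalIntegral.integral_const, sub_zero, smul_eq_mul] at h
  refine abs_le_of_sq_le_sq' (?_ : _ ^ 2 ≤ _ ^ 2) (by positivity) |>.2
  nlinarith [Real.pi_le_four, sq_nonneg S]

/-- The exponential weight makes an `L₂` function small in `L₁`: by Cauchy–Schwarz the gain is
`L^(-1/2) = ε²`. -/
lemma integral_norm_mul_exp_le {f : ℝ → ℂ} (hf : MemL2 f) {S : ℝ} (hS0 : 0 ≤ S)
    (hS : normL2 f ≤ ENNReal.ofReal S) {L ε : ℝ} (hε : 0 < ε) (hL : L * ε ^ 4 = 1) :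
    ∫ s in (0 : ℝ)..Real.pi, ‖f s‖ * Real.exp (-(L * s)) ≤ S * ε ^ 2 := by
  have h := integral_norm_mul_sq_le hf hS0 hS (h := fun s => Real.exp (-(L * s))) (by fun_prop)
    (fun _ => (Real.exp_pos _).le)
  have hL0 : 0 < L := pos_of_mul_pos_left (hL ▸ one_pos) (by positivity)
  have e : ∫ s in (0 : ℝ)..Real.pi, Real.exp (-(L * s)) ^ 2 ≤ ε ^ 4 := by
    have h1 : ∀ s, Real.exp (-(L * s)) ^ 2 = Real.exp (-(2 * L) * s) := by
      intro s
      rw [← Real.exp_nat_mul]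
      congr 1
      push_cast
      ring
    have h2 : ε ^ 4 = 1 / L := by
      field_simp
      linarith
    simp only [h1]
    rw [intervalIntegral.integral_comp_mul_left (fun x => Real.exp x) (by linarith : -(2 * L) ≠ 0),
      integral_exp, h2, smul_eq_mul, mul_zero, Real.exp_zero]
    have h3 := Real.exp_pos (-(2 * L) * Real.pi)
    rw [inv_mul_eq_div, div_le_iff_of_neg (by linarith)]
    have : 1 / L * -(2 * L) = -2 := by field_simp
    linarith
  refine abs_le_of_sq_le_sq' (?_ : _ ^ 2 ≤ _ ^ 2) (by positivity) |>.2
  calc _ ≤ S ^ 2 * ε ^ 4 := h.trans (mul_le_mul_of_nonneg_left e (sq_nonneg S))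
    _ = (S * ε ^ 2) ^ 2 := by ring

section Estimates

variable {M : ℝ → ℂ} {φ : ℝ → ℝ} {L κ n σ a b : ℝ}

lemma integral_exp_mul_le (hκ : 0 ≤ κ) (hL : L * κ = 1) (t : ℝ) :
    ∫ s in (0 : ℝ)..t, Real.exp (L * s) ≤ κ * Real.exp (L * t) := by
  have hL0 : L ≠ 0 := by rintro rfl; simp at hL
  have : κ = L⁻¹ := eq_inv_of_mul_eq_one_right hL
  rw [intervalIntegral.integral_comp_mul_left (fun x => Real.exp x) hL0, integral_exp, smul_eq_mul,
    ← this, mul_zero, Real.exp_zero]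
  nlinarith [hκ]

/-- The exponentially weighted estimate behind all the others: a bound of the form
`φ(s) + n e^{L s}`, with `φ` small in the weighted `L₁` norm, is convolved with
`a + b e^{L τ}`. -/
lemma weighted_convolution_le
    (hM : IntervalIntegrable (fun s => ((Real.pi - s : ℝ) : ℂ) * M s) volume 0 Real.pi)
    (hφ : IntervalIntegrable φ volume 0 Real.pi) (hφ0 : ∀ s, 0 ≤ φ s) (hn : 0 ≤ n)
    (hMφ : ∀ᵐ s ∂volPi, ‖((Real.pi - s : ℝ) : ℂ) * M s‖ ≤ φ s + n * Real.exp (L * s))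
    (hσ : ∫ s in (0 : ℝ)..Real.pi, φ s * Real.exp (-(L * s)) ≤ σ)
    (hκ : 0 < κ) (hL : L * κ = 1) (ha : 0 ≤ a) (hb : 0 ≤ b) {t : ℝ} (ht0 : 0 ≤ t)
    (ht : t ≤ Real.pi) :
    ∫ s in (0 : ℝ)..t, ‖((Real.pi - s : ℝ) : ℂ) * M s‖ * (a + b * Real.exp (L * (t - s)))
      ≤ (a * (σ + n * κ) + b * (σ + n * Real.pi)) * Real.exp (L * t) := by
  have hL0 : 0 < L := pos_of_mul_pos_left (hL ▸ one_pos) hκ.le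
  have hsub : uIcc 0 t ⊆ uIcc 0 Real.pi := by
    rw [uIcc_of_le ht0, uIcc_of_le Real.pi_pos.le]
    exact Icc_subset_Icc le_rfl ht
  have i0 : IntervalIntegrable (fun s => φ s * Real.exp (-(L * s))) volume 0 Real.pi :=
    hφ.mul_continuousOn (by fun_prop)
  have i1 : IntervalIntegrable (fun s => (a + b) * Real.exp (L * t)
      * (φ s * Real.exp (-(L * s)))) volume 0 t := (i0.mono_set hsub).const_mul _
  have i2 : IntervalIntegrable (fun s => n * a * Real.exp (L * s)) volume 0 t :=
    Continuous.intervalIntegrable (by fun_prop) _ _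
  have i3 : IntervalIntegrable (fun _ : ℝ => n * b * Real.exp (L * t)) volume 0 t := by simp
  have i4 : IntervalIntegrable (fun s => ‖((Real.pi - s : ℝ) : ℂ) * M s‖
      * (a + b * Real.exp (L * (t - s)))) volume 0 t :=
    (hM.mono_set hsub).norm.mul_continuousOn (by fun_prop)
  have key : ∫ s in (0 : ℝ)..t, ‖((Real.pi - s : ℝ) : ℂ) * M s‖ * (a + b * Real.exp (L * (t - s)))
      ≤ ∫ s in (0 : ℝ)..t, ((a + b) * Real.exp (L * t) * (φ s * Real.exp (-(L * s)))
        + n * a * Real.exp (L * s) + n * b * Real.exp (L * t)) := by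
    refine intervalIntegral.integral_mono_ae_restrict ht0 i4 ((i1.add i2).add i3) ?_
    have hae := ae_volPi_iff.1 hMφ
    have hne : ∀ᵐ s : ℝ, s ≠ t := by simp [ae_iff, measure_singleton]
    have hne0 : ∀ᵐ s : ℝ, s ≠ 0 := by simp [ae_iff, measure_singleton]
    refine (ae_restrict_iff' measurableSet_Icc).2 ?_
    filter_upwards [hae, hne, hne0] with s h1 h2 h3 hs
    have hs0 : 0 < s := lt_of_le_of_ne hs.1 (Ne.symm h3)
    have hst : s < t := lt_of_le_of_ne hs.2 h2
    have h4 := h1 ⟨hs0, hst.trans_le ht⟩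
    have h5 : Real.exp (L * t) * Real.exp (-(L * s)) = Real.exp (L * (t - s)) := by
      rw [← Real.exp_add]
      congr 1
      ring
    have h6 : Real.exp (L * s) * Real.exp (L * (t - s)) = Real.exp (L * t) := by
      rw [← Real.exp_add]
      congr 1
      ring
    have h7 : 1 ≤ Real.exp (L * (t - s)) :=
      Real.one_le_exp (mul_nonneg hL0.le (by linarith))
    calc _ ≤ (φ s + n * Real.exp (L * s)) * (a + b * Real.exp (L * (t - s))) := by gcongr
      _ = φ s * (a * 1 + b * Real.exp (L * (t - s))) + n * a * Real.exp (L * s)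
          + n * b * (Real.exp (L * s) * Real.exp (L * (t - s))) := by ring
      _ ≤ φ s * (a * Real.exp (L * (t - s)) + b * Real.exp (L * (t - s)))
          + n * a * Real.exp (L * s) + n * b * Real.exp (L * t) := by
          rw [h6]
          have := hφ0 s
          gcongr
      _ = _ := by
          rw [← h5]
          ring
  refine key.trans ?_
  rw [intervalIntegral.integral_add (i1.add i2) i3, intervalIntegral.integral_add i1 i2,
    intervalIntegral.integral_const_mul, intervalIntegral.integral_const_mul,
    intervalIntegral.integral_const, smul_eq_mul, sub_zero]
  have j1 : ∫ s in (0 : ℝ)..t, φ s * Real.exp (-(L * s)) ≤ σ := by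
    refine le_trans ?_ hσ
    exact intervalIntegral.integral_mono_interval le_rfl ht0 ht
      (Filter.Eventually.of_forall fun s => mul_nonneg (hφ0 s) (Real.exp_pos _).le) i0
  have j2 := integral_exp_mul_le hκ.le hL t
  have hE := Real.exp_pos (L * t)
  calc _ ≤ (a + b) * Real.exp (L * t) * σ + n * a * (κ * Real.exp (L * t))
        + Real.pi * (n * b * Real.exp (L * t)) := by gcongr
    _ = _ := by ring

lemma norm_primitive_le_exp {P : ℝ → ℝ → ℂ} (hκ : 0 < κ) (hL : L * κ = 1) (ha : 0 ≤ a) (hb : 0 ≤ b)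
    {y t τ : ℝ} (ht0 : 0 ≤ t) (htτ : t ≤ τ)
    (hP : ∀ η, 0 ≤ η → η ≤ t → ‖P y η‖ ≤ a + b * Real.exp (L * η)) :
    ‖∫ ξ in (0 : ℝ)..t, P y ξ‖ ≤ (a + b) * κ * Real.exp (L * τ) := by
  have hL0 : 0 < L := pos_of_mul_pos_left (hL ▸ one_pos) hκ.le
  have h1 : ‖∫ ξ in (0 : ℝ)..t, P y ξ‖ ≤ ∫ ξ in (0 : ℝ)..t, (a + b) * Real.exp (L * ξ) := by
    refine intervalIntegral.norm_integral_le_of_norm_le ht0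
      (Filter.Eventually.of_forall fun η hη => (hP η hη.1.le hη.2).trans ?_)
      (Continuous.intervalIntegrable (by fun_prop) _ _)
    have : 1 ≤ Real.exp (L * η) := Real.one_le_exp (mul_nonneg hL0.le hη.1.le)
    nlinarith
  refine h1.trans ?_
  rw [intervalIntegral.integral_const_mul, mul_assoc]
  have h2 := integral_exp_mul_le hκ.le hL t
  have h3 : Real.exp (L * t) ≤ Real.exp (L * τ) := Real.exp_le_exp.2 (by gcongr)
  gcongr
  exact h2.trans (by gcongr)

variable {q : ℝ → ℂ} {P : ℝ → ℝ → ℂ} {A x t : ℝ}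

lemma integral_norm_mono (hq : IntervalIntegrable q volume 0 Real.pi)
    (hA : ∫ s in (0 : ℝ)..Real.pi, ‖q s‖ ≤ A) (hx0 : 0 ≤ x) (hx : x ≤ Real.pi) :
    ∫ s in (0 : ℝ)..x, ‖q s‖ ≤ A :=
  (intervalIntegral.integral_mono_interval le_rfl hx0 hx
    (Filter.Eventually.of_forall fun _ => norm_nonneg _) hq.norm).trans hA

lemma norm_charInt_le_exp (hq : IntervalIntegrable q volume 0 Real.pi)
    (hA : ∫ s in (0 : ℝ)..Real.pi, ‖q s‖ ≤ A)
    (hκ : 0 < κ) (hL : L * κ = 1) (ha : 0 ≤ a) (hb : 0 ≤ b)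
    (hPb : ∀ y t, 0 ≤ t → t ≤ y → y ≤ Real.pi → ‖P y t‖ ≤ a + b * Real.exp (L * t))
    (ht0 : 0 ≤ t) (htx : t ≤ x) (hx : x ≤ Real.pi) :
    ‖charInt q P x t‖ ≤ 3 * A * (a + b) * κ * Real.exp (L * t) := by
  have hqx : IntervalIntegrable q volume 0 x := hq.mono_set (by
    rw [uIcc_of_le (ht0.trans htx), uIcc_of_le Real.pi_pos.le]
    exact Icc_subset_Icc le_rfl hx)
  have hE := (Real.exp_pos (L * t)).le
  have := norm_charInt_le (P := P) (R := (a + b) * κ * Real.exp (L * t)) hqx ht0 htx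
    (by positivity) (fun y r h1 h2 h3 h4 => norm_primitive_le_exp hκ hL ha hb h1 h4
      fun η h5 h6 => hPb y η h5 (h6.trans h2) (h3.trans hx))
  refine this.trans ?_
  have h2 := integral_norm_mono hq hA (ht0.trans htx) hx
  calc _ ≤ 3 * (A * ((a + b) * κ * Real.exp (L * t))) := by gcongr
    _ = _ := by ring

lemma norm_charDeriv_le_exp (hq : IntervalIntegrable q volume 0 Real.pi)
    (hA : ∫ s in (0 : ℝ)..Real.pi, ‖q s‖ ≤ A)
    (hL0 : 0 ≤ L) (ha : 0 ≤ a) (hb : 0 ≤ b)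
    (hPb : ∀ y t, 0 ≤ t → t ≤ y → y ≤ Real.pi → ‖P y t‖ ≤ a + b * Real.exp (L * t))
    (ht0 : 0 ≤ t) (htx : t ≤ x) (hx : x ≤ Real.pi) :
    ‖charDeriv q P x t‖ ≤ 3 * A * (a + b) * Real.exp (L * t) := by
  have hqx : IntervalIntegrable q volume 0 x := hq.mono_set (by
    rw [uIcc_of_le (ht0.trans htx), uIcc_of_le Real.pi_pos.le]
    exact Icc_subset_Icc le_rfl hx)
  have hE : 1 ≤ Real.exp (L * t) := Real.one_le_exp (mul_nonneg hL0 ht0)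
  have := norm_charDeriv_le (P := P) (R := (a + b) * Real.exp (L * t)) hqx ht0 htx
    (by positivity) (fun y r h1 h2 h3 h4 => by
      refine (hPb y r h1 h2 (h3.trans hx)).trans ?_
      have : Real.exp (L * r) ≤ Real.exp (L * t) := Real.exp_le_exp.2 (by gcongr)
      nlinarith)
  refine this.trans ?_
  have h2 := integral_norm_mono hq hA (ht0.trans htx) hx
  calc _ ≤ 3 * (A * ((a + b) * Real.exp (L * t))) := by gcongr
    _ = _ := by ring

section Conv

variable
    (hM : IntervalIntegrable (fun s => ((Real.pi - s : ℝ) : ℂ) * M s) volume 0 Real.pi)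
    (hφ : IntervalIntegrable φ volume 0 Real.pi) (hφ0 : ∀ s, 0 ≤ φ s) (hn : 0 ≤ n)
    (hMφ : ∀ᵐ s ∂volPi, ‖((Real.pi - s : ℝ) : ℂ) * M s‖ ≤ φ s + n * Real.exp (L * s))
    (hσ : ∫ s in (0 : ℝ)..Real.pi, φ s * Real.exp (-(L * s)) ≤ σ)
    (hκ : 0 < κ) (hL : L * κ = 1) (ha : 0 ≤ a) (hb : 0 ≤ b)
    (hPb : ∀ y t, 0 ≤ t → t ≤ y → y ≤ Real.pi → ‖P y t‖ ≤ a + b * Real.exp (L * t))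
    (ht0 : 0 ≤ t) (htx : t ≤ x) (hx : x ≤ Real.pi)

include hM hφ hφ0 hn hMφ hσ hκ hL ht0 htx hx in
lemma norm_freeConv_le_exp :
    ‖∫ s in (0 : ℝ)..t, ((x - t : ℝ) : ℂ) * M s‖ ≤ (σ + n * κ) * Real.exp (L * t) := by
  simp only [mul_comm _ (M _)]
  refine (norm_integral_mul_weight_le hM ht0 (htx.trans hx) (c := fun _ => ((x - t : ℝ) : ℂ))
    (r := fun s => 1 + 0 * Real.exp (L * (t - s))) (by fun_prop) fun s hs => ?_).trans
    ((weighted_convolution_le hM hφ hφ0 hn hMφ hσ hκ hL zero_le_one le_rfl ht0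
      (htx.trans hx)).trans_eq (by ring))
  rw [Complex.norm_real, Real.norm_of_nonneg (sub_nonneg.2 htx)]
  linarith [hs.2]

include hM hφ hφ0 hn hMφ hσ hκ hL ha hb hPb ht0 htx hx in
lemma norm_convInt_le_exp :
    ‖convInt M P x t‖ ≤ 3 * (a + b) * κ * (σ + n * Real.pi) * Real.exp (L * t) := by
  refine (norm_integral_mul_weight_le hM ht0 (htx.trans hx)
    (c := fun s => charInt (fun _ => 1) P (x - s) (t - s))
    (r := fun s => 0 + (3 * (a + b) * κ) * Real.exp (L * (t - s))) (by fun_prop)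
    fun s hs => ?_).trans
    ((weighted_convolution_le hM hφ hφ0 hn hMφ hσ hκ hL le_rfl (by positivity) ht0
      (htx.trans hx)).trans_eq (by ring))
  have hE := (Real.exp_pos (L * (t - s))).le
  refine (norm_charInt_one_le (R := (a + b) * κ * Real.exp (L * (t - s))) (by linarith [hs.2])
    (by linarith) (by positivity) (fun y r h1 h2 h3 h4 =>
      norm_primitive_le_exp hκ hL ha hb h1 h4 fun η h5 h6 => hPb y η h5 (h6.trans h2)
        (by linarith [hs.1]))).trans ?_
  calc (x - s) * (3 * ((a + b) * κ * Real.exp (L * (t - s))))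
      ≤ (Real.pi - s) * (3 * ((a + b) * κ * Real.exp (L * (t - s)))) := by gcongr
    _ = _ := by ring

include hM hφ hφ0 hn hMφ hσ hκ hL ha hb hPb ht0 htx hx in
lemma norm_convDeriv_le_exp :
    ‖convDeriv M P x t‖
      ≤ 3 * (a * (σ + n * κ) + b * (σ + n * Real.pi)) * Real.exp (L * t) := by
  have hL0 : 0 < L := pos_of_mul_pos_left (hL ▸ one_pos) hκ.le
  refine (norm_integral_mul_weight_le hM ht0 (htx.trans hx)
    (c := fun s => charDeriv (fun _ => 1) P (x - s) (t - s))
    (r := fun s => 3 * a + (3 * b) * Real.exp (L * (t - s))) (by fun_prop)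
    fun s hs => ?_).trans
    ((weighted_convolution_le hM hφ hφ0 hn hMφ hσ hκ hL (by positivity) (by positivity) ht0
      (htx.trans hx)).trans_eq (by ring))
  have hE := (Real.exp_pos (L * (t - s))).le
  refine (norm_charDeriv_one_le (R := a + b * Real.exp (L * (t - s))) (by linarith [hs.2])
    (by linarith) (by positivity) (fun y r h1 h2 h3 h4 => by
      refine (hPb y r h1 h2 (by linarith [hs.1])).trans ?_
      gcongr)).trans ?_
  calc (x - s) * (3 * (a + b * Real.exp (L * (t - s))))
      ≤ (Real.pi - s) * (3 * (a + b * Real.exp (L * (t - s)))) := by gcongr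
    _ = _ := by ring

end Conv

end Estimates

/-! ### The contraction estimate -/

/-- The inverse of the singular Volterra operator is bounded in the exponentially weighted supremum
norm, uniformly in `L`, on functions of mean zero. -/
lemma norm_hardyInv_le {N : ℝ → ℂ} {L κ ν : ℝ} (hN : ContinuousOn N (Icc 0 Real.pi))
    (h0 : ∫ s in (0 : ℝ)..Real.pi, N s = 0) (hκ : 0 < κ) (hL : L * κ = 1) (hν : 0 ≤ ν)
    (hb : ∀ s ∈ Icc 0 Real.pi, ‖N s‖ ≤ ν * Real.exp (L * s)) {t : ℝ} (ht0 : 0 ≤ t)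
    (ht : t < Real.pi) : ‖hardyInv N t‖ ≤ 4 * ν * Real.exp (L * t) := by
  have hL0 : 0 < L := pos_of_mul_pos_left (hL ▸ one_pos) hκ.le
  have hpos : 0 < Real.pi - t := sub_pos.2 ht
  have hE := Real.exp_pos (L * t)
  have key : ‖∫ s in (0 : ℝ)..t, N s‖ ≤ (Real.pi - t) * (3 * ν * Real.exp (L * t)) := by
    rcases le_total (Real.pi - t) κ with h | h
    · -- at distance at most `1 / L` from `π` the integral is taken over `(t, π)` instead
      have i1 : IntervalIntegrable N volume 0 t :=
        (hN.mono (Icc_subset_Icc le_rfl ht.le)).intervalIntegrable_of_Icc ht0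
      have i2 : IntervalIntegrable N volume t Real.pi :=
        (hN.mono (Icc_subset_Icc ht0 le_rfl)).intervalIntegrable_of_Icc ht.le
      rw [← intervalIntegral.integral_add_adjacent_intervals i1 i2] at h0
      rw [eq_neg_of_add_eq_zero_left h0, norm_neg]
      have h1 : Real.exp (L * Real.pi) ≤ 3 * Real.exp (L * t) := by
        have e : L * Real.pi = L * (Real.pi - t) + L * t := by ring
        rw [e, Real.exp_add]
        have h2 : L * (Real.pi - t) ≤ 1 := by
          rw [← hL]
          gcongr
        have h3 : Real.exp (L * (Real.pi - t)) ≤ 3 :=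
          (Real.exp_le_exp.2 h2).trans (by linarith [Real.exp_one_lt_d9])
        gcongr
      have := intervalIntegral.norm_integral_le_of_norm_le_const (a := t) (b := Real.pi)
        (C := 3 * ν * Real.exp (L * t)) (f := N) (fun s hs => by
          rw [uIoc_of_le ht.le] at hs
          refine (hb s ⟨ht0.trans hs.1.le, hs.2⟩).trans ?_
          calc ν * Real.exp (L * s) ≤ ν * Real.exp (L * Real.pi) := by
                have := hs.2
                gcongr
            _ ≤ ν * (3 * Real.exp (L * t)) := by gcongr
            _ = _ := by ring)
      rw [abs_of_pos hpos] at this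
      linarith
    · have h1 : ‖∫ s in (0 : ℝ)..t, N s‖ ≤ ∫ s in (0 : ℝ)..t, ν * Real.exp (L * s) :=
        intervalIntegral.norm_integral_le_of_norm_le ht0
          (Filter.Eventually.of_forall fun s hs => hb s ⟨hs.1.le, hs.2.trans ht.le⟩)
          (Continuous.intervalIntegrable (by fun_prop) _ _)
      rw [intervalIntegral.integral_const_mul] at h1
      have h2 := integral_exp_mul_le hκ.le hL t
      calc _ ≤ ν * (κ * Real.exp (L * t)) := h1.trans (by gcongr)
        _ ≤ ν * ((Real.pi - t) * Real.exp (L * t)) := by gcongr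
        _ ≤ (Real.pi - t) * (3 * ν * Real.exp (L * t)) := by
            have : 0 ≤ (Real.pi - t) * (ν * Real.exp (L * t)) := by positivity
            linarith
  have h1 : ‖(∫ s in (0 : ℝ)..t, N s) / ((Real.pi - t : ℝ) : ℂ)‖ ≤ 3 * ν * Real.exp (L * t) := by
    rw [norm_div, Complex.norm_real, Real.norm_of_nonneg hpos.le, div_le_iff₀ hpos, mul_comm]
    exact key
  calc _ ≤ ‖N t‖ + _ := norm_add_le _ _
    _ ≤ ν * Real.exp (L * t) + 3 * ν * Real.exp (L * t) :=
        add_le_add (hb t ⟨ht0, ht.le⟩) h1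
    _ = _ := by ring

lemma hardyInv_sub {g N : ℝ → ℂ} (hg : IntervalIntegrable g volume 0 Real.pi)
    (hN : IntervalIntegrable N volume 0 Real.pi) {t : ℝ} (ht0 : 0 ≤ t) (ht : t ≤ Real.pi) :
    hardyInv (fun s => g s - N s) t = hardyInv g t - hardyInv N t := by
  have hsub : uIcc 0 t ⊆ uIcc 0 Real.pi := by
    rw [uIcc_of_le ht0, uIcc_of_le Real.pi_pos.le]
    exact Icc_subset_Icc le_rfl ht
  unfold hardyInv
  rw [intervalIntegral.integral_sub (hg.mono_set hsub) (hN.mono_set hsub)]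
  ring

/-- Twice the right-hand side of the kernel equation, without the term that depends on `q` only. -/
noncomputable def kernelMap (q M : ℝ → ℂ) (P : ℝ → ℝ → ℂ) (x t : ℝ) : ℂ :=
  charInt q P x t + convInt M P x t + ∫ s in (0 : ℝ)..t, ((x - t : ℝ) : ℂ) * M s

section Difference

variable {q M M' : ℝ → ℂ} {P P' : ℝ → ℝ → ℂ} {x t : ℝ}

lemma kernelTerm_eq (hP : Continuous (Function.uncurry P))
    (hM : IntervalIntegrable (fun s => ((Real.pi - s : ℝ) : ℂ) * M s) volume 0 Real.pi)
    (ht : 0 ≤ t) (htx : t ≤ x) (hx : x ≤ Real.pi) :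
    kernelFreeTerm q M x t + kernelOperator q M P x t
      = (1 / 2 : ℂ) * (∫ s in (t / 2)..(x - t / 2), q s) + (1 / 2 : ℂ) * kernelMap q M P x t := by
  rw [kernelOperator_eq hP hM ht htx hx, kernelFreeTerm, kernelMap]
  ring

variable (hq : IntervalIntegrable q volume 0 Real.pi)
  (hM : IntervalIntegrable (fun s => ((Real.pi - s : ℝ) : ℂ) * M s) volume 0 Real.pi)
  (hM' : IntervalIntegrable (fun s => ((Real.pi - s : ℝ) : ℂ) * M' s) volume 0 Real.pi)
  (hP : Continuous (Function.uncurry P)) (hP' : Continuous (Function.uncurry P'))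

include hM hM' in
lemma intervalIntegrable_weight_sub :
    IntervalIntegrable (fun s => ((Real.pi - s : ℝ) : ℂ) * (M s - M' s)) volume 0 Real.pi := by
  simpa only [mul_sub] using hM.sub hM'

include hM hP in
lemma intervalIntegrable_mul_charInt (ht : 0 ≤ t) (htx : t ≤ x) (hx : x ≤ Real.pi) :
    IntervalIntegrable (fun s => M s * charInt (fun _ => 1) P (x - s) (t - s)) volume 0 t := by
  obtain ⟨C, _, hC⟩ := exists_norm_charInt_one_le hP
  exact intervalIntegrable_mul_weight hM ht (htx.trans hx)
    (((continuous_charInt_one hP).uncurry_apply (by fun_prop) (by fun_prop)).measurable)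
    fun s hs => hC x t s hs.1.le hs.2.le htx hx

include hM hP in
lemma intervalIntegrable_mul_charDeriv (ht : 0 ≤ t) (htx : t ≤ x) (hx : x ≤ Real.pi) :
    IntervalIntegrable (fun s => M s * charDeriv (fun _ => 1) P (x - s) (t - s)) volume 0 t := by
  obtain ⟨C, _, hC⟩ := exists_norm_charDeriv_one_le hP
  exact intervalIntegrable_mul_weight hM ht (htx.trans hx)
    (((continuous_charDeriv_one hP).uncurry_apply (by fun_prop) (by fun_prop)).measurable)
    fun s hs => hC x t s hs.1.le hs.2.le htx hx

include hM hM' hP hP' in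
lemma convInt_sub (ht : 0 ≤ t) (htx : t ≤ x) (hx : x ≤ Real.pi) :
    convInt M P x t - convInt M' P' x t
      = convInt (fun s => M s - M' s) P x t + convInt M' (fun x t => P x t - P' x t) x t := by
  have hPP : Continuous (Function.uncurry fun x t => P x t - P' x t) := hP.sub hP'
  unfold convInt
  rw [← intervalIntegral.integral_sub (intervalIntegrable_mul_charInt hM hP ht htx hx)
    (intervalIntegrable_mul_charInt hM' hP' ht htx hx),
    ← intervalIntegral.integral_add
      (intervalIntegrable_mul_charInt (intervalIntegrable_weight_sub hM hM') hP ht htx hx)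
      (intervalIntegrable_mul_charInt hM' hPP ht htx hx)]
  refine intervalIntegral.integral_congr fun s hs => ?_
  rw [uIcc_of_le ht] at hs
  rw [charInt_sub (by simp) (by linarith [hs.2]) (by linarith) hP hP']
  ring

include hM hM' hP hP' in
lemma convDeriv_sub (ht : 0 ≤ t) (htx : t ≤ x) (hx : x ≤ Real.pi) :
    convDeriv M P x t - convDeriv M' P' x t
      = convDeriv (fun s => M s - M' s) P x t
        + convDeriv M' (fun x t => P x t - P' x t) x t := by
  have hPP : Continuous (Function.uncurry fun x t => P x t - P' x t) := hP.sub hP'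
  unfold convDeriv
  rw [← intervalIntegral.integral_sub (intervalIntegrable_mul_charDeriv hM hP ht htx hx)
    (intervalIntegrable_mul_charDeriv hM' hP' ht htx hx),
    ← intervalIntegral.integral_add
      (intervalIntegrable_mul_charDeriv (intervalIntegrable_weight_sub hM hM') hP ht htx hx)
      (intervalIntegrable_mul_charDeriv hM' hPP ht htx hx)]
  refine intervalIntegral.integral_congr fun s hs => ?_
  rw [uIcc_of_le ht] at hs
  rw [charDeriv_sub (by simp) (by linarith [hs.2]) (by linarith) hP hP']
  ring

include hM hM' in
lemma freeConv_sub (ht : 0 ≤ t) (htx : t ≤ x) (hx : x ≤ Real.pi) :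
    (∫ s in (0 : ℝ)..t, ((x - t : ℝ) : ℂ) * M s) - (∫ s in (0 : ℝ)..t, ((x - t : ℝ) : ℂ) * M' s)
      = ∫ s in (0 : ℝ)..t, ((x - t : ℝ) : ℂ) * (M s - M' s) := by
  have h : ∀ {M : ℝ → ℂ},
      IntervalIntegrable (fun s => ((Real.pi - s : ℝ) : ℂ) * M s) volume 0 Real.pi →
      IntervalIntegrable (fun s => ((x - t : ℝ) : ℂ) * M s) volume 0 t := by
    intro M hM
    simp only [mul_comm _ (M _)]
    refine intervalIntegrable_mul_weight hM ht (htx.trans hx) (C := 1) measurable_const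
      fun s hs => ?_
    rw [Complex.norm_real, Real.norm_of_nonneg (sub_nonneg.2 htx)]
    linarith [hs.2]
  rw [← intervalIntegral.integral_sub (h hM) (h hM')]
  simp only [mul_sub]

include hq hM hM' hP hP' in
lemma kernelMap_sub (ht : 0 ≤ t) (htx : t ≤ x) (hx : x ≤ Real.pi) :
    kernelMap q M P x t - kernelMap q M' P' x t
      = charInt q (fun x t => P x t - P' x t) x t + convInt (fun s => M s - M' s) P x t
        + convInt M' (fun x t => P x t - P' x t) x t
        + ∫ s in (0 : ℝ)..t, ((x - t : ℝ) : ℂ) * (M s - M' s) := by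
  have hqx : IntervalIntegrable q volume 0 x := hq.mono_set (by
    rw [uIcc_of_le (ht.trans htx), uIcc_of_le Real.pi_pos.le]
    exact Icc_subset_Icc le_rfl hx)
  rw [charInt_sub hqx ht htx hP hP', ← freeConv_sub hM hM' ht htx hx]
  unfold kernelMap
  linear_combination convInt_sub hM hM' hP hP' ht htx hx

include hq hM hM' hP hP' in
lemma kernelPart_sub (ht : 0 ≤ t) (ht' : t ≤ Real.pi) :
    kernelPart q M P t - kernelPart q M' P' t
      = charDeriv q (fun x t => P x t - P' x t) Real.pi t
        + convDeriv (fun s => M s - M' s) P Real.pi t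
        + convDeriv M' (fun x t => P x t - P' x t) Real.pi t := by
  rw [charDeriv_sub hq ht ht' hP hP']
  unfold kernelPart
  linear_combination convDeriv_sub hM hM' hP hP' ht ht' le_rfl

/-- The contraction estimate. With the weight `e^{L t}`, `L = ε⁻⁴`, and differences of the kernels
measured on the scale `ε`, the two sides of the system for `(M, P)` depend on `(M, P)` with a small
Lipschitz constant. -/
lemma contraction_estimate {A S a b n ε L D : ℝ} {φ : ℝ → ℝ}
    (hq : IntervalIntegrable q volume 0 Real.pi)
    (hM : IntervalIntegrable (fun s => ((Real.pi - s : ℝ) : ℂ) * M s) volume 0 Real.pi)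
    (hM' : IntervalIntegrable (fun s => ((Real.pi - s : ℝ) : ℂ) * M' s) volume 0 Real.pi)
    (hP : Continuous (Function.uncurry P)) (hP' : Continuous (Function.uncurry P'))
    (hA0 : 0 ≤ A) (hA : ∫ s in (0 : ℝ)..Real.pi, ‖q s‖ ≤ A)
    (hφ : IntervalIntegrable φ volume 0 Real.pi) (hφ0 : ∀ s, 0 ≤ φ s) (hn : 0 ≤ n)
    (hMφ : ∀ᵐ s ∂volPi, ‖((Real.pi - s : ℝ) : ℂ) * M' s‖ ≤ φ s + n * Real.exp (L * s))
    (hS : 0 ≤ S) (hσ : ∫ s in (0 : ℝ)..Real.pi, φ s * Real.exp (-(L * s)) ≤ S * ε ^ 2)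
    (hε : 0 < ε) (hε1 : ε ≤ 1) (hL : L * ε ^ 4 = 1) (ha : 0 ≤ a) (hb : 0 ≤ b) (hbε : b ≤ ε)
    (hPb : ∀ y t, 0 ≤ t → t ≤ y → y ≤ Real.pi → ‖P y t‖ ≤ a + b * Real.exp (L * t))
    (hC : (3 * A + 4 + 12 * (a + 1) * Real.pi + 12 * (a + Real.pi) + 3 * (S + n * Real.pi)) * ε
      ≤ 1 / 2)
    (hD : 0 ≤ D)
    (hPD : ∀ y t, 0 ≤ t → t ≤ y → y ≤ Real.pi → ‖P y t - P' y t‖ ≤ ε * D * Real.exp (L * t))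
    (hMD : ∀ᵐ s ∂volPi, ‖((Real.pi - s : ℝ) : ℂ) * (M s - M' s)‖ ≤ 4 * D * Real.exp (L * s)) :
    (∀ t, 0 ≤ t → t ≤ Real.pi →
      ‖kernelPart q M P t - kernelPart q M' P' t‖ ≤ 1 / 2 * D * Real.exp (L * t)) ∧
    ∀ x t, 0 ≤ t → t ≤ x → x ≤ Real.pi →
      ‖(1 / 2 : ℂ) * kernelMap q M P x t - (1 / 2 : ℂ) * kernelMap q M' P' x t‖
        ≤ 1 / 2 * (ε * D) * Real.exp (L * t) := by
  have hpi := Real.pi_pos.le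
  have hκ : 0 < ε ^ 4 := by positivity
  have hL0 : 0 ≤ L := (pos_of_mul_pos_left (hL ▸ one_pos) hκ.le).le
  have hPP : Continuous (Function.uncurry fun x t => P x t - P' x t) := hP.sub hP'
  have hMM := intervalIntegrable_weight_sub hM hM'
  have hMD' : ∀ᵐ s ∂volPi, ‖((Real.pi - s : ℝ) : ℂ) * (M s - M' s)‖
      ≤ (fun _ => (0 : ℝ)) s + 4 * D * Real.exp (L * s) := by simpa using hMD
  have hPD' : ∀ y t, 0 ≤ t → t ≤ y → y ≤ Real.pi →
      ‖P y t - P' y t‖ ≤ 0 + ε * D * Real.exp (L * t) := by simpa using hPD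
  have hεD : 0 ≤ ε * D := by positivity
  have h4D : 0 ≤ 4 * D := by positivity
  have z0 : IntervalIntegrable (fun _ : ℝ => (0 : ℝ)) volume 0 Real.pi := by simp
  have z1 : ∀ s : ℝ, (0 : ℝ) ≤ (fun _ => (0 : ℝ)) s := fun _ => le_rfl
  have z2 : ∫ s in (0 : ℝ)..Real.pi, (fun _ => (0 : ℝ)) s * Real.exp (-(L * s)) ≤ 0 := by simp
  have p2 : ε ^ 2 ≤ 1 := pow_le_one₀ hε.le hε1
  have p3 : ε ^ 3 ≤ 1 := pow_le_one₀ hε.le hε1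
  have p4 : ε ^ 4 ≤ ε := pow_le_of_le_one hε.le hε1 (by norm_num)
  have p42 : ε ^ 4 ≤ ε ^ 2 := pow_le_pow_of_le_one hε.le hε1 (by norm_num)
  constructor
  · intro t ht0 ht
    have hE := Real.exp_pos (L * t)
    have e1 := norm_charDeriv_le_exp hq hA hL0 le_rfl hεD hPD' ht0 ht le_rfl
    have e2 := norm_convDeriv_le_exp hMM z0 z1 h4D hMD' z2 hκ hL ha hb hPb ht0 ht le_rfl
    have e3 := norm_convDeriv_le_exp hM' hφ hφ0 hn hMφ hσ hκ hL le_rfl hεD hPD' ht0 ht le_rfl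
    rw [kernelPart_sub hq hM hM' hP hP' ht0 ht]
    refine (norm_add₃_le).trans ((add_le_add (add_le_add e1 e2) e3).trans ?_)
    rw [← add_mul, ← add_mul]
    refine mul_le_mul_of_nonneg_right ?_ hE.le
    calc 3 * A * (0 + ε * D) + 3 * (a * (0 + 4 * D * ε ^ 4) + b * (0 + 4 * D * Real.pi))
          + 3 * (0 * (S * ε ^ 2 + n * ε ^ 4) + ε * D * (S * ε ^ 2 + n * Real.pi))
        ≤ 3 * A * (0 + ε * D) + 3 * (a * (0 + 4 * D * ε) + ε * (0 + 4 * D * Real.pi))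
          + 3 * (0 * (S * ε ^ 2 + n * ε ^ 4) + ε * D * (S * 1 + n * Real.pi)) := by gcongr
      _ = (3 * A + 12 * (a + Real.pi) + 3 * (S + n * Real.pi)) * ε * D := by ring
      _ ≤ (3 * A + 4 + 12 * (a + 1) * Real.pi + 12 * (a + Real.pi) + 3 * (S + n * Real.pi)) * ε
          * D := by
          gcongr
          have : 0 ≤ 12 * (a + 1) * Real.pi := by positivity
          linarith
      _ ≤ 1 / 2 * D := by gcongr
  · intro x t ht0 htx hx
    have hE := Real.exp_pos (L * t)
    have e1 := norm_charInt_le_exp hq hA hκ hL le_rfl hεD hPD' ht0 htx hx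
    have e2 := norm_convInt_le_exp hMM z0 z1 h4D hMD' z2 hκ hL ha hb hPb ht0 htx hx
    have e3 := norm_convInt_le_exp hM' hφ hφ0 hn hMφ hσ hκ hL le_rfl hεD hPD' ht0 htx hx
    have e4 := norm_freeConv_le_exp hMM z0 z1 h4D hMD' z2 hκ hL ht0 htx hx
    have hhalf : ‖(1 / 2 : ℂ)‖ ≤ 1 := by norm_num
    rw [← mul_sub, norm_mul, kernelMap_sub hq hM hM' hP hP' ht0 htx hx]
    refine (mul_le_of_le_one_left (norm_nonneg _) hhalf).trans ?_
    refine (norm_add₄_le).trans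
      ((add_le_add (add_le_add (add_le_add e1 e2) e3) e4).trans ?_)
    rw [← add_mul, ← add_mul, ← add_mul]
    refine mul_le_mul_of_nonneg_right ?_ hE.le
    have hb1 : b ≤ 1 := hbε.trans hε1
    calc 3 * A * (0 + ε * D) * ε ^ 4 + 3 * (a + b) * ε ^ 4 * (0 + 4 * D * Real.pi)
          + 3 * (0 + ε * D) * ε ^ 4 * (S * ε ^ 2 + n * Real.pi) + (0 + 4 * D * ε ^ 4)
        ≤ 3 * A * (0 + 1 * D) * ε ^ 2 + 3 * (a + 1) * ε ^ 2 * (0 + 4 * D * Real.pi)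
          + 3 * (0 + 1 * D) * ε ^ 2 * (S * 1 + n * Real.pi) + (0 + 4 * D * ε ^ 2) := by gcongr
      _ = (3 * A + 4 + 12 * (a + 1) * Real.pi + 3 * (S + n * Real.pi)) * ε * (ε * D) := by ring
      _ ≤ (3 * A + 4 + 12 * (a + 1) * Real.pi + 12 * (a + Real.pi) + 3 * (S + n * Real.pi)) * ε
          * (ε * D) := by
          refine mul_le_mul_of_nonneg_right (mul_le_mul_of_nonneg_right ?_ hε.le) hεD
          have : 0 ≤ 12 * (a + Real.pi) := by positivity
          linarith
      _ ≤ 1 / 2 * (ε * D) := by gcongr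

end Difference

lemma exists_small_parameter {C c : ℝ} (hc : 0 < c) :
    ∃ ε L : ℝ, 0 < ε ∧ ε ≤ 1 ∧ L * ε ^ 4 = 1 ∧ C * ε ≤ c := by
  refine ⟨min 1 (c / (|C| + 1)), (min 1 (c / (|C| + 1)) ^ 4)⁻¹, by positivity, min_le_left _ _,
    inv_mul_cancel₀ (by positivity), ?_⟩
  calc C * min 1 (c / (|C| + 1)) ≤ (|C| + 1) * (c / (|C| + 1)) := by
        gcongr
        · linarith [le_abs_self C]
        · exact min_le_right _ _
    _ = c := by field_simp

/-! ### Uniqueness -/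

section Uniqueness

variable {q v M M' : ℝ → ℂ}

lemma MemL2Pi.intervalIntegrable (hM : MemL2Pi M) :
    IntervalIntegrable (fun s => ((Real.pi - s : ℝ) : ℂ) * M s) volume 0 Real.pi :=
  MemL2.intervalIntegrable (f := fun s => ((Real.pi - s : ℝ) : ℂ) * M s) hM

/-- A function `M` solves the main equation with kernel `P` if and only if it is obtained from the
data and from the terms with the kernel by inverting the singular Volterra operator. -/
lemma hasDerivAt_side_iff_eq_hardyInv {P : ℝ → ℝ → ℂ} (hq : MemL2 q) (hv : MemL2 v)
    (hM : IntervalIntegrable (fun s => ((Real.pi - s : ℝ) : ℂ) * M s) volume 0 Real.pi)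
    (hP : Continuous (Function.uncurry P))
    (hK : ∀ t, 0 ≤ t → t ≤ Real.pi →
      P Real.pi t = kernelFreeTerm q M Real.pi t + kernelOperator q M P Real.pi t) :
    (∀ᵐ t ∂volPi, HasDerivAt (fun t => P Real.pi t) (-v (Real.pi - t)) t) ↔
      ∀ᵐ t ∂volPi, ((Real.pi - t : ℝ) : ℂ) * M t
        = hardyInv (mainData q v) t - hardyInv (kernelPart q M P) t := by
  have hg := intervalIntegrable_mainData hq.intervalIntegrable hv.intervalIntegrable
  have hN : IntervalIntegrable (kernelPart q M P) volume 0 Real.pi :=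
    (continuousOn_kernelPart hq.intervalIntegrable hM hP).intervalIntegrable_of_Icc Real.pi_pos.le
  rw [hasDerivAt_side_iff hq.intervalIntegrable hM hP hK,
    weight_sub_primitive_iff (g := fun t => mainData q v t - kernelPart q M P t) hM (hg.sub hN),
    ae_volPi_iff, ae_volPi_iff]
  refine Filter.eventually_congr (Filter.Eventually.of_forall fun t => ?_)
  refine imp_congr_right fun ht => ?_
  rw [hardyInv_sub hg hN ht.1.le ht.2.le]

/-- The kernel of a solution of the main equation may be taken to be continuous on the plane. -/
lemma IsMainSolution.exists_kernel (hq : MemL2 q) (hv : MemL2 v) (hM : IsMainSolution q v M) :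
    ∃ P : ℝ → ℝ → ℂ, Continuous (Function.uncurry P) ∧
      (∀ x t, 0 ≤ t → t ≤ x → x ≤ Real.pi →
        P x t = kernelFreeTerm q M x t + kernelOperator q M P x t) ∧
      ∀ᵐ t ∂volPi, ((Real.pi - t : ℝ) : ℂ) * M t
        = hardyInv (mainData q v) t - hardyInv (kernelPart q M P) t := by
  obtain ⟨hM2, P, ⟨hPc, hPe⟩, hd⟩ := hM
  have hK : ∀ x t, 0 ≤ t → t ≤ x → x ≤ Real.pi →
      triExt P x t = kernelFreeTerm q M x t + kernelOperator q M (triExt P) x t := by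
    intro x t h1 h2 h3
    rw [triExt_eq P h1 h2 h3, hPe x t h1 h2 h3,
      kernelOperator_congr (fun x t h1 h2 h3 => triExt_eq P h1 h2 h3) h1 h2 h3]
  refine ⟨triExt P, continuous_triExt hPc, hK, ?_⟩
  rw [← hasDerivAt_side_iff_eq_hardyInv hq hv hM2.intervalIntegrable (continuous_triExt hPc)
    fun t h1 h2 => hK Real.pi t h1 h2 le_rfl, ae_volPi_iff]
  filter_upwards [ae_volPi_iff.1 hd] with t ht htpi
  refine (ht htpi).congr_of_eventuallyEq ?_
  filter_upwards [Ioo_mem_nhds htpi.1 htpi.2] with r hr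
  exact triExt_eq P hr.1.le hr.2.le le_rfl

/-- Uniqueness: iterating the contraction estimate, with the weight chosen for the two given
solutions, shows that their weighted distance is zero. -/
theorem IsMainSolution.ae_unique (hq : MemL2 q) (hv : MemL2 v) (hM : IsMainSolution q v M)
    (hM' : IsMainSolution q v M') : M' =ᵐ[volPi] M := by
  obtain ⟨P, hP, hK, hf⟩ := hM.exists_kernel hq hv
  obtain ⟨P', hP', hK', hf'⟩ := hM'.exists_kernel hq hv
  have hqi := hq.intervalIntegrable
  have hMi := hM.1.intervalIntegrable
  have hMi' := hM'.1.intervalIntegrable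
  set N := kernelPart q M P with hN
  set N' := kernelPart q M' P' with hN'
  have hNc : ContinuousOn N (Icc 0 Real.pi) := continuousOn_kernelPart hqi hMi hP
  have hNc' : ContinuousOn N' (Icc 0 Real.pi) := continuousOn_kernelPart hqi hMi' hP'
  have hNi : IntervalIntegrable N volume 0 Real.pi :=
    hNc.intervalIntegrable_of_Icc Real.pi_pos.le
  have hNi' : IntervalIntegrable N' volume 0 Real.pi :=
    hNc'.intervalIntegrable_of_Icc Real.pi_pos.le
  have h0 : ∫ s in (0 : ℝ)..Real.pi, (N' s - N s) = 0 := by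
    rw [intervalIntegral.integral_sub hNi' hNi, integral_kernelPart_pi hqi hMi hP,
      integral_kernelPart_pi hqi hMi' hP', sub_zero]
  have hΔ : ∀ᵐ t ∂volPi, ((Real.pi - t : ℝ) : ℂ) * (M t - M' t)
      = hardyInv (fun s => N' s - N s) t := by
    rw [ae_volPi_iff]
    filter_upwards [ae_volPi_iff.1 hf, ae_volPi_iff.1 hf'] with t h1 h2 ht
    rw [hardyInv_sub hNi' hNi ht.1.le ht.2.le, mul_sub, h1 ht, h2 ht]
    ring
  -- only bounds that do not depend on the weight `L` may enter its choice
  obtain ⟨a, ha, hPa⟩ := exists_bound_of_continuous hP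
  obtain ⟨a', ha', hPa'⟩ := exists_bound_of_continuous hP'
  obtain ⟨ν, hν⟩ := (isCompact_Icc (a := (0 : ℝ)) (b := Real.pi)).exists_bound_of_continuousOn
    (hNc.sub hNc')
  set A := ∫ s in (0 : ℝ)..Real.pi, ‖q s‖ with hA
  have hA0 : 0 ≤ A := intervalIntegral.integral_nonneg Real.pi_pos.le fun _ _ => norm_nonneg _
  set f' : ℝ → ℂ := fun s => ((Real.pi - s : ℝ) : ℂ) * M' s with hf'_def
  have hf'2 : MemL2 f' := hM'.1
  set S := (normL2 f').toReal with hS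
  have hSle : normL2 f' ≤ ENNReal.ofReal S := (ENNReal.ofReal_toReal hf'2.2.ne).ge
  obtain ⟨ε, L, hε, hε1, hL, hC⟩ := exists_small_parameter
    (C := 3 * A + 4 + 12 * (a + 1) * Real.pi + 12 * (a + Real.pi) + 3 * (S + 0 * Real.pi))
    (c := 1 / 2) (by norm_num)
  have hκ : 0 < ε ^ 4 := by positivity
  have hL0 : 0 ≤ L := (pos_of_mul_pos_left (hL ▸ one_pos) hκ.le).le
  have hexp : ∀ t, 0 ≤ t → 1 ≤ Real.exp (L * t) := fun t ht =>
    Real.one_le_exp (mul_nonneg hL0 ht)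
  set D₀ := max ν 0 + (a + a') / ε with hD₀
  have hD₀0 : 0 ≤ D₀ := by positivity
  have key : ∀ j : ℕ,
      (∀ t, 0 ≤ t → t ≤ Real.pi → ‖N t - N' t‖ ≤ (D₀ * (1 / 2) ^ j) * Real.exp (L * t)) ∧
      ∀ x t, 0 ≤ t → t ≤ x → x ≤ Real.pi →
        ‖P x t - P' x t‖ ≤ ε * (D₀ * (1 / 2) ^ j) * Real.exp (L * t) := by
    intro j
    induction j with
    | zero =>
      simp only [pow_zero, mul_one]
      constructor
      · intro t h1 h2
        calc ‖N t - N' t‖ ≤ ν := hν t ⟨h1, h2⟩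
          _ ≤ D₀ * 1 := by
            have : 0 ≤ (a + a') / ε := by positivity
            linarith [le_max_left ν 0]
          _ ≤ D₀ * Real.exp (L * t) := by
            have := hexp t h1
            gcongr
      · intro x t h1 h2 h3
        have e1 := hPa x ⟨h1.trans h2, h3⟩ t ⟨h1, h2.trans h3⟩
        have e2 := hPa' x ⟨h1.trans h2, h3⟩ t ⟨h1, h2.trans h3⟩
        calc ‖P x t - P' x t‖ ≤ a + a' := (norm_sub_le _ _).trans (add_le_add e1 e2)
          _ = ε * ((a + a') / ε) := by field_simp
          _ ≤ ε * D₀ * 1 := by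
            rw [mul_one]
            gcongr
            linarith [le_max_right ν 0]
          _ ≤ ε * D₀ * Real.exp (L * t) := by
            have := hexp t h1
            gcongr
    | succ j ih =>
      have hMD : ∀ᵐ s ∂volPi, ‖((Real.pi - s : ℝ) : ℂ) * (M s - M' s)‖
          ≤ 4 * (D₀ * (1 / 2) ^ j) * Real.exp (L * s) := by
        rw [ae_volPi_iff]
        filter_upwards [ae_volPi_iff.1 hΔ] with s hs hspi
        rw [hs hspi]
        refine norm_hardyInv_le (hNc'.sub hNc) h0 hκ hL (by positivity) (fun r hr => ?_)
          hspi.1.le hspi.2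
        rw [Pi.sub_apply, norm_sub_rev]
        exact ih.1 r hr.1 hr.2
      have hcon := contraction_estimate (n := 0) (b := 0) (φ := fun s => ‖f' s‖)
        hqi hMi hMi' hP hP' hA0 le_rfl hf'2.intervalIntegrable.norm
        (fun _ => norm_nonneg _) le_rfl (Filter.Eventually.of_forall fun s => by simp [hf'_def])
        (by positivity) (integral_norm_mul_exp_le hf'2 (by positivity) hSle hε hL) hε hε1 hL ha
        le_rfl hε.le (fun y t h1 h2 h3 => by
          simpa using hPa y ⟨h1.trans h2, h3⟩ t ⟨h1, h2.trans h3⟩) hC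
        (D := D₀ * (1 / 2) ^ j) (by positivity) ih.2 hMD
      constructor
      · intro t h1 h2
        refine (hcon.1 t h1 h2).trans_eq ?_
        ring
      · intro x t h1 h2 h3
        rw [hK x t h1 h2 h3, hK' x t h1 h2 h3, kernelTerm_eq hP hMi h1 h2 h3,
          kernelTerm_eq hP' hMi' h1 h2 h3, add_sub_add_left_eq_sub]
        refine (hcon.2 x t h1 h2 h3).trans_eq ?_
        ring
  have hNN : ∀ t, 0 ≤ t → t ≤ Real.pi → N' t - N t = 0 := by
    intro t h1 h2
    have hlim : Filter.Tendsto (fun j : ℕ => (D₀ * (1 / 2) ^ j) * Real.exp (L * t)) Filter.atTop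
        (nhds ((D₀ * 0) * Real.exp (L * t))) :=
      ((tendsto_pow_atTop_nhds_zero_of_lt_one (by norm_num) (by norm_num)).const_mul D₀).mul_const _
    have := ge_of_tendsto' hlim fun j => (key j).1 t h1 h2
    rw [mul_zero, zero_mul, norm_sub_rev] at this
    exact norm_le_zero_iff.1 this
  refine ae_volPi_iff.2 ?_
  filter_upwards [ae_volPi_iff.1 hΔ] with t ht htpi
  have h1 := ht htpi
  have h2 : ∫ s in (0 : ℝ)..t, (N' s - N s) = 0 := by
    rw [intervalIntegral.integral_congr (g := fun _ => (0 : ℂ))]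
    · simp
    · intro s hs
      rw [uIcc_of_le htpi.1.le] at hs
      exact hNN s hs.1 (hs.2.trans htpi.2.le)
  rw [hardyInv, h2, hNN t htpi.1.le htpi.2.le, zero_div, add_zero] at h1
  exact (sub_eq_zero.1 ((mul_eq_zero.1 h1).resolve_left (pi_sub_ne_zero htpi.2))).symm

end Uniqueness

/-! ### The fixed point -/

/-- The function `M` recovered from the data `f` and the sum `N` of the terms with the kernel:
`(π - t) M(t) = f(t) - (hardyInv N)(t)`. -/
noncomputable def recovered (f N : ℝ → ℂ) (t : ℝ) : ℂ :=
  (f t - hardyInv N t) / ((Real.pi - t : ℝ) : ℂ)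

section Recovered

variable {f N N' : ℝ → ℂ}

lemma weight_mul_recovered (f N : ℝ → ℂ) {t : ℝ} (ht : t < Real.pi) :
    ((Real.pi - t : ℝ) : ℂ) * recovered f N t = f t - hardyInv N t :=
  mul_div_cancel₀ _ (pi_sub_ne_zero ht)

lemma Continuous.memL2 (hN : Continuous N) : MemL2 N := by
  have : IsFiniteMeasure volPi := ⟨by simp [volPi]⟩
  obtain ⟨C, hC⟩ := (isCompact_Icc (a := (0 : ℝ)) (b := Real.pi)).exists_bound_of_continuousOn
    hN.continuousOn
  exact MemLp.of_bound hN.aestronglyMeasurable C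
    (ae_volPi_iff.2 (Filter.Eventually.of_forall fun t ht => hC t ⟨ht.1.le, ht.2.le⟩))

lemma memL2Pi_recovered (hf : MemL2 f) (hN : Continuous N)
    (h0 : ∫ s in (0 : ℝ)..Real.pi, N s = 0) : MemL2Pi (recovered f N) := by
  refine (memLp_congr_ae ?_).2 (MemLp.sub hf (memL2_hardyInv hN.memL2 h0).1)
  exact ae_volPi_iff.2 (Filter.Eventually.of_forall fun t ht => weight_mul_recovered f N ht.2)

variable {L κ ν : ℝ} (hκ : 0 < κ) (hL : L * κ = 1)

include hκ hL in
lemma norm_weight_mul_recovered_le (hN : Continuous N)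
    (h0 : ∫ s in (0 : ℝ)..Real.pi, N s = 0) (hν : 0 ≤ ν)
    (hb : ∀ s ∈ Icc 0 Real.pi, ‖N s‖ ≤ ν * Real.exp (L * s)) :
    ∀ᵐ s ∂volPi, ‖((Real.pi - s : ℝ) : ℂ) * recovered f N s‖
      ≤ ‖f s‖ + 4 * ν * Real.exp (L * s) := by
  refine ae_volPi_iff.2 (Filter.Eventually.of_forall fun t ht => ?_)
  rw [weight_mul_recovered f N ht.2]
  exact (norm_sub_le _ _).trans (add_le_add le_rfl
    (norm_hardyInv_le hN.continuousOn h0 hκ hL hν hb ht.1.le ht.2))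

include hκ hL in
lemma norm_weight_mul_recovered_sub_le (hN : Continuous N) (hN' : Continuous N')
    (h0 : ∫ s in (0 : ℝ)..Real.pi, N s = 0) (h0' : ∫ s in (0 : ℝ)..Real.pi, N' s = 0)
    (hν : 0 ≤ ν) (hb : ∀ s ∈ Icc 0 Real.pi, ‖N s - N' s‖ ≤ ν * Real.exp (L * s)) :
    ∀ᵐ s ∂volPi, ‖((Real.pi - s : ℝ) : ℂ) * (recovered f N s - recovered f N' s)‖
      ≤ 4 * ν * Real.exp (L * s) := by
  have hi : ∀ {N : ℝ → ℂ}, Continuous N → IntervalIntegrable N volume 0 Real.pi :=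
    fun h => h.intervalIntegrable _ _
  refine ae_volPi_iff.2 (Filter.Eventually.of_forall fun t ht => ?_)
  have e : ((Real.pi - t : ℝ) : ℂ) * (recovered f N t - recovered f N' t)
      = hardyInv (fun s => N' s - N s) t := by
    rw [hardyInv_sub (hi hN') (hi hN) ht.1.le ht.2.le, mul_sub, weight_mul_recovered f N ht.2,
      weight_mul_recovered f N' ht.2]
    ring
  rw [e]
  refine norm_hardyInv_le (hN'.sub hN).continuousOn ?_ hκ hL hν (fun s hs => ?_) ht.1.le ht.2
  · simp only [Pi.sub_apply]
    rw [intervalIntegral.integral_sub (hi hN') (hi hN), h0, h0', sub_zero]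
  · rw [Pi.sub_apply, norm_sub_rev]
    exact hb s hs

end Recovered

lemma continuousOn_kernelMap {q M : ℝ → ℂ} {P : ℝ → ℝ → ℂ}
    (hq : IntervalIntegrable q volume 0 Real.pi)
    (hM : IntervalIntegrable (fun s => ((Real.pi - s : ℝ) : ℂ) * M s) volume 0 Real.pi)
    (hP : Continuous (Function.uncurry P)) :
    ContinuousOn (fun p : ℝ × ℝ => kernelMap q M P p.1 p.2) triangle :=
  ((continuousOn_charInt hq hP).add (continuousOn_convInt hM hP)).add (continuousOn_freeConv hM)

/-- The estimates by which a ball, of radius independent of `L = ε⁻⁴`, is mapped into itself. -/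
lemma self_map_estimate {q M : ℝ → ℂ} {P : ℝ → ℝ → ℂ} {A S n ε L : ℝ} {φ : ℝ → ℝ}
    (hq : IntervalIntegrable q volume 0 Real.pi)
    (hM : IntervalIntegrable (fun s => ((Real.pi - s : ℝ) : ℂ) * M s) volume 0 Real.pi)
    (hA0 : 0 ≤ A) (hA : ∫ s in (0 : ℝ)..Real.pi, ‖q s‖ ≤ A)
    (hφ : IntervalIntegrable φ volume 0 Real.pi) (hφ0 : ∀ s, 0 ≤ φ s) (hn : 0 ≤ n)
    (hMφ : ∀ᵐ s ∂volPi, ‖((Real.pi - s : ℝ) : ℂ) * M s‖ ≤ φ s + n * Real.exp (L * s))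
    (hS : 0 ≤ S) (hσ : ∫ s in (0 : ℝ)..Real.pi, φ s * Real.exp (-(L * s)) ≤ S * ε ^ 2)
    (hε : 0 < ε) (hε1 : ε ≤ 1) (hL : L * ε ^ 4 = 1)
    (hPb : ∀ y t, 0 ≤ t → t ≤ y → y ≤ Real.pi → ‖P y t‖ ≤ A + ε * Real.exp (L * t))
    (hC : (3 * A * (S + n) + 3 * (S + n * Real.pi) + 3 * A * (A + 1)
      + 3 * (A + 1) * (S + n * Real.pi) + S + n) * ε ≤ 1) :
    (∀ t, 0 ≤ t → t ≤ Real.pi →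
      ‖kernelPart q M P t‖ ≤ (3 * A * (A + 1) + 1) * Real.exp (L * t)) ∧
    ∀ x t, 0 ≤ t → t ≤ x → x ≤ Real.pi →
      ‖(1 / 2 : ℂ) * kernelMap q M P x t‖ ≤ ε * Real.exp (L * t) := by
  have hpi := Real.pi_pos.le
  have hκ : 0 < ε ^ 4 := by positivity
  have hL0 : 0 ≤ L := (pos_of_mul_pos_left (hL ▸ one_pos) hκ.le).le
  have p2 : ε ^ 2 ≤ 1 := pow_le_one₀ hε.le hε1
  have p2' : ε ^ 2 ≤ ε := pow_le_of_le_one hε.le hε1 (by norm_num)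
  have p4 : ε ^ 4 ≤ ε := pow_le_of_le_one hε.le hε1 (by norm_num)
  have p42 : ε ^ 4 ≤ ε ^ 2 := pow_le_pow_of_le_one hε.le hε1 (by norm_num)
  constructor
  · intro t ht0 ht
    have hE := Real.exp_pos (L * t)
    have e1 := norm_charDeriv_le_exp hq hA hL0 hA0 hε.le hPb ht0 ht le_rfl
    have e2 := norm_convDeriv_le_exp hM hφ hφ0 hn hMφ hσ hκ hL hA0 hε.le hPb ht0 ht le_rfl
    refine (norm_add_le _ _).trans ((add_le_add e1 e2).trans ?_)
    rw [← add_mul]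
    refine mul_le_mul_of_nonneg_right ?_ hE.le
    calc 3 * A * (A + ε) + 3 * (A * (S * ε ^ 2 + n * ε ^ 4) + ε * (S * ε ^ 2 + n * Real.pi))
        ≤ 3 * A * (A + 1) + 3 * (A * (S * ε + n * ε) + ε * (S * 1 + n * Real.pi)) := by gcongr
      _ = 3 * A * (A + 1) + (3 * A * (S + n) + 3 * (S + n * Real.pi)) * ε := by ring
      _ ≤ 3 * A * (A + 1) + (3 * A * (S + n) + 3 * (S + n * Real.pi) + 3 * A * (A + 1)
          + 3 * (A + 1) * (S + n * Real.pi) + S + n) * ε := by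
          refine add_le_add le_rfl (mul_le_mul_of_nonneg_right ?_ hε.le)
          have : 0 ≤ 3 * A * (A + 1) + 3 * (A + 1) * (S + n * Real.pi) + S + n := by positivity
          linarith
      _ ≤ _ := by gcongr
  · intro x t ht0 htx hx
    have hE := Real.exp_pos (L * t)
    have e1 := norm_charInt_le_exp hq hA hκ hL hA0 hε.le hPb ht0 htx hx
    have e2 := norm_convInt_le_exp hM hφ hφ0 hn hMφ hσ hκ hL hA0 hε.le hPb ht0 htx hx
    have e3 := norm_freeConv_le_exp hM hφ hφ0 hn hMφ hσ hκ hL ht0 htx hx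
    have hhalf : ‖(1 / 2 : ℂ)‖ ≤ 1 := by norm_num
    rw [norm_mul]
    refine (mul_le_of_le_one_left (norm_nonneg _) hhalf).trans ?_
    refine (norm_add₃_le).trans ((add_le_add (add_le_add e1 e2) e3).trans ?_)
    rw [← add_mul, ← add_mul]
    refine mul_le_mul_of_nonneg_right ?_ hE.le
    calc 3 * A * (A + ε) * ε ^ 4 + 3 * (A + ε) * ε ^ 4 * (S * ε ^ 2 + n * Real.pi)
          + (S * ε ^ 2 + n * ε ^ 4)
        ≤ 3 * A * (A + 1) * ε ^ 2 + 3 * (A + 1) * ε ^ 2 * (S * 1 + n * Real.pi)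
          + (S * ε ^ 2 + n * ε ^ 2) := by gcongr
      _ = (3 * A * (A + 1) + 3 * (A + 1) * (S + n * Real.pi) + S + n) * ε * ε := by ring
      _ ≤ (3 * A * (S + n) + 3 * (S + n * Real.pi) + 3 * A * (A + 1)
          + 3 * (A + 1) * (S + n * Real.pi) + S + n) * ε * ε := by
          refine mul_le_mul_of_nonneg_right (mul_le_mul_of_nonneg_right ?_ hε.le) hε.le
          have : 0 ≤ 3 * A * (S + n) + 3 * (S + n * Real.pi) := by positivity
          linarith
      _ ≤ 1 * ε := by gcongr
      _ = ε := one_mul ε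

section FixedPoint

/-- The function on the line with the values `e^{L t} N(t)` for `0 ≤ t ≤ π`. -/
noncomputable def weightedSide (L : ℝ) (N : C(Icc (0 : ℝ) Real.pi, ℂ)) (t : ℝ) : ℂ :=
  (Real.exp (L * t) : ℂ) * N (projIcc 0 Real.pi Real.pi_pos.le t)

/-- The function on the plane with the values
`½ ∫_{t/2}^{x-t/2} q + ε e^{L t} P(x, t)` on the triangle. -/
noncomputable def weightedKernel (q : ℝ → ℂ) (ε L : ℝ) (P : C(triangle, ℂ)) : ℝ → ℝ → ℂ :=
  triExt fun x t => (1 / 2 : ℂ) * (∫ s in (t / 2)..(x - t / 2), q s)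
    + (ε * Real.exp (L * t) : ℝ) * P ⟨_, retraction_mem_triangle x t⟩

variable {q : ℝ → ℂ} {ε L : ℝ}

lemma continuous_weightedSide (N : C(Icc (0 : ℝ) Real.pi, ℂ)) :
    Continuous (weightedSide L N) := by
  unfold weightedSide
  have : Continuous (projIcc (0 : ℝ) Real.pi Real.pi_pos.le) := continuous_projIcc
  fun_prop

lemma weightedSide_eq (N : C(Icc (0 : ℝ) Real.pi, ℂ)) {t : ℝ} (ht : t ∈ Icc 0 Real.pi) :
    weightedSide L N t = (Real.exp (L * t) : ℂ) * N ⟨t, ht⟩ := by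
  rw [weightedSide, projIcc_of_mem _ ht]

lemma weightedKernel_eq (P : C(triangle, ℂ)) {p : ℝ × ℝ} (hp : p ∈ triangle) :
    weightedKernel q ε L P p.1 p.2 = (1 / 2 : ℂ) * (∫ s in (p.2 / 2)..(p.1 - p.2 / 2), q s)
      + (ε * Real.exp (L * p.2) : ℝ) * P ⟨p, hp⟩ := by
  obtain ⟨x, t⟩ := p
  obtain ⟨h1, h2, h3⟩ := id hp
  simp only at h1 h2 h3
  rw [weightedKernel, triExt_eq _ h1 h2 h3]
  simp only [min_eq_left h3, max_eq_right (h1.trans h2), min_eq_left h2, max_eq_right h1]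

lemma continuousOn_integral_side (hq : IntervalIntegrable q volume 0 Real.pi) :
    ContinuousOn (fun p : ℝ × ℝ => ∫ s in (p.2 / 2)..(p.1 - p.2 / 2), q s) triangle := by
  have := continuousOn_integral_weight isCompact_triangle Real.pi_pos.le hq
    (α := fun p : ℝ × ℝ => p.2 / 2) (β := fun p => p.1 - p.2 / 2) (Φ := fun _ _ => 1)
    (by fun_prop) (by fun_prop)
    (fun p hp => ⟨by linarith [hp.1], by linarith [hp.2.1], by linarith [hp.1, hp.2.2]⟩)
    (by fun_prop)
  simpa using this

lemma continuous_weightedKernel (hq : IntervalIntegrable q volume 0 Real.pi)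
    (P : C(triangle, ℂ)) : Continuous (Function.uncurry (weightedKernel q ε L P)) := by
  have h1 : Continuous fun p : ℝ × ℝ => ((ε * Real.exp (L * p.2) : ℝ) : ℂ) := by fun_prop
  have h2 : Continuous fun p : ℝ × ℝ => (⟨_, retraction_mem_triangle p.1 p.2⟩ : triangle) :=
    Continuous.subtype_mk (by fun_prop) _
  have h3 : Continuous fun p : ℝ × ℝ => P ⟨_, retraction_mem_triangle p.1 p.2⟩ :=
    P.continuous.comp h2
  exact continuous_triExt (((continuousOn_integral_side hq).const_smul (1 / 2 : ℂ)).add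
    (h1.mul h3).continuousOn)

lemma norm_half_integral_side_le (hq : IntervalIntegrable q volume 0 Real.pi) {A x t : ℝ}
    (hA : ∫ s in (0 : ℝ)..Real.pi, ‖q s‖ ≤ A) (ht : 0 ≤ t) (htx : t ≤ x)
    (hx : x ≤ Real.pi) : ‖(1 / 2 : ℂ) * ∫ s in (t / 2)..(x - t / 2), q s‖ ≤ A := by
  have h := norm_integral_mul_le (a := t / 2) (b := x - t / 2) (g := fun _ => 1) (R := 1) hq
    (by linarith) (by linarith) (by linarith) zero_le_one (by simp)
  simp only [mul_one] at h
  have hhalf : ‖(1 / 2 : ℂ)‖ ≤ 1 := by norm_num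
  rw [norm_mul]
  exact (mul_le_of_le_one_left (norm_nonneg _) hhalf).trans (h.trans hA)

/-- The system for the kernel `P` and the sum `N` of the terms with the kernel has a solution, with
a bound that depends only on bounds for `q` and for the data `f`. -/
lemma exists_solution_system {f : ℝ → ℂ} {A S : ℝ}
    (hq : IntervalIntegrable q volume 0 Real.pi) (hA0 : 0 ≤ A)
    (hA : ∫ s in (0 : ℝ)..Real.pi, ‖q s‖ ≤ A) (hf : MemL2 f) (hS0 : 0 ≤ S)
    (hS : normL2 f ≤ ENNReal.ofReal S) {ν n : ℝ} (hν : ν = 3 * A * (A + 1) + 1) (hn : n = 4 * ν)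
    (hε : 0 < ε) (hε1 : ε ≤ 1) (hL : L * ε ^ 4 = 1)
    (hC₁ : (3 * A + 4 + 12 * (A + 1) * Real.pi + 12 * (A + Real.pi) + 3 * (S + n * Real.pi)) * ε
      ≤ 1 / 2)
    (hC₂ : (3 * A * (S + n) + 3 * (S + n * Real.pi) + 3 * A * (A + 1)
      + 3 * (A + 1) * (S + n * Real.pi) + S + n) * ε ≤ 1) :
    ∃ (N : ℝ → ℂ) (P : ℝ → ℝ → ℂ), Continuous N ∧ ∫ s in (0 : ℝ)..Real.pi, N s = 0 ∧
      (∀ t ∈ Icc 0 Real.pi, ‖N t‖ ≤ ν * Real.exp (L * t)) ∧ Continuous (Function.uncurry P) ∧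
      (∀ t ∈ Icc 0 Real.pi, N t = kernelPart q (recovered f N) P t) ∧
      ∀ x t, 0 ≤ t → t ≤ x → x ≤ Real.pi →
        P x t = (1 / 2 : ℂ) * (∫ s in (t / 2)..(x - t / 2), q s)
          + (1 / 2 : ℂ) * kernelMap q (recovered f N) P x t := by
  have hpi := Real.pi_pos.le
  have hκ : 0 < ε ^ 4 := by positivity
  have hν0 : 0 ≤ ν := by rw [hν]; positivity
  have hn0 : 0 ≤ n := by rw [hn]; positivity
  have hσ := integral_norm_mul_exp_le hf hS0 hS hε hL
  have : CompactSpace triangle := isCompact_iff_compactSpace.1 isCompact_triangle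
  set s : Set (C(Icc (0 : ℝ) Real.pi, ℂ) × C(triangle, ℂ)) :=
    {e | ‖e.1‖ ≤ ν ∧ ‖e.2‖ ≤ 1 ∧ ∫ t in (0 : ℝ)..Real.pi, weightedSide L e.1 t = 0} with hs
  have hexp : ∀ t, (Real.exp (L * t) : ℂ) ≠ 0 := fun t => by
    exact_mod_cast (Real.exp_pos (L * t)).ne'
  -- the condition on the mean is closed, and it makes the recovered `M` an element of `L_{2,π}`
  have hsc : IsClosed s := by
    refine (isClosed_le continuous_fst.norm continuous_const).inter
      ((isClosed_le continuous_snd.norm continuous_const).inter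
        (isClosed_eq (Continuous.comp (g := fun N : C(Icc (0 : ℝ) Real.pi, ℂ) =>
          ∫ t in (0 : ℝ)..Real.pi, weightedSide L N t) ?_ continuous_fst) continuous_const))
    obtain ⟨C, hC⟩ := (isCompact_Icc (a := (0 : ℝ)) (b := Real.pi)).exists_bound_of_continuousOn
      (f := fun t => Real.exp (L * t)) (by fun_prop)
    refine LipschitzWith.continuous (K := (max C 0 * Real.pi).toNNReal)
      (LipschitzWith.of_dist_le_mul fun N N' => ?_)
    rw [dist_eq_norm, ← intervalIntegral.integral_sub
      ((continuous_weightedSide N).intervalIntegrable _ _)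
      ((continuous_weightedSide N').intervalIntegrable _ _), Real.coe_toNNReal _ (by positivity)]
    refine (intervalIntegral.norm_integral_le_of_norm_le_const (C := max C 0 * dist N N')
      fun t ht => ?_).trans_eq ?_
    · rw [uIoc_of_le hpi] at ht
      rw [weightedSide, weightedSide, ← mul_sub, norm_mul, Complex.norm_real, ← dist_eq_norm]
      exact mul_le_mul ((hC t ⟨ht.1.le, ht.2⟩).trans (le_max_left _ _))
        (ContinuousMap.dist_apply_le_dist _) dist_nonneg (le_max_right _ _)
    · rw [sub_zero, abs_of_nonneg hpi]
      ring
  have hne : (0 : C(Icc (0 : ℝ) Real.pi, ℂ) × C(triangle, ℂ)) ∈ s := by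
    refine ⟨by simpa using hν0, by simp, ?_⟩
    simp [weightedSide]
  have : CompleteSpace s := hsc.completeSpace_coe
  have : Nonempty s := ⟨⟨0, hne⟩⟩
  set NN : s → ℝ → ℂ := fun e => weightedSide L e.1.1 with hNN
  set PP : s → ℝ → ℝ → ℂ := fun e => weightedKernel q ε L e.1.2 with hPP
  set MM : s → ℝ → ℂ := fun e => recovered f (NN e) with hMM
  have cN : ∀ e, Continuous (NN e) := fun e => continuous_weightedSide _
  have cP : ∀ e, Continuous (Function.uncurry (PP e)) := fun e => continuous_weightedKernel hq _
  have bN : ∀ e, ∀ t ∈ Icc 0 Real.pi, ‖NN e t‖ ≤ ν * Real.exp (L * t) := by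
    intro e t ht
    rw [hNN]
    simp only
    rw [weightedSide_eq _ ht, norm_mul, Complex.norm_real,
      Real.norm_of_nonneg (Real.exp_pos _).le, mul_comm]
    have := (e.1.1.norm_coe_le_norm ⟨t, ht⟩).trans e.2.1
    gcongr
  have bP : ∀ e, ∀ x t, 0 ≤ t → t ≤ x → x ≤ Real.pi →
      ‖PP e x t‖ ≤ A + ε * Real.exp (L * t) := by
    intro e x t h1 h2 h3
    have hp : ((x, t) : ℝ × ℝ) ∈ triangle := ⟨h1, h2, h3⟩
    have := weightedKernel_eq (q := q) (ε := ε) (L := L) e.1.2 hp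
    simp only at this
    rw [hPP]
    simp only
    rw [this]
    refine (norm_add_le _ _).trans (add_le_add (norm_half_integral_side_le hq hA h1 h2 h3) ?_)
    have hE : 0 ≤ ε * Real.exp (L * t) := by positivity
    rw [norm_mul, Complex.norm_real, Real.norm_of_nonneg hE]
    exact mul_le_of_le_one_right hE ((e.1.2.norm_coe_le_norm _).trans e.2.2.1)
  have iM : ∀ e, IntervalIntegrable (fun s => ((Real.pi - s : ℝ) : ℂ) * MM e s) volume 0
      Real.pi := fun e => (memL2Pi_recovered hf (cN e) e.2.2.2).intervalIntegrable
  have bM : ∀ e, ∀ᵐ s ∂volPi, ‖((Real.pi - s : ℝ) : ℂ) * MM e s‖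
      ≤ ‖f s‖ + n * Real.exp (L * s) := fun e => by
    rw [hn]
    exact norm_weight_mul_recovered_le hκ hL (cN e) e.2.2.2 hν0 (bN e)
  have hmaps : ∀ e : s, ∃ e' : s,
      (∀ t : Icc (0 : ℝ) Real.pi, (Real.exp (L * t) : ℂ) * e'.1.1 t
        = kernelPart q (MM e) (PP e) t) ∧
      ∀ p : triangle, ((ε * Real.exp (L * p.1.2) : ℝ) : ℂ) * e'.1.2 p
        = (1 / 2 : ℂ) * kernelMap q (MM e) (PP e) p.1.1 p.1.2 := by
    intro e
    obtain ⟨h1, h2⟩ := self_map_estimate hq (iM e) hA0 hA hf.intervalIntegrable.norm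
      (fun _ => norm_nonneg _) hn0 (bM e) hS0 hσ hε hε1 hL (bP e) hC₂
    have hεexp : ∀ t : ℝ, ((ε * Real.exp (L * t) : ℝ) : ℂ) ≠ 0 := fun t => by
      have : 0 < ε * Real.exp (L * t) := by positivity
      exact_mod_cast this.ne'
    set N₁ : C(Icc (0 : ℝ) Real.pi, ℂ) :=
      ⟨fun t => kernelPart q (MM e) (PP e) t / (Real.exp (L * t) : ℂ),
        (continuousOn_iff_continuous_domRestrict.1
          (continuousOn_kernelPart hq (iM e) (cP e))).div (by fun_prop) fun t => hexp t⟩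
    set P₁ : C(triangle, ℂ) :=
      ⟨fun p => ((1 / 2 : ℂ) * kernelMap q (MM e) (PP e) p.1.1 p.1.2)
          / ((ε * Real.exp (L * p.1.2) : ℝ) : ℂ),
        (continuous_const.mul (continuousOn_iff_continuous_domRestrict.1
          (continuousOn_kernelMap hq (iM e) (cP e)))).div (by fun_prop) fun p => hεexp p.1.2⟩
    have e1 : ∀ t : Icc (0 : ℝ) Real.pi, (Real.exp (L * t) : ℂ) * N₁ t
        = kernelPart q (MM e) (PP e) t := fun t => mul_div_cancel₀ _ (hexp t)
    refine ⟨⟨(N₁, P₁), ?_, ?_, ?_⟩, e1, fun p => mul_div_cancel₀ _ (hεexp p.1.2)⟩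
    · refine (ContinuousMap.norm_le _ hν0).2 fun t => ?_
      have hE := Real.exp_pos (L * t)
      change ‖kernelPart q (MM e) (PP e) t / (Real.exp (L * t) : ℂ)‖ ≤ ν
      rw [norm_div, Complex.norm_real, Real.norm_of_nonneg hE.le,
        div_le_iff₀ hE, hν]
      exact h1 t t.2.1 t.2.2
    · refine (ContinuousMap.norm_le _ zero_le_one).2 fun p => ?_
      have hE : 0 < ε * Real.exp (L * p.1.2) := by positivity
      change ‖((1 / 2 : ℂ) * kernelMap q (MM e) (PP e) p.1.1 p.1.2)
        / ((ε * Real.exp (L * p.1.2) : ℝ) : ℂ)‖ ≤ 1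
      rw [norm_div, Complex.norm_real, Real.norm_of_nonneg hE.le,
        div_le_iff₀ hE, one_mul]
      exact h2 _ _ p.2.1 p.2.2.1 p.2.2.2
    · rw [← integral_kernelPart_pi hq (iM e) (cP e)]
      refine intervalIntegral.integral_congr fun t ht => ?_
      rw [uIcc_of_le hpi] at ht
      simp only
      rw [weightedSide_eq _ ht]
      exact e1 ⟨t, ht⟩
  choose Φ hΦN hΦP using hmaps
  have hΦ : ContractingWith (1 / 2) Φ := by
    refine ⟨by norm_num, LipschitzWith.of_dist_le_mul fun e e' => ?_⟩
    set D := dist e e' with hD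
    have d1 : dist e.1.1 e'.1.1 ≤ D := le_max_left _ _
    have d2 : dist e.1.2 e'.1.2 ≤ D := le_max_right _ _
    have hD0 : 0 ≤ D := dist_nonneg
    have hND : ∀ t ∈ Icc 0 Real.pi, ‖NN e t - NN e' t‖ ≤ D * Real.exp (L * t) := by
      intro t ht
      rw [hNN]
      simp only
      rw [weightedSide_eq _ ht, weightedSide_eq _ ht, ← mul_sub, norm_mul, Complex.norm_real,
        Real.norm_of_nonneg (Real.exp_pos _).le, mul_comm, ← dist_eq_norm]
      have := (ContinuousMap.dist_apply_le_dist (f := e.1.1) (g := e'.1.1) ⟨t, ht⟩).trans d1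
      gcongr
    have hPD : ∀ x t, 0 ≤ t → t ≤ x → x ≤ Real.pi →
        ‖PP e x t - PP e' x t‖ ≤ ε * D * Real.exp (L * t) := by
      intro x t h1 h2 h3
      have hp : ((x, t) : ℝ × ℝ) ∈ triangle := ⟨h1, h2, h3⟩
      have k1 := weightedKernel_eq (q := q) (ε := ε) (L := L) e.1.2 hp
      have k2 := weightedKernel_eq (q := q) (ε := ε) (L := L) e'.1.2 hp
      simp only at k1 k2
      have hE : 0 ≤ ε * Real.exp (L * t) := by positivity
      rw [hPP]
      simp only
      rw [k1, k2, add_sub_add_left_eq_sub, ← mul_sub, norm_mul, Complex.norm_real,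
        Real.norm_of_nonneg hE, ← dist_eq_norm]
      exact (mul_le_mul_of_nonneg_left ((ContinuousMap.dist_apply_le_dist _).trans d2)
        hE).trans_eq (by ring)
    have hcon := contraction_estimate hq (iM e) (iM e') (cP e) (cP e') hA0 hA
      hf.intervalIntegrable.norm (fun _ => norm_nonneg _) hn0 (bM e') hS0 hσ hε hε1 hL hA0 hε.le
      le_rfl (bP e) hC₁ hD0 hPD
      (norm_weight_mul_recovered_sub_le hκ hL (cN e) (cN e') e.2.2.2 e'.2.2.2 hD0 hND)
    have hhalf : (((1 / 2 : NNReal) : NNReal) : ℝ) = 1 / 2 := by norm_num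
    rw [hhalf]
    refine max_le ?_ ?_
    · refine (ContinuousMap.dist_le (by positivity)).2 fun t => ?_
      have hE := Real.exp_pos (L * t)
      have := hcon.1 t t.2.1 t.2.2
      rw [← hΦN e t, ← hΦN e' t, ← mul_sub, norm_mul, Complex.norm_real,
        Real.norm_of_nonneg hE.le, ← dist_eq_norm, mul_comm] at this
      exact le_of_mul_le_mul_right this hE
    · refine (ContinuousMap.dist_le (by positivity)).2 fun p => ?_
      have hE : 0 < ε * Real.exp (L * p.1.2) := by positivity
      have := hcon.2 p.1.1 p.1.2 p.2.1 p.2.2.1 p.2.2.2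
      rw [← hΦP e p, ← hΦP e' p, ← mul_sub, norm_mul, Complex.norm_real,
        Real.norm_of_nonneg hE.le, ← dist_eq_norm, mul_comm] at this
      refine le_of_mul_le_mul_right (this.trans_eq ?_) hE
      ring
  set e := ContractingWith.fixedPoint Φ hΦ with he
  have hfix : Φ e = e := hΦ.fixedPoint_isFixedPt
  have h1 := hΦN e
  have h2 := hΦP e
  rw [hfix] at h1 h2
  refine ⟨NN e, PP e, cN e, e.2.2.2, bN e, cP e, fun t ht => ?_, fun x t h3 h4 h5 => ?_⟩
  · exact (weightedSide_eq _ ht).trans (h1 ⟨t, ht⟩)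
  · have hp : ((x, t) : ℝ × ℝ) ∈ triangle := ⟨h3, h4, h5⟩
    exact (weightedKernel_eq (q := q) (ε := ε) (L := L) e.1.2 hp).trans
      (congrArg _ (h2 ⟨(x, t), hp⟩))

end FixedPoint

/-! ### Existence with a uniform bound -/

/-- The constant comes from `π ≤ 4`. -/
lemma normL2_le_of_forall_norm_le {g : ℝ → ℂ} {C : ℝ} (hC : 0 ≤ C)
    (h : ∀ t ∈ Ioo 0 Real.pi, ‖g t‖ ≤ C) : normL2 g ≤ ENNReal.ofReal (2 * C) := by
  rw [← ENNReal.pow_le_pow_left_iff two_ne_zero, normL2_sq, ← ENNReal.ofReal_pow (by positivity)]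
  calc ∫⁻ x in Ioo 0 Real.pi, ‖g x‖ₑ ^ 2
      ≤ ∫⁻ _ in Ioo 0 Real.pi, ENNReal.ofReal (C ^ 2) := by
        refine setLIntegral_mono' measurableSet_Ioo fun x hx => ?_
        rw [ENNReal.ofReal_pow hC, ← ofReal_norm]
        gcongr
        exact h x hx
    _ = ENNReal.ofReal (C ^ 2 * Real.pi) := by
        rw [setLIntegral_const, Real.volume_Ioo, sub_zero, ENNReal.ofReal_mul (by positivity)]
    _ ≤ ENNReal.ofReal ((2 * C) ^ 2) := by
        refine ENNReal.ofReal_le_ofReal ?_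
        nlinarith [Real.pi_le_four, sq_nonneg C]

/-- Solutions exist and are bounded uniformly for `q` and `v` in a ball. -/
theorem exists_isMainSolution_le {r : ℝ} (hr : 0 < r) : ∃ C : ℝ, 0 < C ∧
    ∀ q v : ℝ → ℂ, MemL2 q → MemL2 v →
      (∫ x in (0 : ℝ)..Real.pi, v x) = (1 / 2 : ℂ) * ∫ x in (0 : ℝ)..Real.pi, q x →
      normL2 v ≤ ENNReal.ofReal r → normL2 q ≤ ENNReal.ofReal r →
      ∃ M : ℝ → ℂ, IsMainSolution q v M ∧ normL2Pi M ≤ ENNReal.ofReal C := by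
  -- `A` bounds the `L₁` norm of `q` and `S` the `L₂` norm of the inverted data, which is at most
  -- `3 (2 r + 2 r)`; all further constants depend on these two only
  set A := 2 * r with hA
  set S := 12 * r with hS
  set ν := 3 * A * (A + 1) + 1 with hν
  set n := 4 * ν with hn
  have hA0 : 0 ≤ A := by positivity
  have hS0 : 0 ≤ S := by positivity
  have hν0 : 0 ≤ ν := by positivity
  have hn0 : 0 ≤ n := by positivity
  have hpi := Real.pi_pos
  set C₁ := 3 * A + 4 + 12 * (A + 1) * Real.pi + 12 * (A + Real.pi) + 3 * (S + n * Real.pi)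
  set C₂ := 3 * A * (S + n) + 3 * (S + n * Real.pi) + 3 * A * (A + 1)
      + 3 * (A + 1) * (S + n * Real.pi) + S + n
  have hC₁ : 0 ≤ C₁ := by positivity
  have hC₂ : 0 ≤ C₂ := by positivity
  obtain ⟨ε, L, hε, hε1, hL, hC⟩ := exists_small_parameter (C := C₁ + C₂) (c := 1 / 2)
    (by norm_num)
  have hc1 : C₁ * ε ≤ 1 / 2 := by
    have := mul_nonneg hC₂ hε.le
    linarith
  have hc2 : C₂ * ε ≤ 1 := by
    have := mul_nonneg hC₁ hε.le
    linarith
  have hκ : 0 < ε ^ 4 := by positivity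
  have hL0 : 0 ≤ L := (pos_of_mul_pos_left (hL ▸ one_pos) hκ.le).le
  refine ⟨S + 2 * (n * Real.exp (L * Real.pi)), by positivity,
    fun q v hq hv hqv hvr hqr => ?_⟩
  have hqi := hq.intervalIntegrable
  have hvi := hv.intervalIntegrable
  obtain ⟨hg, hgn⟩ := memL2_mainData hq hv
  obtain ⟨hf, hfn⟩ := memL2_hardyInv hg (integral_mainData hqi hvi hqv)
  have hfS : normL2 (hardyInv (mainData q v)) ≤ ENNReal.ofReal S := by
    refine hfn.trans ?_
    calc 3 * normL2 (mainData q v) ≤ 3 * (2 * ENNReal.ofReal r + 2 * ENNReal.ofReal r) := by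
          gcongr
          exact hgn.trans (by gcongr)
      _ = ENNReal.ofReal S := by
          rw [hS, ENNReal.ofReal_mul (by norm_num), ENNReal.ofReal_ofNat]
          ring
  obtain ⟨N, P, hN, hN0, hNν, hP, hNP, hPP⟩ := exists_solution_system hqi hA0
    (integral_norm_le hq hr.le hqr) hf hS0 hfS hν hn hε hε1 hL hc1 hc2
  set M := recovered (hardyInv (mainData q v)) N with hM
  have hM2 : MemL2Pi M := memL2Pi_recovered hf hN hN0
  have hMi := hM2.intervalIntegrable
  have hK : ∀ x t, 0 ≤ t → t ≤ x → x ≤ Real.pi →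
      P x t = kernelFreeTerm q M x t + kernelOperator q M P x t := fun x t h1 h2 h3 => by
    rw [kernelTerm_eq hP hMi h1 h2 h3]
    exact hPP x t h1 h2 h3
  refine ⟨M, ⟨hM2, P, ⟨hP.continuousOn, hK⟩, ?_⟩, ?_⟩
  · refine (hasDerivAt_side_iff_eq_hardyInv hq hv hMi hP
      fun t h1 h2 => hK Real.pi t h1 h2 le_rfl).2 (ae_volPi_iff.2 ?_)
    refine Filter.Eventually.of_forall fun t ht => ?_
    have e : hardyInv N t = hardyInv (kernelPart q M P) t := by
      unfold hardyInv
      rw [hNP t ⟨ht.1.le, ht.2.le⟩, intervalIntegral.integral_congr fun s hs => ?_]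
      rw [uIcc_of_le ht.1.le] at hs
      exact hNP s ⟨hs.1, hs.2.trans ht.2.le⟩
    rw [← e]
    exact weight_mul_recovered _ _ ht.2
  · have e : normL2Pi M = normL2 (fun t => hardyInv (mainData q v) t - hardyInv N t) :=
      eLpNorm_congr_ae (ae_volPi_iff.2
        (Filter.Eventually.of_forall fun t ht => weight_mul_recovered _ _ ht.2))
    have hb : normL2 (hardyInv N) ≤ ENNReal.ofReal (2 * (n * Real.exp (L * Real.pi))) := by
      refine normL2_le_of_forall_norm_le (by positivity) fun t ht => ?_
      refine (norm_hardyInv_le hN.continuousOn hN0 hκ hL hν0 hNν ht.1.le ht.2).trans ?_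
      have := ht.2.le
      rw [hn]
      gcongr
    rw [e, ENNReal.ofReal_add hS0 (by positivity)]
    exact (eLpNorm_sub_le hf.aestronglyMeasurable
      (memL2_hardyInv hN.memL2 hN0).1.aestronglyMeasurable one_le_two).trans (add_le_add hfS hb)

theorem theorem4 :
    (∀ q v : ℝ → ℂ, MemL2 q → MemL2 v →
      (∫ x in (0 : ℝ)..Real.pi, v x) = (1 / 2 : ℂ) * ∫ x in (0 : ℝ)..Real.pi, q x →
      ∃ M : ℝ → ℂ, IsMainSolution q v M ∧
        ∀ M' : ℝ → ℂ, IsMainSolution q v M' → M' =ᵐ[volPi] M) ∧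
    (∀ r : ℝ, 0 < r → ∃ C : ℝ, 0 < C ∧
      ∀ q v : ℝ → ℂ, MemL2 q → MemL2 v →
      (∫ x in (0 : ℝ)..Real.pi, v x) = (1 / 2 : ℂ) * ∫ x in (0 : ℝ)..Real.pi, q x →
      normL2 v ≤ ENNReal.ofReal r → normL2 q ≤ ENNReal.ofReal r →
      ∀ M : ℝ → ℂ, IsMainSolution q v M → normL2Pi M ≤ ENNReal.ofReal C) := by
  constructor
  · intro q v hq hv hqv
    set r := max (normL2 v).toReal (normL2 q).toReal + 1 with hr
    have hr0 : 0 < r := by positivity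
    have hle : ∀ {f : ℝ → ℂ}, MemL2 f → (normL2 f).toReal ≤ r → normL2 f ≤ ENNReal.ofReal r :=
      fun hf h => (ENNReal.le_ofReal_iff_toReal_le hf.2.ne hr0.le).2 h
    obtain ⟨C, _, hC⟩ := exists_isMainSolution_le hr0
    obtain ⟨M, hM, _⟩ := hC q v hq hv hqv
      (hle hv (by linarith [le_max_left (normL2 v).toReal (normL2 q).toReal]))
      (hle hq (by linarith [le_max_right (normL2 v).toReal (normL2 q).toReal]))
    exact ⟨M, hM, fun M' hM' => hM.ae_unique hq hv hM'⟩
  · intro r hr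
    obtain ⟨C, hC0, hC⟩ := exists_isMainSolution_le hr
    refine ⟨C, hC0, fun q v hq hv hqv hvr hqr M hM => ?_⟩
    obtain ⟨M₀, hM₀, hle⟩ := hC q v hq hv hqv hvr hqr
    refine (eLpNorm_congr_ae ?_).trans_le hle
    filter_upwards [hM₀.ae_unique hq hv hM] with t ht
    rw [ht]
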